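/- **Setting.** Let $A$ be a $C^*$-algebra (not necessarily unital). A $C^*$-correspondence over $A$ is a right Hilbert $C^*$-module $E$ over $A$ with a left action of $A$ by a $*$-homomorphism $\varphi$ into the adjointable operators on $E$; all correspondences are assumed essential, i.e. $\overline{\operatorname{span}}\,\varphi(A)E=E$. All representations of $A$ on Hilbert spaces are nondegenerate $*$-representations. For a representation $\sigma$ of $A$ on $H$, $E\otimes_\sigma H$ denotes the Hilbert space completion of the (quotient of the) algebraic tensor product for $\langle \xi\otimes h,\eta\otimes h'\rangle=\langle h,\sigma(\langle\xi,\eta\rangle)h'\rangle$. Let $k\in\mathbb N_0$ and let $\mathbb E$ be a product system of $C^*$-correspondences over $\mathbb N_0^k$: a family of correspondences $(\mathbb E(n))_{n\in\mathbb N_0^k}$ with $\mathbb E(0)=A$ and an associative multiplication inducing isomorphisms of correspondences $\mathbb E(m)\otimes_A\mathbb E(n)\cong\mathbb E(m+n)$, where multiplication by elements of $\mathbb E(0)=A$ is given by the left and right module actions. Write $E_i=\mathbb E(e_i)$ for the standard basis elements $e_i$, and let $t_{i,j}:E_i\otimes_A E_j\cong\mathbb E(e_i+e_j)\cong E_j\otimes_A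 E_i$ be the resulting isomorphisms. An *isometric representation* $(\sigma,T^{(1)},\dots,T^{(k)})$ of $\mathbb E$ on a Hilbert space $H$ consists of a representation $\sigma$ of $A$ on $H$ and linear maps $T^{(i)}:E_i\to B(H)$ with $T^{(i)}(a\xi b)=\sigma(a)T^{(i)}(\xi)\sigma(b)$ and $T^{(i)}(\xi)^*T^{(i)}(\eta)=\sigma(\langle\xi,\eta\rangle)$, such that the isometries $\widetilde T^{(i)}:E_i\otimes_\sigma H\to H$, $\widetilde T^{(i)}(\xi\otimes h)=T^{(i)}(\xi)h$, satisfy for all $i,j$ $$\widetilde T^{(i)}(I_{E_i}\otimes\widetilde T^{(j)})=\widetilde T^{(j)}(I_{E_j}\otimes\widetilde T^{(i)})(t_{i,j}\otimes I_H).$$ It is *doubly commuting* if for all $i\ne j$ $$\widetilde T^{(j)*}\widetilde T^{(i)}=(I_{E_j}\otimes\widetilde T^{(i)})(t_{i,j}\otimes I_H)(I_{E_i}\otimes\widetilde T^{(j)*}).$$ The representation $(\sigma,T^{(i)})$ of $E_i$ is *fully coisometric* if $\widetilde T^{(i)}\widetilde T^{(i)*}=I_H$. A closed subspace $K\subset H$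 *reduces* the representation if $K$ and $K^\perp$ are invariant under all $\sigma(a)$ and all $T^{(i)}(\xi)$. Two representations are *isomorphic* if a unitary operator intertwines them. For $\alpha\subset\{1,\dots,k\}$ let $\mathbb E_\alpha$ be the product subsystem consisting of the $\mathbb E(n)$ with $n$ supported in $\alpha$ (a product system over $\mathbb N_0^{|\alpha|}$ with generating correspondences $E_i$, $i\in\alpha$). A representation $\pi$ of $A$ on a Hilbert space $K$ *induces* a representation of $\mathbb E_\alpha$ on $\mathcal F(\mathbb E_\alpha)\otimes_\pi K=\bigoplus_n\mathbb E_\alpha(n)\otimes_\pi K$, where $\mathcal F(\mathbb E_\alpha)=\bigoplus_n \mathbb E_\alpha(n)$ is the Fock module, by $\sigma(a)=\varphi_\infty(a)\otimes I_K$ and $T^{(i)}(\xi)=T_\xi\otimes I_K$, with $\varphi_\infty$ the diagonal left action and $T_\xi$ the creation operator $\eta\mapsto\xi\eta$. **Theorem.** Let $(\sigma,T^{(1)},\dots,T^{(k)})$ be a doubly commuting isometric representation of $\mathbb E$ on a Hilbert space $H$. Then there is exactly one family $(H_\alpha)_{\alpha\subset\{1,\dots,k\}}$ of closed subspaces of $H$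 such that $H=\bigoplus_{\alpha}H_\alpha$ (orthogonal direct sum) and, for each $\alpha=\{\alpha_1,\dots,\alpha_r\}\subset\{1,\dots,k\}$: 1. $H_\alpha$ reduces $(\sigma,T^{(1)},\dots,T^{(k)})$; 2. the restriction of $(\sigma,T^{(\alpha_1)},\dots,T^{(\alpha_r)})$ to $H_\alpha$ is isomorphic to an induced representation of $\mathbb E_\alpha$; 3. for each $i\in\{1,\dots,k\}\setminus\alpha$, the restriction of $(\sigma,T^{(i)})$ to $H_\alpha$ is fully coisometric. -/

import Mathlib

noncomputable section

namespace WoldDecomposition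

open scoped TensorProduct InnerProductSpace

/-! ### `C*`-correspondences -/

section Correspondence

/-- A `C*`-correspondence over `A`: a right Hilbert `C*`-module `E` over `A` with an essential left
action of `A` by adjointable operators. Mathlib's `CStarModule` is written for left actions, so a
right Hilbert `A`-module is a `CStarModule` over the opposite algebra. -/
class CStarCorrespondence (A E : Type*) [NonUnitalCStarAlgebra A] [PartialOrder A]
    [StarOrderedRing A] [NormedAddCommGroup E] [NormedSpace ℂ E]
    extends SMul Aᵐᵒᵖ E, CStarModule Aᵐᵒᵖ E where
  /-- completeness of the module -/
  complete : CompleteSpace E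
  /-- the left action `φ` -/
  lact : A →ₙₐ[ℂ] (E →L[ℂ] E)
  /-- `φ a` is adjointable with adjoint `φ (star a)` -/
  inner_lact_left : ∀ (a : A) (x y : E),
    Inner.inner Aᵐᵒᵖ (lact a x) y = Inner.inner Aᵐᵒᵖ x (lact (star a) y)
  /-- the closed linear span of `φ(A)E` is `E` -/
  essential : (Submodule.span ℂ {z : E | ∃ (a : A) (x : E), lact a x = z}).topologicalClosure = ⊤

variable {A : Type*} [NonUnitalCStarAlgebra A] [PartialOrder A] [StarOrderedRing A]
variable {E : Type*} [NormedAddCommGroup E] [NormedSpace ℂ E] [CStarCorrespondence A E]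

variable (A) in
/-- The `A`-valued inner product of a right Hilbert `A`-module, linear in the second variable. -/
def rinner (x y : E) : A := (inner Aᵐᵒᵖ x y).unop

/-- The left action `a ↦ φ a`. -/
def lact (a : A) : E →L[ℂ] E := CStarCorrespondence.lact a

/-- The right action `x ↦ x · a`. -/
def ract (x : E) (a : A) : E := MulOpposite.op a • x

theorem rinner_add_right (x y z : E) : rinner A x (y + z) = rinner A x y + rinner A x z := by
  simp [rinner]

theorem rinner_add_left (x y z : E) : rinner A (x + y) z = rinner A x z + rinner A y z := by
  simp [rinner]

theorem rinner_smul_right (c : ℂ) (x y : E) : rinner A x (c • y) = c • rinner A x y := by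
  simp [rinner]

theorem rinner_smul_left (c : ℂ) (x y : E) :
    rinner A (c • x) y = (starRingEnd ℂ c) • rinner A x y := by
  simp [rinner]

theorem star_rinner (x y : E) : star (rinner A x y) = rinner A y x := by
  simp [rinner, ← MulOpposite.unop_star]

theorem rinner_self_nonneg (x : E) : 0 ≤ rinner A x x :=
  CStarModule.inner_self_nonneg (A := Aᵐᵒᵖ) (x := x)

theorem rinner_ract_right (x y : E) (a : A) : rinner A x (ract y a) = rinner A x y * a := by
  simp [rinner, ract]

theorem rinner_ract_left (x y : E) (a : A) :
    rinner A (ract x a) y = star a * rinner A x y := by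
  simp [rinner, ract]

theorem rinner_lact_left (a : A) (x y : E) : 
    rinner A (lact a x) y = rinner A x (lact (star a) y) := by
  simp only [rinner, lact, CStarCorrespondence.inner_lact_left]

theorem norm_sq_eq_norm_rinner (x : E) : ‖x‖ ^ 2 = ‖rinner A x x‖ := by
  rw [CStarModule.norm_sq_eq (A := Aᵐᵒᵖ)]; rfl

theorem rinner_sum_right {ι : Type*} (s : Finset ι) (x : E) (y : ι → E) :
    rinner A x (∑ i ∈ s, y i) = ∑ i ∈ s, rinner A x (y i) := by
  simp [rinner]

theorem rinner_sum_left {ι : Type*} (s : Finset ι) (x : ι → E) (y : E) :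
    rinner A (∑ i ∈ s, x i) y = ∑ i ∈ s, rinner A (x i) y := by
  simp [rinner]

theorem lact_mul (a b : A) (x : E) : lact (a * b) x = lact a (lact b x) := by
  simp [lact]

theorem exists_test_of_isSelfAdjoint {B : Type*} [NonUnitalCStarAlgebra B] (M : B)
    (hM : IsSelfAdjoint M) :
    ∃ N C : B, star N * M * N = -(star C * C) ∧ (C = 0 → ∃ D : B, M = star D * D) := by
  let _ : PartialOrder B := CStarAlgebra.spectralOrder B
  let _ : StarOrderedRing B := CStarAlgebra.spectralOrderedRing B
  set N := M⁻ with hN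
  have hNs : star N = N := (CFC.negPart_nonneg M).isSelfAdjoint
  have h1 : star N * M * N = - (star N * N * N) := by
    have h2 : M * N = - (N * N) := by
      conv_lhs => rw [← CFC.posPart_sub_negPart M hM]
      rw [sub_mul, CFC.posPart_mul_negPart, zero_sub]
    rw [mul_assoc, h2, mul_neg, mul_assoc]
  have h3 : 0 ≤ star N * N * N := star_left_conjugate_nonneg (CFC.negPart_nonneg M) N
  obtain ⟨C, hC⟩ := CStarAlgebra.nonneg_iff_eq_star_mul_self.mp h3
  refine ⟨N, C, by rw [h1, hC], fun hC0 => ?_⟩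
  rw [hC0, mul_zero, hNs] at hC
  have h10 : star (N * N) * (N * N) = 0 := by
    rw [star_mul, hNs, ← mul_assoc, hC, zero_mul]
  have h11 : N * N = 0 := (CStarRing.star_mul_self_eq_zero_iff _).mp h10
  have h12 : star N * N = 0 := by rw [hNs, h11]
  have key : N = 0 := (CStarRing.star_mul_self_eq_zero_iff _).mp h12
  exact CStarAlgebra.nonneg_iff_eq_star_mul_self.mp ((CFC.negPart_eq_zero_iff M hM).mp key)

/-- A self-adjoint `A`-valued matrix that is positive as a form on `Aⁿ` is of the form `N* N`. -/
theorem exists_factor_of_form_nonneg {n : Type*} [Fintype n] (G : n → n → A)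
    (hs : ∀ i j, star (G i j) = G j i)
    (h : ∀ c : n → A, 0 ≤ ∑ i, ∑ j, star (c i) * G i j * c j) :
    ∃ N : n → n → A, ∀ i j, G i j = ∑ k, star (N k i) * N k j := by
  let M : CStarMatrix n n A := fun i j => G i j
  have hM : IsSelfAdjoint M := by
    ext i j
    rw [CStarMatrix.star_apply]
    exact hs j i
  obtain ⟨N, B, h1, h2⟩ := exists_test_of_isSelfAdjoint M hM
  have h4 : ∀ j, (star N * M * N) j j = ∑ i, ∑ k, star (N i j) * G i k * N k j := by
    intro j
    simp only [CStarMatrix.mul_apply, CStarMatrix.star_apply, Finset.sum_mul]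
    rw [Finset.sum_comm]
  have h5 : B = 0 := by
    ext k j
    have h6 := h (fun i => N i j)
    rw [← h4, h1] at h6
    simp only [CStarMatrix.neg_apply, CStarMatrix.mul_apply, CStarMatrix.star_apply] at h6
    have h7 : ∀ k ∈ Finset.univ, 0 ≤ star (B k j) * B k j := fun k _ => star_mul_self_nonneg _
    have h8 : ∑ k, star (B k j) * B k j = 0 :=
      le_antisymm (neg_nonneg.mp h6) (Finset.sum_nonneg h7)
    have h9 := (Finset.sum_eq_zero_iff_of_nonneg h7).mp h8 k (Finset.mem_univ k)
    exact (CStarRing.star_mul_self_eq_zero_iff _).mp h9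
  obtain ⟨N, hN⟩ := h2 h5
  refine ⟨fun k i => N k i, fun i j => ?_⟩
  have h6 : M i j = (star N * N) i j := by rw [← hN]
  rw [CStarMatrix.mul_apply] at h6
  simpa only [CStarMatrix.star_apply] using h6

theorem exists_gram_factor {n : Type*} [Fintype n] (x : n → E) :
    ∃ N : n → n → A, ∀ i j, rinner A (x i) (x j) = ∑ k, star (N k i) * N k j := by
  refine exists_factor_of_form_nonneg _ (fun i j => star_rinner _ _) fun c => ?_
  have : ∑ i, ∑ j, star (c i) * rinner A (x i) (x j) * c j =
      rinner A (∑ i, ract (x i) (c i)) (∑ j, ract (x j) (c j)) := by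
    rw [rinner_sum_left]
    refine Finset.sum_congr rfl fun i _ => ?_
    rw [rinner_sum_right]
    refine Finset.sum_congr rfl fun j _ => ?_
    rw [rinner_ract_right, rinner_ract_left]
  rw [this]
  exact rinner_self_nonneg _

end Correspondence
/-! ### The interior tensor product with a representation -/

section InteriorTensor

variable {A : Type*} [NonUnitalCStarAlgebra A] [PartialOrder A] [StarOrderedRing A]
variable {E : Type*} [NormedAddCommGroup E] [NormedSpace ℂ E] [CStarCorrespondence A E]
variable {H : Type*} [NormedAddCommGroup H] [InnerProductSpace ℂ H] [CompleteSpace H]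

/-- A `*`-representation is nondegenerate if the closed linear span of `σ(A)H` is `H`. -/
def IsNondegenerate (σ : A →⋆ₙₐ[ℂ] (H →L[ℂ] H)) : Prop :=
  (Submodule.span ℂ {z : H | ∃ (a : A) (x : H), σ a x = z}).topologicalClosure = ⊤

set_option linter.unusedVariables false in
/-- The algebraic tensor product `E ⊗ H`, carrying the semi-inner product determined by
`⟪ξ ⊗ h, η ⊗ k⟫ = ⟪h, σ(⟨ξ, η⟩) k⟫`. -/
def PreTensor (E : Type*) [NormedAddCommGroup E] [NormedSpace ℂ E] [CStarCorrespondence A E]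
    (σ : A →⋆ₙₐ[ℂ] (H →L[ℂ] H)) : Type _ := E ⊗[ℂ] H

variable (σ : A →⋆ₙₐ[ℂ] (H →L[ℂ] H))

instance : AddCommGroup (PreTensor E σ) := inferInstanceAs (AddCommGroup (E ⊗[ℂ] H))
instance : Module ℂ (PreTensor E σ) := inferInstanceAs (Module ℂ (E ⊗[ℂ] H))

/-- For fixed `ξ, h`, the functional `η ⊗ k ↦ ⟪h, σ(⟨ξ, η⟩) k⟫`. -/
def preFormRight (ξ : E) (h : H) : E ⊗[ℂ] H →ₗ[ℂ] ℂ :=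
  TensorProduct.lift (LinearMap.mk₂ ℂ (fun (η : E) (k : H) => ⟪h, σ (rinner A ξ η) k⟫_ℂ)
    (by intros; simp [rinner_add_right])
    (by intros; simp [rinner_smul_right])
    (by intros; simp)
    (by intros; simp))

/-- The semi-inner product on the algebraic tensor product. -/
def preForm : E ⊗[ℂ] H →ₗ⋆[ℂ] E ⊗[ℂ] H →ₗ[ℂ] ℂ :=
  TensorProduct.lift (LinearMap.mk₂'ₛₗ (starRingEnd ℂ) (starRingEnd ℂ) (preFormRight σ)
    (by intros; ext; simp [preFormRight, rinner_add_left])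
    (by intros; ext; simp [preFormRight, rinner_smul_left])
    (by intros; ext; simp [preFormRight])
    (by intros; ext; simp [preFormRight, mul_comm]))

theorem preForm_tmul (ξ η : E) (h k : H) :
    preForm σ (ξ ⊗ₜ h) (η ⊗ₜ k) = ⟪h, σ (rinner A ξ η) k⟫_ℂ := rfl

theorem preForm_symm (x y : E ⊗[ℂ] H) :
    (starRingEnd ℂ) (preForm σ y x) = preForm σ x y := by
  induction x using TensorProduct.induction_on with
  | zero => simp
  | add x₁ x₂ h₁ h₂ => simp [h₁, h₂]
  | tmul ξ h =>
    induction y using TensorProduct.induction_on with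
    | zero => simp
    | add x₁ x₂ h₁ h₂ => simp [h₁, h₂]
    | tmul η k =>
      rw [preForm_tmul, preForm_tmul, inner_conj_symm, ← star_rinner ξ η, map_star,
        ContinuousLinearMap.star_eq_adjoint, ContinuousLinearMap.adjoint_inner_left]

theorem exists_sum_tmul (x : E ⊗[ℂ] H) :
    ∃ (n : ℕ) (ξ : Fin n → E) (h : Fin n → H), x = ∑ i, ξ i ⊗ₜ[ℂ] h i := by
  induction x using TensorProduct.induction_on with
  | zero => exact ⟨0, Fin.elim0, Fin.elim0, by simp⟩
  | tmul ξ h => exact ⟨1, fun _ => ξ, fun _ => h, by simp⟩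
  | add x y hx hy =>
    obtain ⟨n, ξ, h, rfl⟩ := hx
    obtain ⟨m, η, k, rfl⟩ := hy
    exact ⟨n + m, Fin.append ξ η, Fin.append h k, by simp [Fin.sum_univ_add]⟩

/-- The norm formula behind positivity: with `⟨ξ i, ξ j⟩ = ∑ k, N_{ki}* N_{kj}`, the square norm of
`∑ ξ i ⊗ h i` is `∑ k, ‖∑ i, σ(N_{ki}) h i‖ ^ 2`. -/
theorem preForm_sum_self {n : Type*} [Fintype n] (ξ : n → E) (h : n → H) (N : n → n → A)
    (hN : ∀ i j, rinner A (ξ i) (ξ j) = ∑ k, star (N k i) * N k j) :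
    preForm σ (∑ i, ξ i ⊗ₜ[ℂ] h i) (∑ i, ξ i ⊗ₜ[ℂ] h i) =
      ((∑ k, ‖∑ i, σ (N k i) (h i)‖ ^ 2 : ℝ) : ℂ) := by
  have key : ∀ k, ((‖∑ i, σ (N k i) (h i)‖ ^ 2 : ℝ) : ℂ) =
      ∑ i, ∑ j, ⟪σ (N k i) (h i), σ (N k j) (h j)⟫_ℂ := by
    intro k
    have := inner_self_eq_norm_sq_to_K (𝕜 := ℂ) (∑ i, σ (N k i) (h i))
    rw [Complex.ofReal_pow]
    refine this.symm.trans ?_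
    rw [sum_inner]
    exact Finset.sum_congr rfl fun i _ => inner_sum _ _ _
  rw [Complex.ofReal_sum, Finset.sum_congr rfl fun k _ => key k, Finset.sum_comm,
    map_sum (preForm σ), LinearMap.sum_apply]
  refine Finset.sum_congr rfl fun i _ => ?_
  rw [map_sum, Finset.sum_comm]
  refine Finset.sum_congr rfl fun j _ => ?_
  rw [preForm_tmul, hN, map_sum, sum_apply, inner_sum]
  refine Finset.sum_congr rfl fun k _ => ?_
  rw [map_mul, map_star, ContinuousLinearMap.star_eq_adjoint, mul_apply_eq_comp,
    ContinuousLinearMap.adjoint_inner_right]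

theorem preForm_self_nonneg (x : E ⊗[ℂ] H) : 0 ≤ (preForm σ x x).re := by
  obtain ⟨n, ξ, h, rfl⟩ := exists_sum_tmul x
  obtain ⟨N, hN⟩ := exists_gram_factor (A := A) ξ
  rw [preForm_sum_self σ ξ h N hN, Complex.ofReal_re]
  positivity

/-- The semi-inner product space structure on `PreTensor E σ`. -/
abbrev preTensorCore : PreInnerProductSpace.Core ℂ (PreTensor E σ) where
  inner x y := preForm σ x y
  conj_inner_symm x y := preForm_symm σ x y
  re_inner_nonneg x := preForm_self_nonneg σ x
  add_left x y z := LinearMap.map_add₂ (preForm σ) x y z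
  smul_left x y c := LinearMap.map_smulₛₗ₂ (preForm σ) c x y

instance : SeminormedAddCommGroup (PreTensor E σ) :=
  InnerProductSpace.Core.toSeminormedAddCommGroup (c := preTensorCore σ)
instance : InnerProductSpace ℂ (PreTensor E σ) :=
  InnerProductSpace.ofCore (preTensorCore σ)

theorem preTensor_inner (x y : PreTensor E σ) : ⟪x, y⟫_ℂ = preForm σ x y := rfl

variable (E) in
/-- The interior tensor product `E ⊗_σ H`: the Hilbert space obtained from the algebraic tensor
product by separation and completion with respect to `⟪ξ ⊗ h, η ⊗ k⟫ = ⟪h, σ(⟨ξ, η⟩) k⟫`. -/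
abbrev InteriorTensor : Type _ := UniformSpace.Completion (PreTensor E σ)

/-- The elementary tensor `ξ ⊗ h` of the algebraic tensor product. -/
def preTmul (ξ : E) (h : H) : PreTensor E σ := (ξ ⊗ₜ[ℂ] h : E ⊗[ℂ] H)

/-- The elementary tensor `ξ ⊗ h` of `E ⊗_σ H`. -/
def tmul (ξ : E) (h : H) : InteriorTensor E σ := (preTmul σ ξ h : InteriorTensor E σ)

theorem inner_tmul (ξ η : E) (h k : H) :
    ⟪tmul σ ξ h, tmul σ η k⟫_ℂ = ⟪h, σ (rinner A ξ η) k⟫_ℂ := by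
  rw [tmul, tmul, UniformSpace.Completion.inner_coe]; rfl

theorem tmul_add_left (ξ η : E) (h : H) : tmul σ (ξ + η) h = tmul σ ξ h + tmul σ η h := by
  rw [tmul, tmul, tmul, ← UniformSpace.Completion.coe_add]
  exact congrArg _ (TensorProduct.add_tmul ξ η h)

theorem tmul_add_right (ξ : E) (h k : H) : tmul σ ξ (h + k) = tmul σ ξ h + tmul σ ξ k := by
  rw [tmul, tmul, tmul, ← UniformSpace.Completion.coe_add]
  exact congrArg _ (TensorProduct.tmul_add ξ h k)

theorem tmul_smul_left (c : ℂ) (ξ : E) (h : H) : tmul σ (c • ξ) h = c • tmul σ ξ h := by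
  rw [tmul, tmul, ← UniformSpace.Completion.coe_smul]
  exact congrArg _ (TensorProduct.smul_tmul' c ξ h).symm

theorem tmul_smul_right (c : ℂ) (ξ : E) (h : H) : tmul σ ξ (c • h) = c • tmul σ ξ h := by
  rw [tmul, tmul, ← UniformSpace.Completion.coe_smul]
  exact congrArg _ (TensorProduct.tmul_smul c ξ h)

/-- Induction principle for closed linear conditions on `E ⊗_σ H`. -/
theorem interiorTensor_induction {p : InteriorTensor E σ → Prop}
    (hc : IsClosed {x | p x}) (h0 : p 0) (ha : ∀ x y, p x → p y → p (x + y))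
    (ht : ∀ ξ h, p (tmul σ ξ h)) (x : InteriorTensor E σ) : p x := by
  induction x using UniformSpace.Completion.induction_on with
  | hp => exact hc
  | ih x =>
    induction x using TensorProduct.induction_on with
    | zero => exact h0
    | tmul ξ h => exact ht ξ h
    | add x y hx hy =>
      have := ha _ _ hx hy
      rw [← UniformSpace.Completion.coe_add (α := PreTensor E σ) x y] at this
      exact this

theorem interiorTensor_ext {X : Type*} [NormedAddCommGroup X] [NormedSpace ℂ X]
    {f g : InteriorTensor E σ →L[ℂ] X} (h : ∀ ξ x, f (tmul σ ξ x) = g (tmul σ ξ x)) : f = g := by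
  ext x
  induction x using interiorTensor_induction with
  | hc => exact isClosed_eq f.continuous g.continuous
  | h0 => simp
  | ha x y hx hy => simp [hx, hy]
  | ht ξ x => exact h ξ x

theorem span_tmul :
    (Submodule.span ℂ {z : InteriorTensor E σ | ∃ ξ h, tmul σ ξ h = z}).topologicalClosure = ⊤ := by
  rw [eq_top_iff]
  rintro x -
  induction x using interiorTensor_induction with
  | hc => exact Submodule.isClosed_topologicalClosure _
  | h0 => exact zero_mem _
  | ha x y hx hy => exact add_mem hx hy
  | ht ξ x => exact Submodule.le_topologicalClosure _ (Submodule.subset_span ⟨ξ, x, rfl⟩)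

/-! #### Maps out of the interior tensor product -/

variable {X : Type*} [NormedAddCommGroup X] [InnerProductSpace ℂ X] [CompleteSpace X]

theorem inner_lift_pre (b : E →ₗ[ℂ] H →ₗ[ℂ] X)
    (hb : ∀ ξ η h k, ⟪b ξ h, b η k⟫_ℂ = ⟪h, σ (rinner A ξ η) k⟫_ℂ) (x y : E ⊗[ℂ] H) :
    ⟪TensorProduct.lift b x, TensorProduct.lift b y⟫_ℂ = preForm σ x y := by
  induction x using TensorProduct.induction_on with
  | zero => simp
  | add x₁ x₂ h₁ h₂ => 
    rw [map_add, inner_add_left, h₁, h₂, map_add, LinearMap.add_apply]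
  | tmul ξ h =>
    induction y using TensorProduct.induction_on with
    | zero => simp
    | add x₁ x₂ h₁ h₂ => rw [map_add, inner_add_right, h₁, h₂, map_add]
    | tmul η k => simpa [preForm_tmul] using hb ξ η h k

theorem preTensor_norm_sq (x : PreTensor E σ) : ‖x‖ ^ 2 = (preForm σ x x).re :=
  norm_sq_eq_re_inner (𝕜 := ℂ) x

/-- The map on the algebraic tensor product induced by a bilinear map. -/
def preLift (b : E →ₗ[ℂ] H →ₗ[ℂ] X) : PreTensor E σ →ₗ[ℂ] X :=
  (TensorProduct.lift b : E ⊗[ℂ] H →ₗ[ℂ] X)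

theorem inner_preLift (b : E →ₗ[ℂ] H →ₗ[ℂ] X)
    (hb : ∀ ξ η h k, ⟪b ξ h, b η k⟫_ℂ = ⟪h, σ (rinner A ξ η) k⟫_ℂ) (x y : PreTensor E σ) :
    ⟪preLift σ b x, preLift σ b y⟫_ℂ = ⟪x, y⟫_ℂ :=
  inner_lift_pre σ b hb x y

theorem norm_preLift (b : E →ₗ[ℂ] H →ₗ[ℂ] X)
    (hb : ∀ ξ η h k, ⟪b ξ h, b η k⟫_ℂ = ⟪h, σ (rinner A ξ η) k⟫_ℂ) (x : PreTensor E σ) :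
    ‖preLift σ b x‖ = ‖x‖ := by
  rw [← sq_eq_sq₀ (norm_nonneg _) (norm_nonneg _), norm_sq_eq_re_inner (𝕜 := ℂ),
    norm_sq_eq_re_inner (𝕜 := ℂ) x, inner_preLift σ b hb]

/-- Universal property of the interior tensor product: a bilinear map `b : E × H → X` with
`⟪b ξ h, b η k⟫ = ⟪h, σ(⟨ξ, η⟩) k⟫` induces a bounded map `E ⊗_σ H → X`, `ξ ⊗ h ↦ b ξ h`. -/
def liftCLM (b : E →ₗ[ℂ] H →ₗ[ℂ] X)
    (hb : ∀ ξ η h k, ⟪b ξ h, b η k⟫_ℂ = ⟪h, σ (rinner A ξ η) k⟫_ℂ) :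
    InteriorTensor E σ →L[ℂ] X :=
  ContinuousLinearMap.fromCompletion <| (preLift σ b).mkContinuous 1 fun x => by
    rw [one_mul, norm_preLift σ b hb]

theorem liftCLM_coe (b : E →ₗ[ℂ] H →ₗ[ℂ] X)
    (hb : ∀ ξ η h k, ⟪b ξ h, b η k⟫_ℂ = ⟪h, σ (rinner A ξ η) k⟫_ℂ) (x : PreTensor E σ) :
    liftCLM σ b hb (x : InteriorTensor E σ) = preLift σ b x := by
  simp [liftCLM]

/-- `liftCLM` as an isometry. -/
def liftₗᵢ (b : E →ₗ[ℂ] H →ₗ[ℂ] X)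
    (hb : ∀ ξ η h k, ⟪b ξ h, b η k⟫_ℂ = ⟪h, σ (rinner A ξ η) k⟫_ℂ) :
    InteriorTensor E σ →ₗᵢ[ℂ] X :=
  LinearMap.isometryOfInner (liftCLM σ b hb).toLinearMap fun x y => by
    induction x, y using UniformSpace.Completion.induction_on₂ with
    | hp =>
      refine isClosed_eq ?_ ?_
      · exact ((liftCLM σ b hb).continuous.comp continuous_fst).inner
          ((liftCLM σ b hb).continuous.comp continuous_snd)
      · exact continuous_fst.inner continuous_snd
    | ih x y =>
      rw [UniformSpace.Completion.inner_coe, ← inner_preLift σ b hb]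
      exact congrArg₂ _ (liftCLM_coe σ b hb x) (liftCLM_coe σ b hb y)

theorem liftₗᵢ_tmul (b : E →ₗ[ℂ] H →ₗ[ℂ] X)
    (hb : ∀ ξ η h k, ⟪b ξ h, b η k⟫_ℂ = ⟪h, σ (rinner A ξ η) k⟫_ℂ) (ξ : E) (h : H) :
    liftₗᵢ σ b hb (tmul σ ξ h) = b ξ h :=
  (liftCLM_coe σ b hb (preTmul σ ξ h)).trans (TensorProduct.lift.tmul ξ h)

end InteriorTensor

section StarRep

/-- A `*`-representation of a `C*`-algebra by operators on a semi-inner product space is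
contractive. -/
theorem norm_starRep_le {A V : Type*} [NonUnitalCStarAlgebra A] [SeminormedAddCommGroup V]
    [InnerProductSpace ℂ V] (ψ : A →ₙₐ[ℂ] Module.End ℂ V)
    (hψ : ∀ a v w, ⟪ψ a v, w⟫_ℂ = ⟪v, ψ (star a) w⟫_ℂ) (a : A) (v : V) :
    ‖ψ a v‖ ≤ ‖a‖ * ‖v‖ := by
  let U := Unitization ℂ A
  let _ : PartialOrder U := CStarAlgebra.spectralOrder U
  let _ : StarOrderedRing U := CStarAlgebra.spectralOrderedRing U
  let Ψ : U →ₐ[ℂ] Module.End ℂ V := Unitization.lift ψ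
  have hΨ' : ∀ (u : U) v, Ψ u v = u.fst • v + ψ u.snd v := by
    intro u v
    induction u using Unitization.ind with
    | inl_add_inr r a => simp [Ψ, NonUnitalAlgHom.toAlgHom]
  have hΨ : ∀ (u : U) v w, ⟪Ψ u v, w⟫_ℂ = ⟪v, Ψ (star u) w⟫_ℂ := by
    intro u v w
    rw [hΨ', hΨ', inner_add_left, inner_add_right, hψ, inner_smul_left, inner_smul_right]
    rfl
  have h1 : star (a : U) * (a : U) ≤ algebraMap ℝ U (‖(a : U)‖ ^ 2) :=
    CStarAlgebra.star_mul_le_algebraMap_norm_sq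
  obtain ⟨d, hd⟩ := CStarAlgebra.nonneg_iff_eq_star_mul_self.mp (sub_nonneg.mpr h1)
  have hr : Ψ (algebraMap ℝ U (‖a‖ ^ 2)) v = ((‖a‖ ^ 2 : ℝ) : ℂ) • v := by
    rw [IsScalarTower.algebraMap_apply ℝ ℂ U, AlgHom.commutes]
    rfl
  have ha : Ψ (a : U) v = ψ a v := by simp [hΨ']
  have h2 : ⟪Ψ d v, Ψ d v⟫_ℂ = (‖a‖ ^ 2 : ℝ) * ⟪v, v⟫_ℂ - ⟪ψ a v, ψ a v⟫_ℂ := by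
    rw [hΨ, ← Module.End.mul_apply, ← map_mul, ← hd, map_sub, LinearMap.sub_apply, inner_sub_right,
      Unitization.norm_inr, hr, inner_smul_right, map_mul, Module.End.mul_apply, ← hΨ, ha]
  have h3 : 0 ≤ ‖a‖ ^ 2 * ‖v‖ ^ 2 - ‖ψ a v‖ ^ 2 := by
    have h4 := congrArg Complex.re h2
    rw [Complex.sub_re, Complex.re_ofReal_mul] at h4
    have h5 : ∀ w : V, (⟪w, w⟫_ℂ).re = ‖w‖ ^ 2 := fun w => (norm_sq_eq_re_inner (𝕜 := ℂ) w).symm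
    rw [h5, h5, h5] at h4
    rw [← h4]
    positivity
  refine le_of_sq_le_sq ?_ (by positivity)
  rw [mul_pow]
  linarith

end StarRep

section Functoriality

variable {A : Type*} [NonUnitalCStarAlgebra A] [PartialOrder A] [StarOrderedRing A]
variable {E : Type*} [NormedAddCommGroup E] [NormedSpace ℂ E] [CStarCorrespondence A E]
variable {F : Type*} [NormedAddCommGroup F] [NormedSpace ℂ F] [CStarCorrespondence A F]
variable {H : Type*} [NormedAddCommGroup H] [InnerProductSpace ℂ H] [CompleteSpace H]
variable (σ : A →⋆ₙₐ[ℂ] (H →L[ℂ] H))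

/-- `R ⊗ I` on algebraic tensor products. -/
def preMapLeft (R : E →ₗ[ℂ] F) : PreTensor E σ →ₗ[ℂ] PreTensor F σ :=
  (TensorProduct.map R LinearMap.id : E ⊗[ℂ] H →ₗ[ℂ] F ⊗[ℂ] H)

theorem preMapLeft_preTmul (R : E →ₗ[ℂ] F) (ξ : E) (h : H) :
    preMapLeft σ R (preTmul σ ξ h) = preTmul σ (R ξ) h := rfl

theorem preTensor_inner_induction {p : PreTensor E σ → Prop} (h0 : p 0)
    (ha : ∀ x y, p x → p y → p (x + y)) (ht : ∀ ξ h, p (preTmul σ ξ h)) (x : PreTensor E σ) :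
    p x :=
  TensorProduct.induction_on (motive := p) x h0 ht ha

theorem inner_preTmul (ξ η : E) (h k : H) :
    ⟪preTmul σ ξ h, preTmul σ η k⟫_ℂ = ⟪h, σ (rinner A ξ η) k⟫_ℂ := rfl

/-- `φ(a) ⊗ I` on the algebraic tensor product. -/
def preLact : A →ₙₐ[ℂ] Module.End ℂ (PreTensor E σ) where
  toFun a := preMapLeft σ (lact a : E →L[ℂ] E).toLinearMap
  map_smul' c a := by
    ext x
    induction x using preTensor_inner_induction with
    | h0 => simp
    | ha x y hx hy => rw [map_add, map_add, hx, hy]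
    | ht ξ h =>
      simp only [lact, map_smul]
      exact TensorProduct.smul_tmul' _ _ _
  map_zero' := by
    ext x
    induction x using preTensor_inner_induction with
    | h0 => simp
    | ha x y hx hy => rw [map_add, map_add, hx, hy]
    | ht ξ h =>
      simp only [lact, map_zero]
      exact TensorProduct.zero_tmul _ _
  map_add' a b := by
    ext x
    induction x using preTensor_inner_induction with
    | h0 => simp
    | ha x y hx hy => rw [map_add, map_add, hx, hy]
    | ht ξ h =>
      simp only [lact, map_add]
      exact TensorProduct.add_tmul _ _ _
  map_mul' a b := by
    ext x
    induction x using preTensor_inner_induction with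
    | h0 => simp
    | ha x y hx hy => rw [map_add, map_add, hx, hy]
    | ht ξ h =>
      simp only [lact, map_mul]
      rfl

theorem preLact_preTmul (a : A) (ξ : E) (h : H) :
    preLact σ a (preTmul σ ξ h) = preTmul σ (lact a ξ) h := rfl

theorem inner_preLact (a : A) (x y : PreTensor E σ) :
    ⟪preLact σ a x, y⟫_ℂ = ⟪x, preLact σ (star a) y⟫_ℂ := by
  induction x using preTensor_inner_induction with
  | h0 => simp
  | ha x₁ x₂ h₁ h₂ => rw [map_add, inner_add_left, h₁, h₂, inner_add_left]
  | ht ξ h =>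
    induction y using preTensor_inner_induction with
    | h0 => simp
    | ha x₁ x₂ h₁ h₂ => rw [map_add, inner_add_right, h₁, h₂, inner_add_right]
    | ht η k =>
      rw [preLact_preTmul, preLact_preTmul, inner_preTmul, inner_preTmul, rinner_lact_left]

theorem norm_preLact_le (a : A) (x : PreTensor E σ) : ‖preLact σ a x‖ ≤ ‖a‖ * ‖x‖ :=
  norm_starRep_le (preLact σ) (inner_preLact σ) a x

theorem inner_preMapLeft (R : E →ₗ[ℂ] F) (c : A)
    (hR : ∀ ξ η, rinner A (R ξ) (R η) = rinner A ξ (lact c η)) (x y : PreTensor E σ) :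
    ⟪preMapLeft σ R x, preMapLeft σ R y⟫_ℂ = ⟪x, preLact σ c y⟫_ℂ := by
  induction x using preTensor_inner_induction with
  | h0 => simp
  | ha x₁ x₂ h₁ h₂ => rw [map_add, inner_add_left, h₁, h₂, inner_add_left]
  | ht ξ h =>
    induction y using preTensor_inner_induction with
    | h0 => simp
    | ha x₁ x₂ h₁ h₂ => rw [map_add, inner_add_right, h₁, h₂, map_add, inner_add_right]
    | ht η k =>
      rw [preLact_preTmul, preMapLeft_preTmul, preMapLeft_preTmul, inner_preTmul, inner_preTmul, hR]

theorem norm_preMapLeft_le (R : E →ₗ[ℂ] F) (c : A)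
    (hR : ∀ ξ η, rinner A (R ξ) (R η) = rinner A ξ (lact c η)) (x : PreTensor E σ) :
    ‖preMapLeft σ R x‖ ≤ √‖c‖ * ‖x‖ := by
  refine le_of_sq_le_sq ?_ (by positivity)
  rw [norm_sq_eq_re_inner (𝕜 := ℂ), inner_preMapLeft σ R c hR, mul_pow,
    Real.sq_sqrt (norm_nonneg _)]
  calc RCLike.re ⟪x, preLact σ c x⟫_ℂ ≤ ‖⟪x, preLact σ c x⟫_ℂ‖ := RCLike.re_le_norm _
    _ ≤ ‖x‖ * ‖preLact σ c x‖ := norm_inner_le_norm _ _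
    _ ≤ ‖x‖ * (‖c‖ * ‖x‖) := by gcongr; exact norm_preLact_le σ c x
    _ = ‖c‖ * ‖x‖ ^ 2 := by ring

/-- The operator `R ⊗ I : E ⊗_σ H → F ⊗_σ H` for a linear map `R` with `R* R = φ(c)`. -/
def mapLeft (R : E →ₗ[ℂ] F) (c : A)
    (hR : ∀ ξ η, rinner A (R ξ) (R η) = rinner A ξ (lact c η)) :
    InteriorTensor E σ →L[ℂ] InteriorTensor F σ :=
  ((preMapLeft σ R).mkContinuous (√‖c‖) (norm_preMapLeft_le σ R c hR)).completion

theorem mapLeft_tmul (R : E →ₗ[ℂ] F) (c : A)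
    (hR : ∀ ξ η, rinner A (R ξ) (R η) = rinner A ξ (lact c η)) (ξ : E) (h : H) :
    mapLeft σ R c hR (tmul σ ξ h) = tmul σ (R ξ) h := by
  rw [mapLeft, tmul, ContinuousLinearMap.completion_apply_coe, LinearMap.mkContinuous_apply,
    preMapLeft_preTmul, tmul]

theorem norm_mapLeft_le (R : E →ₗ[ℂ] F) (c : A)
    (hR : ∀ ξ η, rinner A (R ξ) (R η) = rinner A ξ (lact c η)) (x : InteriorTensor E σ) :
    ‖mapLeft σ R c hR x‖ ≤ √‖c‖ * ‖x‖ := by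
  induction x using UniformSpace.Completion.induction_on with
  | hp => exact isClosed_le (by fun_prop) (by fun_prop)
  | ih x =>
    rw [mapLeft, ContinuousLinearMap.completion_apply_coe, UniformSpace.Completion.norm_coe,
      UniformSpace.Completion.norm_coe]
    exact norm_preMapLeft_le σ R c hR x

theorem rinner_lact_lact (a : A) (ξ η : E) :
    rinner A (lact a ξ) (lact a η) = rinner A ξ (lact (star a * a) η) := by
  rw [rinner_lact_left, lact_mul]

variable (E) in
/-- The representation `a ↦ φ(a) ⊗ I` of `A` on `E ⊗_σ H`. -/
def leftRep : A →⋆ₙₐ[ℂ] (InteriorTensor E σ →L[ℂ] InteriorTensor E σ) where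
  toFun a := mapLeft σ (lact a : E →L[ℂ] E).toLinearMap (star a * a) (rinner_lact_lact a)
  map_smul' c a := by
    refine interiorTensor_ext σ fun ξ h => ?_
    simp [mapLeft_tmul, lact, tmul_smul_left]
  map_zero' := by
    refine interiorTensor_ext σ fun ξ h => ?_
    have : tmul σ (0 : E) h = 0 := by simpa using tmul_smul_left σ 0 (0 : E) h
    simp [mapLeft_tmul, lact, this]
  map_add' a b := by
    refine interiorTensor_ext σ fun ξ h => ?_
    simp [mapLeft_tmul, lact, tmul_add_left]
  map_mul' a b := by
    refine interiorTensor_ext σ fun ξ h => ?_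
    simp [mapLeft_tmul, lact]
  map_star' a := by
    rw [ContinuousLinearMap.star_eq_adjoint, ContinuousLinearMap.eq_adjoint_iff]
    intro x y
    induction x using interiorTensor_induction with
    | hc => exact isClosed_eq (by fun_prop) (by fun_prop)
    | h0 => simp
    | ha x₁ x₂ h₁ h₂ => rw [map_add, inner_add_left, h₁, h₂, inner_add_left]
    | ht ξ h =>
      induction y using interiorTensor_induction with
      | hc => exact isClosed_eq (by fun_prop) (by fun_prop)
      | h0 => simp
      | ha x₁ x₂ h₁ h₂ => rw [inner_add_right, h₁, h₂, map_add, inner_add_right]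
      | ht η k =>
        rw [mapLeft_tmul, mapLeft_tmul, inner_tmul, inner_tmul]
        simp [rinner_lact_left]

theorem leftRep_tmul (a : A) (ξ : E) (h : H) :
    leftRep E σ a (tmul σ ξ h) = tmul σ (lact a ξ) h :=
  mapLeft_tmul σ _ _ (rinner_lact_lact a) ξ h

theorem norm_tmul_le (ξ : E) (h : H) : ‖tmul σ ξ h‖ ≤ ‖h‖ * ‖ξ‖ := by
  refine le_of_sq_le_sq ?_ (by positivity)
  rw [norm_sq_eq_re_inner (𝕜 := ℂ), inner_tmul, mul_pow, norm_sq_eq_norm_rinner (A := A) ξ]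
  calc RCLike.re ⟪h, σ (rinner A ξ ξ) h⟫_ℂ ≤ ‖⟪h, σ (rinner A ξ ξ) h⟫_ℂ‖ := RCLike.re_le_norm _
    _ ≤ ‖h‖ * ‖σ (rinner A ξ ξ) h‖ := norm_inner_le_norm _ _
    _ ≤ ‖h‖ * (‖σ (rinner A ξ ξ)‖ * ‖h‖) := by gcongr; exact (σ _).le_opNorm _
    _ ≤ ‖h‖ * (‖rinner A ξ ξ‖ * ‖h‖) := by
      gcongr
      exact NonUnitalStarAlgHom.norm_apply_le σ _
    _ = ‖h‖ ^ 2 * ‖rinner A ξ ξ‖ := by ring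

/-- The bounded map `ξ ↦ ξ ⊗ h`. -/
def tmulLeft (h : H) : E →L[ℂ] InteriorTensor E σ :=
  LinearMap.mkContinuous
    { toFun := fun ξ => tmul σ ξ h
      map_add' := fun ξ η => tmul_add_left σ ξ η h
      map_smul' := fun c ξ => tmul_smul_left σ c ξ h } ‖h‖ fun ξ => norm_tmul_le σ ξ h

variable {σ}
variable {K : Type*} [NormedAddCommGroup K] [InnerProductSpace ℂ K] [CompleteSpace K]
variable {ρ : A →⋆ₙₐ[ℂ] (K →L[ℂ] K)}

/-- `I ⊗ S` on algebraic tensor products. -/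
def preMapRight (S : H →L[ℂ] K) : PreTensor E σ →ₗ[ℂ] PreTensor E ρ :=
  (TensorProduct.map LinearMap.id S.toLinearMap : E ⊗[ℂ] H →ₗ[ℂ] E ⊗[ℂ] K)

theorem norm_preMapRight_le (S : H →L[ℂ] K) (hS : ∀ a h, S (σ a h) = ρ a (S h))
    (x : PreTensor E σ) : ‖(preMapRight S : PreTensor E σ →ₗ[ℂ] PreTensor E ρ) x‖ ≤ ‖S‖ * ‖x‖ := by
  refine le_of_sq_le_sq ?_ (by positivity)
  rw [mul_pow, preTensor_norm_sq, preTensor_norm_sq]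
  obtain ⟨n, ξ, h, rfl⟩ := exists_sum_tmul x
  obtain ⟨N, hN⟩ := exists_gram_factor (A := A) ξ
  have h1 : (preMapRight S : PreTensor E σ →ₗ[ℂ] PreTensor E ρ) (∑ i, ξ i ⊗ₜ[ℂ] h i : E ⊗[ℂ] H) =
      (∑ i, ξ i ⊗ₜ[ℂ] S (h i) : E ⊗[ℂ] K) :=
    map_sum (TensorProduct.map LinearMap.id S.toLinearMap : E ⊗[ℂ] H →ₗ[ℂ] E ⊗[ℂ] K) _ _
  rw [h1, preForm_sum_self σ ξ h N hN, preForm_sum_self ρ ξ _ N hN, Complex.ofReal_re,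
    Complex.ofReal_re, Finset.mul_sum]
  refine Finset.sum_le_sum fun k _ => ?_
  simp only [← hS]
  rw [← map_sum, ← mul_pow]
  gcongr
  exact S.le_opNorm _

/-- The operator `I ⊗ S : E ⊗_σ H → E ⊗_ρ K` for an operator `S : H → K` intertwining the
representations `σ` and `ρ`. -/
def mapRight (S : H →L[ℂ] K) (hS : ∀ a h, S (σ a h) = ρ a (S h)) :
    InteriorTensor E σ →L[ℂ] InteriorTensor E ρ :=
  ((preMapRight S).mkContinuous ‖S‖ (norm_preMapRight_le S hS)).completion

theorem mapRight_tmul (S : H →L[ℂ] K) (hS : ∀ a h, S (σ a h) = ρ a (S h)) (ξ : E) (h : H) :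
    mapRight S hS (tmul σ ξ h) = tmul ρ ξ (S h) := by
  rw [mapRight, tmul, ContinuousLinearMap.completion_apply_coe, LinearMap.mkContinuous_apply]
  rfl

end Functoriality

/-! ### Isometric representations of one correspondence -/

section SingleRep

variable {A : Type*} [NonUnitalCStarAlgebra A] [PartialOrder A] [StarOrderedRing A]
variable {E : Type*} [NormedAddCommGroup E] [NormedSpace ℂ E] [CStarCorrespondence A E]
variable {H : Type*} [NormedAddCommGroup H] [InnerProductSpace ℂ H] [CompleteSpace H]

/-- `(σ, T)` is an isometric covariant representation of the correspondence `E` on `H`: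
`T(a ξ b) = σ(a) T(ξ) σ(b)` and `T(ξ)* T(η) = σ(⟨ξ, η⟩)`. (The last identity makes `T` completely
contractive.) -/
structure IsIsometricRep (σ : A →⋆ₙₐ[ℂ] (H →L[ℂ] H)) (T : E →ₗ[ℂ] (H →L[ℂ] H)) : Prop where
  map_lact : ∀ (a : A) (ξ : E), T (lact a ξ) = σ a ∘L T ξ
  map_ract : ∀ (ξ : E) (a : A), T (ract ξ a) = T ξ ∘L σ a
  isometric : ∀ ξ η : E, ContinuousLinearMap.adjoint (T ξ) ∘L T η = σ (rinner A ξ η)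

variable {σ : A →⋆ₙₐ[ℂ] (H →L[ℂ] H)} {T : E →ₗ[ℂ] (H →L[ℂ] H)}

namespace IsIsometricRep

theorem inner_map_map (hT : IsIsometricRep σ T) (ξ η : E) (h k : H) :
    ⟪T ξ h, T η k⟫_ℂ = ⟪h, σ (rinner A ξ η) k⟫_ℂ := by
  rw [← hT.isometric, ContinuousLinearMap.comp_apply, ContinuousLinearMap.adjoint_inner_right]

/-- The isometry `T̃ : E ⊗_σ H → H`, `T̃(ξ ⊗ h) = T(ξ)h`. -/
def tilde (hT : IsIsometricRep σ T) : InteriorTensor E σ →L[ℂ] H :=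
  (liftₗᵢ σ ((ContinuousLinearMap.coeLM ℂ).comp T) hT.inner_map_map).toContinuousLinearMap

theorem tilde_tmul (hT : IsIsometricRep σ T) (ξ : E) (h : H) :
    hT.tilde (tmul σ ξ h) = T ξ h :=
  liftₗᵢ_tmul σ _ hT.inner_map_map ξ h

theorem tilde_leftRep (hT : IsIsometricRep σ T) (a : A) (v : InteriorTensor E σ) :
    hT.tilde (leftRep E σ a v) = σ a (hT.tilde v) := by
  have : hT.tilde ∘L leftRep E σ a = σ a ∘L hT.tilde := interiorTensor_ext σ fun ξ h => by
    simp [leftRep_tmul, tilde_tmul, hT.map_lact]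
  exact congrArg (fun f => f v) this

theorem adjoint_tilde_apply (hT : IsIsometricRep σ T) (a : A) (h : H) :
    ContinuousLinearMap.adjoint hT.tilde (σ a h) =
      leftRep E σ a (ContinuousLinearMap.adjoint hT.tilde h) := by
  refine ext_inner_right ℂ fun v => ?_
  have h1 : σ a = ContinuousLinearMap.adjoint (σ (star a)) := by
    rw [map_star, ContinuousLinearMap.star_eq_adjoint, ContinuousLinearMap.adjoint_adjoint]
  have h2 : leftRep E σ a = ContinuousLinearMap.adjoint (leftRep E σ (star a)) := by
    rw [map_star, ContinuousLinearMap.star_eq_adjoint, ContinuousLinearMap.adjoint_adjoint]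
  rw [h2, ContinuousLinearMap.adjoint_inner_left, ContinuousLinearMap.adjoint_inner_left,
    ContinuousLinearMap.adjoint_inner_left, hT.tilde_leftRep, h1,
    ContinuousLinearMap.adjoint_inner_left]

/-- `(σ, T)` is fully coisometric if `T̃ T̃* = I`. -/
def IsFullyCoisometric (hT : IsIsometricRep σ T) : Prop :=
  hT.tilde ∘L ContinuousLinearMap.adjoint hT.tilde = ContinuousLinearMap.id ℂ H

end IsIsometricRep

end SingleRep

/-! ### Product systems -/

/-- A product system of `C*`-correspondences over an additive commutative monoid `M` (such as
`ℕ₀ᵏ`): a family of correspondences `E n` with an associative multiplication inducing isomorphisms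
of correspondences `E m ⊗_A E n ≅ E (m + n)`, and with `E 0 = A` acting through the two module
actions. The multiplications are bilinear maps `E m × E n → E p`, one for each `m + n = p`. Such a
map extends to a unitary from the interior tensor product `E m ⊗_A E n` onto `E p` exactly if it
respects the inner products (`rinner_mul`) and its values are total (`mul_total`). -/
structure ProductSystem (A : Type*) [NonUnitalCStarAlgebra A] [PartialOrder A] [StarOrderedRing A]
    {M : Type*} [AddCommMonoid M] (E : M → Type*) [∀ n, NormedAddCommGroup (E n)]
    [∀ n, NormedSpace ℂ (E n)] [∀ n, CStarCorrespondence A (E n)] where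
  /-- the multiplication -/
  mul : ∀ {m n p : M}, m + n = p → (E m →ₗ[ℂ] E n →ₗ[ℂ] E p)
  rinner_mul : ∀ {m n p : M} (h : m + n = p) (ξ ξ' : E m) (η η' : E n),
    rinner A (mul h ξ η) (mul h ξ' η') = rinner A η (lact (rinner A ξ ξ') η')
  mul_total : ∀ {m n p : M} (h : m + n = p),
    (Submodule.span ℂ {z : E p | ∃ ξ η, mul h ξ η = z}).topologicalClosure = ⊤
  lact_mul : ∀ {m n p : M} (h : m + n = p) (a : A) (ξ : E m) (η : E n),
    mul h (lact a ξ) η = lact a (mul h ξ η)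
  mul_assoc : ∀ {l m n p q r : M} (h₁ : l + m = p) (h₂ : p + n = r) (h₃ : m + n = q)
    (h₄ : l + q = r) (ξ : E l) (η : E m) (ζ : E n),
    mul h₂ (mul h₁ ξ η) ζ = mul h₄ ξ (mul h₃ η ζ)
  /-- the identification of `A` with `E 0` -/
  unit : A ≃ₗ[ℂ] E 0
  rinner_unit : ∀ a b : A, rinner A (unit a) (unit b) = star a * b
  unit_mul : ∀ {n : M} (a : A) (ξ : E n), mul (zero_add n) (unit a) ξ = lact a ξ
  mul_unit : ∀ {n : M} (ξ : E n) (a : A), mul (add_zero n) ξ (unit a) = ract ξ a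

namespace ProductSystem

variable {A : Type*} [NonUnitalCStarAlgebra A] [PartialOrder A] [StarOrderedRing A]
variable {M : Type*} [AddCommMonoid M] {E : M → Type*} [∀ n, NormedAddCommGroup (E n)]
  [∀ n, NormedSpace ℂ (E n)] [∀ n, CStarCorrespondence A (E n)]
variable {H : Type*} [NormedAddCommGroup H] [InnerProductSpace ℂ H] [CompleteSpace H]

/-- The product subsystem over a submonoid. -/
def subsystem (P : ProductSystem A E) (S : AddSubmonoid M) :
    ProductSystem A (fun n : S => E (n : M)) where
  mul h := P.mul (congrArg Subtype.val h)
  rinner_mul h := P.rinner_mul (congrArg Subtype.val h)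
  mul_total h := P.mul_total (congrArg Subtype.val h)
  lact_mul h := P.lact_mul (congrArg Subtype.val h)
  mul_assoc h₁ h₂ h₃ h₄ := P.mul_assoc (congrArg Subtype.val h₁) (congrArg Subtype.val h₂)
    (congrArg Subtype.val h₃) (congrArg Subtype.val h₄)
  unit := P.unit
  rinner_unit := P.rinner_unit
  unit_mul := P.unit_mul
  mul_unit := P.mul_unit

variable (P : ProductSystem A E) {m n p : M} (h : m + n = p)

section Creation

variable (σ : A →⋆ₙₐ[ℂ] (H →L[ℂ] H))

/-- The creation operator `T_ξ ⊗ I : E n ⊗_σ H → E p ⊗_σ H`, `η ⊗ x ↦ ξη ⊗ x`, for `ξ ∈ E m` and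
`m + n = p`. -/
def creation (ξ : E m) : InteriorTensor (E n) σ →L[ℂ] InteriorTensor (E p) σ :=
  mapLeft σ (P.mul h ξ) (rinner A ξ ξ) (P.rinner_mul h ξ ξ)

theorem creation_tmul (ξ : E m) (η : E n) (x : H) :
    P.creation h σ ξ (tmul σ η x) = tmul σ (P.mul h ξ η) x :=
  mapLeft_tmul σ _ _ (P.rinner_mul h ξ ξ) η x

theorem norm_creation_le (ξ : E m) (v : InteriorTensor (E n) σ) :
    ‖P.creation h σ ξ v‖ ≤ ‖ξ‖ * ‖v‖ := by
  refine (norm_mapLeft_le σ _ _ (P.rinner_mul h ξ ξ) v).trans_eq ?_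
  rw [← norm_sq_eq_norm_rinner, Real.sqrt_sq (norm_nonneg _)]

theorem inner_creation (ξ ξ' : E m) (v w : InteriorTensor (E n) σ) :
    ⟪P.creation h σ ξ v, P.creation h σ ξ' w⟫_ℂ =
      ⟪v, leftRep (E n) σ (rinner A ξ ξ') w⟫_ℂ := by
  induction v using interiorTensor_induction with
  | hc => exact isClosed_eq (by fun_prop) (by fun_prop)
  | h0 => simp
  | ha x₁ x₂ h₁ h₂ => rw [map_add, inner_add_left, h₁, h₂, inner_add_left]
  | ht η x =>
    induction w using interiorTensor_induction with
    | hc => exact isClosed_eq (by fun_prop) (by fun_prop)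
    | h0 => simp
    | ha x₁ x₂ h₁ h₂ => rw [map_add, inner_add_right, h₁, h₂, map_add, inner_add_right]
    | ht η' y =>
      rw [creation_tmul, creation_tmul, leftRep_tmul, inner_tmul, inner_tmul, P.rinner_mul]

/-- `creation` as a linear map in `ξ`. -/
def creationₗ : E m →ₗ[ℂ] (InteriorTensor (E n) σ →L[ℂ] InteriorTensor (E p) σ) where
  toFun ξ := P.creation h σ ξ
  map_add' ξ ξ' := interiorTensor_ext σ fun η x => by
    simp [creation_tmul, tmul_add_left]
  map_smul' c ξ := interiorTensor_ext σ fun η x => by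
    simp [creation_tmul, tmul_smul_left]

theorem creation_leftRep (a : A) (ξ : E m) (v : InteriorTensor (E n) σ) :
    P.creation h σ (lact a ξ) v = leftRep (E p) σ a (P.creation h σ ξ v) := by
  have : P.creation h σ (lact a ξ) = leftRep (E p) σ a ∘L P.creation h σ ξ :=
    interiorTensor_ext σ fun η x => by simp [creation_tmul, leftRep_tmul, P.lact_mul]
  exact congrArg (fun f => f v) this

/-- The isometry underlying `mulIso`. -/
def mulIsometry :
    InteriorTensor (E m) (leftRep (E n) σ) →ₗᵢ[ℂ] InteriorTensor (E p) σ :=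
  liftₗᵢ (leftRep (E n) σ) ((ContinuousLinearMap.coeLM ℂ).comp (P.creationₗ h σ))
    (fun ξ η v w => P.inner_creation h σ ξ η v w)

theorem mulIsometry_tmul (ξ : E m) (v : InteriorTensor (E n) σ) :
    P.mulIsometry h σ (tmul (leftRep (E n) σ) ξ v) = P.creation h σ ξ v :=
  liftₗᵢ_tmul _ _ (fun ξ η v w => P.inner_creation h σ ξ η v w) ξ v

theorem mulIsometry_surjective : Function.Surjective (P.mulIsometry h σ) := by
  have hcl : IsClosed (Set.range (P.mulIsometry h σ)) :=
    (P.mulIsometry h σ).isometry.isClosedEmbedding.isClosed_range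
  let R : Submodule ℂ (InteriorTensor (E p) σ) := LinearMap.range (P.mulIsometry h σ).toLinearMap
  have hclR : IsClosed {y | y ∈ R} := hcl
  intro y
  change y ∈ R
  induction y using interiorTensor_induction with
  | hc => exact hclR
  | h0 => exact zero_mem _
  | ha x₁ x₂ h₁ h₂ => exact add_mem h₁ h₂
  | ht ζ x =>
    let L : E p →L[ℂ] InteriorTensor (E p) σ := tmulLeft σ x
    have h1 : (Submodule.span ℂ {z : E p | ∃ ξ η, P.mul h ξ η = z}).topologicalClosure ≤
        R.comap L.toLinearMap := by
      refine Submodule.topologicalClosure_minimal _ ?_ (hclR.preimage L.continuous)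
      rw [Submodule.span_le]
      rintro _ ⟨ξ, η, rfl⟩
      exact ⟨tmul (leftRep (E n) σ) ξ (tmul σ η x), by
        rw [LinearIsometry.coe_toLinearMap, mulIsometry_tmul, creation_tmul]; rfl⟩
    rw [P.mul_total h] at h1
    exact h1 (Submodule.mem_top (x := ζ))

/-- The unitary `E m ⊗ (E n ⊗_σ H) ≅ E (m + n) ⊗_σ H`, `ξ ⊗ (η ⊗ x) ↦ ξη ⊗ x`. -/
def mulIso :
    InteriorTensor (E m) (leftRep (E n) σ) ≃ₗᵢ[ℂ] InteriorTensor (E p) σ :=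
  LinearIsometryEquiv.ofSurjective (P.mulIsometry h σ) (P.mulIsometry_surjective h σ)

theorem mulIso_tmul (ξ : E m) (v : InteriorTensor (E n) σ) :
    P.mulIso h σ (tmul (leftRep (E n) σ) ξ v) = P.creation h σ ξ v :=
  P.mulIsometry_tmul h σ ξ v

/-- The unitary `t ⊗ I : E m ⊗ (E n ⊗_σ H) → E n ⊗ (E m ⊗_σ H)`, where
`t : E m ⊗ E n ≅ E (m + n) = E (n + m) ≅ E n ⊗ E m` is the isomorphism given by the multiplication
of the product system. -/
def flip (m n : M) : InteriorTensor (E m) (leftRep (E n) σ) ≃ₗᵢ[ℂ]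
    InteriorTensor (E n) (leftRep (E m) σ) :=
  (P.mulIso (m := m) (n := n) rfl σ).trans (P.mulIso (add_comm n m) σ).symm

end Creation

end ProductSystem

/-! ### Isometric representations of product systems -/

section Rep

variable {A : Type*} [NonUnitalCStarAlgebra A] [PartialOrder A] [StarOrderedRing A]
variable {M : Type*} [AddCommMonoid M] {E : M → Type*} [∀ n, NormedAddCommGroup (E n)]
  [∀ n, NormedSpace ℂ (E n)] [∀ n, CStarCorrespondence A (E n)]
variable {ι : Type*}

/-- An isometric representation `(σ, (T⁽ⁱ⁾)_{i ∈ ι})` on `H` of a product system over a monoid `M`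
with generators `e i`, `i ∈ ι` (for `M = ℕ₀ᵏ`, the basis elements): `σ` is a nondegenerate
representation of `A`, every `(σ, T⁽ⁱ⁾)` is an isometric representation of `E_i = E (e i)`, and
`T̃⁽ⁱ⁾ (I ⊗ T̃⁽ʲ⁾) = T̃⁽ʲ⁾ (I ⊗ T̃⁽ⁱ⁾) (t_{i,j} ⊗ I)`. -/
structure IsometricRep (P : ProductSystem A E) (e : ι → M) (H : Type*) [NormedAddCommGroup H]
    [InnerProductSpace ℂ H] [CompleteSpace H] where
  /-- the representation of `A` -/
  σ : A →⋆ₙₐ[ℂ] (H →L[ℂ] H)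
  nondegenerate : IsNondegenerate σ
  /-- the maps `T⁽ⁱ⁾` -/
  T : ∀ i : ι, E (e i) →ₗ[ℂ] (H →L[ℂ] H)
  isIsometricRep : ∀ i, IsIsometricRep σ (T i)
  comm : ∀ i j, (isIsometricRep i).tilde ∘L
      mapRight (isIsometricRep j).tilde (isIsometricRep j).tilde_leftRep =
    (isIsometricRep j).tilde ∘L
      mapRight (isIsometricRep i).tilde (isIsometricRep i).tilde_leftRep ∘L
        (P.flip σ (e i) (e j)).toContinuousLinearEquiv.toContinuousLinearMap

namespace IsometricRep

variable {P : ProductSystem A E} {e : ι → M}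
variable {H : Type*} [NormedAddCommGroup H] [InnerProductSpace ℂ H] [CompleteSpace H]
variable {K : Type*} [NormedAddCommGroup K] [InnerProductSpace ℂ K] [CompleteSpace K]

/-- The isometry `T̃⁽ⁱ⁾ : E_i ⊗_σ H → H`. -/
abbrev tilde (R : IsometricRep P e H) (i : ι) : InteriorTensor (E (e i)) R.σ →L[ℂ] H :=
  (R.isIsometricRep i).tilde

/-- Double commutation:
`T̃⁽ʲ⁾* T̃⁽ⁱ⁾ = (I ⊗ T̃⁽ⁱ⁾) (t_{i,j} ⊗ I) (I ⊗ T̃⁽ʲ⁾*)` for all `i ≠ j`. -/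
def IsDoublyCommuting (R : IsometricRep P e H) : Prop :=
  ∀ i j, i ≠ j → ContinuousLinearMap.adjoint (R.tilde j) ∘L R.tilde i =
    mapRight (R.tilde i) (R.isIsometricRep i).tilde_leftRep ∘L
      (P.flip R.σ (e i) (e j)).toContinuousLinearEquiv.toContinuousLinearMap ∘L
        mapRight (ContinuousLinearMap.adjoint (R.tilde j)) (R.isIsometricRep j).adjoint_tilde_apply

/-- Isomorphism (unitary equivalence) of representations. -/
def Isomorphic (R : IsometricRep P e H) (S : IsometricRep P e K) : Prop :=
  ∃ U : H ≃ₗᵢ[ℂ] K, (∀ a x, U (R.σ a x) = S.σ a (U x)) ∧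
    ∀ i ξ x, U (R.T i ξ x) = S.T i ξ (U x)

/-- A closed subspace `K` is reducing if `K` and `Kᗮ` are invariant under all `σ(a)` and all
`T⁽ⁱ⁾(ξ)`. -/
structure IsReducing (R : IsometricRep P e H) (K : ClosedSubmodule ℂ H) : Prop where
  σ_mem : ∀ a, ∀ x ∈ K.toSubmodule, R.σ a x ∈ K.toSubmodule
  σ_mem_orthogonal : ∀ a, ∀ x ∈ K.toSubmoduleᗮ, R.σ a x ∈ K.toSubmoduleᗮ
  T_mem : ∀ i ξ, ∀ x ∈ K.toSubmodule, R.T i ξ x ∈ K.toSubmodule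
  T_mem_orthogonal : ∀ i ξ, ∀ x ∈ K.toSubmoduleᗮ, R.T i ξ x ∈ K.toSubmoduleᗮ

end IsometricRep

instance completeSpace_closedSubmodule {H : Type*} [NormedAddCommGroup H] [InnerProductSpace ℂ H]
    [CompleteSpace H] (K : ClosedSubmodule ℂ H) : CompleteSpace K.toSubmodule :=
  K.isClosed.completeSpace_coe

/-- The restriction of a `*`-representation to an invariant closed subspace. -/
def restrictStarHom {H : Type*} [NormedAddCommGroup H] [InnerProductSpace ℂ H]
    [CompleteSpace H] (σ : A →⋆ₙₐ[ℂ] (H →L[ℂ] H)) (K : ClosedSubmodule ℂ H)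
    (hK : ∀ a, ∀ x ∈ K.toSubmodule, σ a x ∈ K.toSubmodule) :
    A →⋆ₙₐ[ℂ] (K.toSubmodule →L[ℂ] K.toSubmodule) where
  toFun a := (σ a).restrict (hK a)
  map_smul' c a := by ext x; simp
  map_zero' := by ext x; simp
  map_add' a b := by ext x; simp
  map_mul' a b := by ext x; simp
  map_star' a := by
    rw [ContinuousLinearMap.star_eq_adjoint, ContinuousLinearMap.eq_adjoint_iff]
    intro x y
    simp [Submodule.coe_inner, map_star, ContinuousLinearMap.star_eq_adjoint,
      ContinuousLinearMap.adjoint_inner_left]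

section Naturality

variable {H : Type*} [NormedAddCommGroup H] [InnerProductSpace ℂ H] [CompleteSpace H]
variable {K : Type*} [NormedAddCommGroup K] [InnerProductSpace ℂ K] [CompleteSpace K]
variable {σ : A →⋆ₙₐ[ℂ] (H →L[ℂ] H)} {ρ : A →⋆ₙₐ[ℂ] (K →L[ℂ] K)}

theorem mapRight_leftRep {F : Type*} [NormedAddCommGroup F] [NormedSpace ℂ F]
    [CStarCorrespondence A F] (S : H →L[ℂ] K) (hS : ∀ a h, S (σ a h) = ρ a (S h)) (a : A)
    (v : InteriorTensor F σ) :
    mapRight S hS (leftRep F σ a v) = leftRep F ρ a (mapRight S hS v) := by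
  have : mapRight S hS ∘L leftRep F σ a = leftRep F ρ a ∘L mapRight S hS :=
    interiorTensor_ext σ fun ξ h => by simp [leftRep_tmul, mapRight_tmul]
  exact congrArg (fun f => f v) this

theorem mapRight_creation (P : ProductSystem A E) {m n p : M} (h : m + n = p) (S : H →L[ℂ] K)
    (hS : ∀ a h, S (σ a h) = ρ a (S h)) (ξ : E m) (v : InteriorTensor (E n) σ) :
    mapRight S hS (P.creation h σ ξ v) = P.creation h ρ ξ (mapRight S hS v) := by
  have : mapRight S hS ∘L P.creation h σ ξ = P.creation h ρ ξ ∘L mapRight S hS :=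
    interiorTensor_ext σ fun ξ h => by simp [P.creation_tmul, mapRight_tmul]
  exact congrArg (fun f => f v) this

theorem mapRight_mulIso (P : ProductSystem A E) {m n p : M} (h : m + n = p) (S : H →L[ℂ] K)
    (hS : ∀ a h, S (σ a h) = ρ a (S h)) (v : InteriorTensor (E m) (leftRep (E n) σ)) :
    mapRight S hS (P.mulIso h σ v) =
      P.mulIso h ρ (mapRight (mapRight S hS) (mapRight_leftRep S hS) v) := by
  have : mapRight S hS ∘L (P.mulIso h σ).toContinuousLinearEquiv.toContinuousLinearMap =
      (P.mulIso h ρ).toContinuousLinearEquiv.toContinuousLinearMap ∘L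
        mapRight (mapRight S hS) (mapRight_leftRep S hS) :=
    interiorTensor_ext _ fun ξ v => by
      simp [P.mulIso_tmul, mapRight_tmul, mapRight_creation]
  exact congrArg (fun f => f v) this

theorem mapRight_flip (P : ProductSystem A E) (m n : M) (S : H →L[ℂ] K)
    (hS : ∀ a h, S (σ a h) = ρ a (S h)) (v : InteriorTensor (E m) (leftRep (E n) σ)) :
    mapRight (mapRight S hS) (mapRight_leftRep S hS) (P.flip σ m n v) =
      P.flip ρ m n (mapRight (mapRight S hS) (mapRight_leftRep S hS) v) := by
  apply (P.mulIso (add_comm n m) ρ).injective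
  rw [← mapRight_mulIso]
  simp only [ProductSystem.flip, LinearIsometryEquiv.trans_apply,
    LinearIsometryEquiv.apply_symm_apply]
  rw [mapRight_mulIso]

theorem IsIsometricRep.tilde_mapRight {F : Type*} [NormedAddCommGroup F] [NormedSpace ℂ F]
    [CStarCorrespondence A F] {T : F →ₗ[ℂ] (H →L[ℂ] H)} {T' : F →ₗ[ℂ] (K →L[ℂ] K)}
    (hT : IsIsometricRep σ T) (hT' : IsIsometricRep ρ T') (S : H →L[ℂ] K)
    (hS : ∀ a h, S (σ a h) = ρ a (S h)) (hST : ∀ ξ h, S (T ξ h) = T' ξ (S h))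
    (v : InteriorTensor F σ) : S (hT.tilde v) = hT'.tilde (mapRight S hS v) := by
  have : S ∘L hT.tilde = hT'.tilde ∘L mapRight S hS :=
    interiorTensor_ext σ fun ξ h => by simp [IsIsometricRep.tilde_tmul, mapRight_tmul, hST]
  exact congrArg (fun f => f v) this

theorem mapRight_mapRight {F : Type*} [NormedAddCommGroup F] [NormedSpace ℂ F]
    [CStarCorrespondence A F] {H₁ H₂ H₃ : Type*}
    [NormedAddCommGroup H₁] [InnerProductSpace ℂ H₁] [CompleteSpace H₁]
    [NormedAddCommGroup H₂] [InnerProductSpace ℂ H₂] [CompleteSpace H₂]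
    [NormedAddCommGroup H₃] [InnerProductSpace ℂ H₃] [CompleteSpace H₃]
    {σ₁ : A →⋆ₙₐ[ℂ] (H₁ →L[ℂ] H₁)} {σ₂ : A →⋆ₙₐ[ℂ] (H₂ →L[ℂ] H₂)}
    {σ₃ : A →⋆ₙₐ[ℂ] (H₃ →L[ℂ] H₃)} (S₁ : H₁ →L[ℂ] H₂) (h₁ : ∀ a h, S₁ (σ₁ a h) = σ₂ a (S₁ h))
    (S₂ : H₂ →L[ℂ] H₃) (h₂ : ∀ a h, S₂ (σ₂ a h) = σ₃ a (S₂ h)) (S : H₁ →L[ℂ] H₃)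
    (hS : ∀ a h, S (σ₁ a h) = σ₃ a (S h)) (hc : ∀ h, S₂ (S₁ h) = S h) (v : InteriorTensor F σ₁) :
    mapRight S₂ h₂ (mapRight S₁ h₁ v) = mapRight S hS v := by
  have : mapRight S₂ h₂ ∘L mapRight S₁ h₁ = (mapRight S hS : InteriorTensor F σ₁ →L[ℂ] _) :=
    interiorTensor_ext σ₁ fun ξ h => by simp [mapRight_tmul, hc]
  exact congrArg (fun f => f v) this

end Naturality

namespace IsometricRep

variable {P : ProductSystem A E} {e : ι → M}
variable {H : Type*} [NormedAddCommGroup H] [InnerProductSpace ℂ H] [CompleteSpace H]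

/-- The restriction of `T⁽ⁱ⁾` to a reducing subspace. -/
def restrictT (R : IsometricRep P e H) {K : ClosedSubmodule ℂ H} (hK : R.IsReducing K) (i : ι) :
    E (e i) →ₗ[ℂ] (K.toSubmodule →L[ℂ] K.toSubmodule) where
  toFun ξ := (R.T i ξ).restrict (hK.T_mem i ξ)
  map_add' ξ η := by ext x; simp
  map_smul' c ξ := by ext x; simp

theorem isIsometricRep_restrictT (R : IsometricRep P e H) {K : ClosedSubmodule ℂ H}
    (hK : R.IsReducing K) (i : ι) :
    IsIsometricRep (restrictStarHom R.σ K hK.σ_mem) (R.restrictT hK i) where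
  map_lact a ξ := by
    ext x
    simp [restrictT, restrictStarHom, (R.isIsometricRep i).map_lact]
  map_ract ξ a := by
    ext x
    simp [restrictT, restrictStarHom, (R.isIsometricRep i).map_ract]
  isometric ξ η := by
    ext1 x
    refine ext_inner_left ℂ fun y => ?_
    rw [ContinuousLinearMap.comp_apply, ContinuousLinearMap.adjoint_inner_right]
    exact (R.isIsometricRep i).inner_map_map ξ η (y : H) (x : H)

theorem nondegenerate_restrictStarHom (R : IsometricRep P e H) {K : ClosedSubmodule ℂ H}
    (hK : R.IsReducing K) : IsNondegenerate (restrictStarHom R.σ K hK.σ_mem) := by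
  let L : H →L[ℂ] K.toSubmodule := K.toSubmodule.orthogonalProjectionOnto
  have hL : ∀ a x, L (R.σ a x) = restrictStarHom R.σ K hK.σ_mem a (L x) := by
    intro a x
    refine ext_inner_right ℂ fun y => ?_
    have h1 : ∀ z (y : K.toSubmodule), ⟪L z, y⟫_ℂ = ⟪z, (y : H)⟫_ℂ := fun z y => by
      rw [Submodule.coe_inner]
      exact Submodule.inner_orthogonalProjectionOnto_eq_of_mem_right y z
    have h2 : R.σ a = ContinuousLinearMap.adjoint (R.σ (star a)) := by
      rw [map_star, ContinuousLinearMap.star_eq_adjoint, ContinuousLinearMap.adjoint_adjoint]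
    have h3 : restrictStarHom R.σ K hK.σ_mem a =
        ContinuousLinearMap.adjoint (restrictStarHom R.σ K hK.σ_mem (star a)) := by
      rw [map_star, ContinuousLinearMap.star_eq_adjoint, ContinuousLinearMap.adjoint_adjoint]
    rw [h1, h2, h3, ContinuousLinearMap.adjoint_inner_left, ContinuousLinearMap.adjoint_inner_left,
      h1]
    rfl
  unfold IsNondegenerate
  set V := Submodule.span ℂ {z : K.toSubmodule | ∃ a x, restrictStarHom R.σ K hK.σ_mem a x = z}
  have h4 : (Submodule.span ℂ {z : H | ∃ a x, R.σ a x = z}).topologicalClosure ≤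
      V.topologicalClosure.comap L.toLinearMap := by
    refine Submodule.topologicalClosure_minimal _ ?_
      (V.isClosed_topologicalClosure.preimage L.continuous)
    rw [Submodule.span_le]
    rintro _ ⟨a, x, rfl⟩
    exact V.le_topologicalClosure (Submodule.subset_span ⟨a, L x, (hL a x).symm⟩)
  rw [R.nondegenerate] at h4
  rw [eq_top_iff]
  rintro x -
  have h5 : L (x : H) = x := Submodule.orthogonalProjectionOnto_mem_subspace_eq_self x
  rw [← h5]
  exact h4 (Submodule.mem_top (x := (x : H)))

/-- The summand of a representation on a reducing subspace. -/
def restrict (R : IsometricRep P e H) {K : ClosedSubmodule ℂ H} (hK : R.IsReducing K) :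
    IsometricRep P e K.toSubmodule where
  σ := restrictStarHom R.σ K hK.σ_mem
  nondegenerate := R.nondegenerate_restrictStarHom hK
  T := R.restrictT hK
  isIsometricRep := R.isIsometricRep_restrictT hK
  comm i j := by
    let S : K.toSubmodule →L[ℂ] H := K.toSubmodule.subtypeL
    have hS : ∀ a h, S (restrictStarHom R.σ K hK.σ_mem a h) = R.σ a (S h) := fun a h => rfl
    have hST : ∀ i ξ h, S (R.restrictT hK i ξ h) = R.T i ξ (S h) := fun i ξ h => rfl
    have key : ∀ i j v, S ((R.isIsometricRep_restrictT hK i).tilde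
        (mapRight (R.isIsometricRep_restrictT hK j).tilde
          (R.isIsometricRep_restrictT hK j).tilde_leftRep v)) =
        R.tilde i (mapRight (R.tilde j) (R.isIsometricRep j).tilde_leftRep
          (mapRight (mapRight S hS) (mapRight_leftRep S hS) v)) := by
      intro i j v
      rw [(R.isIsometricRep_restrictT hK i).tilde_mapRight (R.isIsometricRep i) S hS (hST i)]
      have hc : ∀ a h, (S ∘L (R.isIsometricRep_restrictT hK j).tilde) (leftRep _ _ a h) =
          R.σ a ((S ∘L (R.isIsometricRep_restrictT hK j).tilde) h) := fun a h => by
        rw [ContinuousLinearMap.comp_apply, (R.isIsometricRep_restrictT hK j).tilde_leftRep, hS]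
        rfl
      rw [mapRight_mapRight _ _ _ _ (S ∘L (R.isIsometricRep_restrictT hK j).tilde) hc
        fun h => rfl]
      rw [mapRight_mapRight _ _ _ _ (S ∘L (R.isIsometricRep_restrictT hK j).tilde) hc fun h =>
        ((R.isIsometricRep_restrictT hK j).tilde_mapRight (R.isIsometricRep j) S hS (hST j) h).symm]
    ext1 v
    apply Subtype.val_injective
    have h1 := congrArg (fun f => f (mapRight (mapRight S hS) (mapRight_leftRep S hS) v))
      (R.comm i j)
    refine (key i j v).trans (h1.trans ?_)
    refine Eq.trans ?_ (key j i (P.flip _ (e i) (e j) v)).symm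
    exact congrArg (fun w => R.tilde j (mapRight (R.tilde i) (R.isIsometricRep i).tilde_leftRep w))
      (mapRight_flip P (e i) (e j) S hS v).symm

/-- The representation of the subsystem over a submonoid `S` obtained by keeping only some of the
generators. -/
def subsystem (R : IsometricRep P e H) (S : AddSubmonoid M) {κ : Type*} (f : κ → ι)
    (hf : ∀ j, e (f j) ∈ S) : IsometricRep (P.subsystem S) (fun j => (⟨e (f j), hf j⟩ : S)) H where
  σ := R.σ
  nondegenerate := R.nondegenerate
  T j := R.T (f j)
  isIsometricRep j := R.isIsometricRep (f j)
  comm i j := R.comm (f i) (f j)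

end IsometricRep

end Rep

/-! ### Induced representations -/

section Fock

variable {I : Type*} {G G' : I → Type*} [∀ n, NormedAddCommGroup (G n)]
  [∀ n, InnerProductSpace ℂ (G n)] [∀ n, NormedAddCommGroup (G' n)]
  [∀ n, InnerProductSpace ℂ (G' n)]

open scoped Classical in
/-- The inclusion of the `n`-th summand into a Hilbert space direct sum. -/
def incl (n : I) : G n →ₗᵢ[ℂ] lp G 2 where
  toFun := lp.single 2 n
  map_add' := lp.single_add 2 n
  map_smul' := lp.single_smul 2 n
  norm_map' := lp.norm_single (by norm_num) n

theorem inner_incl_left (n : I) (v : G n) (f : lp G 2) : ⟪incl n v, f⟫_ℂ = ⟪v, f n⟫_ℂ := by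
  classical
  exact lp.inner_single_left n v f

theorem incl_apply_self (n : I) (v : G n) : (incl n v : lp G 2) n = v := by
  classical
  exact lp.single_apply_self 2 n v

theorem incl_apply_ne {n m : I} (hmn : m ≠ n) (v : G n) : (incl n v : lp G 2) m = 0 := by
  classical
  exact lp.single_apply_ne 2 n v hmn

theorem hasSum_incl (f : lp G 2) : HasSum (fun n => incl n (f n)) f := by
  classical
  exact lp.hasSum_single (by norm_num) f

theorem orthogonalFamily_incl {J : Type*} (s : J → I) (hs : Function.Injective s) :
    OrthogonalFamily ℂ (fun n => G (s n)) (fun n => (incl (s n) : G (s n) →ₗᵢ[ℂ] lp G 2)) := by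
  intro m n hmn v w
  rw [inner_incl_left, incl_apply_ne (fun h => hmn (hs h)), inner_zero_right]

theorem ext_inner_incl {f g : lp G 2} (h : ∀ n v, ⟪incl n v, f⟫_ℂ = ⟪incl n v, g⟫_ℂ) :
    f = g := by
  ext n
  refine ext_inner_left ℂ fun v => ?_
  rw [← inner_incl_left, ← inner_incl_left, h]

theorem clm_ext_incl {X : Type*} [NormedAddCommGroup X] [NormedSpace ℂ X] {S T : lp G 2 →L[ℂ] X}
    (h : ∀ n v, S (incl n v) = T (incl n v)) : S = T := by
  ext f
  have h1 := (hasSum_incl f).mapL S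
  simp only [h] at h1
  exact h1.unique ((hasSum_incl f).mapL T)

/-- The direct sum of a bounded family of operators. -/
def diagMap (B : ∀ n, G n →L[ℂ] G' n) (C : ℝ) (hB : ∀ n x, ‖B n x‖ ≤ C * ‖x‖) :
    lp G 2 →L[ℂ] lp G' 2 :=
  LinearMap.mkContinuous
    { toFun := fun f => ⟨fun n => B n (f n), by
        have h1 : Summable fun n => ‖f n‖ ^ 2 := by
          simpa using (lp.memℓp f).summable (by norm_num)
        refine (memℓp_gen_iff (by norm_num)).mpr ?_
        refine Summable.of_nonneg_of_le (fun n => by positivity) (fun n => ?_)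
          (h1.mul_left (C ^ 2))
        have h2 := pow_le_pow_left₀ (norm_nonneg _) (hB n (f n)) 2
        simpa [mul_pow] using h2⟩
      map_add' := fun f g => by ext n; exact map_add (B n) _ _
      map_smul' := fun c f => by ext n; exact map_smul (B n) _ _ } |C| fun f => by
    have h1 : HasSum (fun n => ‖f n‖ ^ 2) (‖f‖ ^ 2) := by
      simpa using lp.hasSum_norm (p := 2) (by norm_num) f
    refine le_of_sq_le_sq ?_ (by positivity)
    rw [mul_pow, sq_abs]
    refine hasSum_le (fun n => ?_) (by simpa using lp.hasSum_norm (p := 2) (by norm_num) _)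
      (h1.mul_left (C ^ 2))
    have h2 := pow_le_pow_left₀ (norm_nonneg _) (hB n (f n)) 2
    simpa [mul_pow] using h2

theorem diagMap_incl (B : ∀ n, G n →L[ℂ] G' n) (C : ℝ) (hB : ∀ n x, ‖B n x‖ ≤ C * ‖x‖) (n : I)
    (v : G n) : diagMap B C hB (incl n v) = incl n (B n v) := by
  ext m
  change B m ((incl n v : lp G 2) m) = _
  by_cases hm : m = n
  · subst hm
    rw [incl_apply_self, incl_apply_self]
  · rw [incl_apply_ne hm, incl_apply_ne hm, map_zero]

variable [∀ n, CompleteSpace (G n)]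

/-- The operator mapping the `n`-th summand to the `s n`-th summand by `B n`, for an injection `s`
and a bounded family `B`. -/
def shiftMap (s : I → I) (hs : Function.Injective s) (B : ∀ n, G n →L[ℂ] G (s n)) (C : ℝ)
    (hB : ∀ n x, ‖B n x‖ ≤ C * ‖x‖) : lp G 2 →L[ℂ] lp G 2 :=
  (orthogonalFamily_incl s hs).linearIsometry.toContinuousLinearMap ∘L diagMap B C hB

theorem shiftMap_incl (s : I → I) (hs : Function.Injective s) (B : ∀ n, G n →L[ℂ] G (s n)) (C : ℝ)
    (hB : ∀ n x, ‖B n x‖ ≤ C * ‖x‖) (n : I) (v : G n) :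
    shiftMap s hs B C hB (incl n v) = incl (s n) (B n v) := by
  classical
  rw [shiftMap, ContinuousLinearMap.comp_apply, diagMap_incl]
  exact (orthogonalFamily_incl (G := G) s hs).linearIsometry_apply_single (B n v)

end Fock

section Induced

universe v

variable {A : Type*} [NonUnitalCStarAlgebra A] [PartialOrder A] [StarOrderedRing A]
variable {M : Type*} [AddCommMonoid M] {E : M → Type*}
  [∀ n, NormedAddCommGroup (E n)] [∀ n, NormedSpace ℂ (E n)] [∀ n, CStarCorrespondence A (E n)]
variable {K : Type*} [NormedAddCommGroup K] [InnerProductSpace ℂ K] [CompleteSpace K]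

variable (E) in
/-- The Hilbert space `F(E) ⊗_π K = ⨁ n, E n ⊗_π K`, where `F(E) = ⨁ n, E n` is the Fock space. -/
abbrev FockSpace (π : A →⋆ₙₐ[ℂ] (K →L[ℂ] K)) : Type _ :=
  lp (fun n : M => InteriorTensor (E n) π) 2

theorem norm_leftRep_le (F : Type*) [NormedAddCommGroup F] [NormedSpace ℂ F]
    [CStarCorrespondence A F] (π : A →⋆ₙₐ[ℂ] (K →L[ℂ] K)) (a : A) (x : InteriorTensor F π) :
    ‖leftRep F π a x‖ ≤ ‖a‖ * ‖x‖ :=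
  ((leftRep F π a).le_opNorm x).trans
    (mul_le_mul_of_nonneg_right (NonUnitalStarAlgHom.norm_apply_le _ a) (norm_nonneg x))

variable (E) in
/-- The representation `a ↦ φ_∞(a) ⊗ I` of `A` on `F(E) ⊗_π K`, acting on the summand
`E n ⊗_π K` as `φ_n(a) ⊗ I`. -/
def inducedσ (π : A →⋆ₙₐ[ℂ] (K →L[ℂ] K)) :
    A →⋆ₙₐ[ℂ] (FockSpace E π →L[ℂ] FockSpace E π) :=
  { toFun := fun a => diagMap (fun n => leftRep (E n) π a) ‖a‖ (fun n => norm_leftRep_le (E n) π a)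
    map_smul' := fun c a => clm_ext_incl fun n v => by simp [diagMap_incl]
    map_zero' := clm_ext_incl fun n v => by simp [diagMap_incl]
    map_add' := fun a b => clm_ext_incl fun n v => by simp [diagMap_incl]
    map_mul' := fun a b => clm_ext_incl fun n v => by simp [diagMap_incl]
    map_star' := fun a => by
      rw [ContinuousLinearMap.star_eq_adjoint]
      refine clm_ext_incl fun n v => ?_
      refine ext_inner_incl fun m w => ?_
      rw [ContinuousLinearMap.adjoint_inner_right,
        diagMap_incl, diagMap_incl, inner_incl_left, inner_incl_left]
      by_cases hm : m = n
      · subst hm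
        rw [incl_apply_self, incl_apply_self, map_star, ContinuousLinearMap.star_eq_adjoint,
          ContinuousLinearMap.adjoint_inner_right]
      · rw [incl_apply_ne hm, incl_apply_ne hm, inner_zero_right, inner_zero_right] }

theorem inducedσ_incl (π : A →⋆ₙₐ[ℂ] (K →L[ℂ] K)) (a : A) (n : M) (v : InteriorTensor (E n) π) :
    inducedσ E π a (incl n v) = incl n (leftRep (E n) π a v) :=
  diagMap_incl (G := fun n : M => InteriorTensor (E n) π) (fun n => leftRep (E n) π a) ‖a‖
    (fun n => norm_leftRep_le (E n) π a) n v

namespace ProductSystem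

variable (P : ProductSystem A E) (π : A →⋆ₙₐ[ℂ] (K →L[ℂ] K))

theorem incl_creation {m n p q : M} (h : m + n = p) (h' : m + n = q) (ξ : E m)
    (v : InteriorTensor (E n) π) :
    (incl p (P.creation h π ξ v) : FockSpace E π) = incl q (P.creation h' π ξ v) := by
  subst h
  subst h'
  rfl

theorem creation_creation {l m n p q r : M} (h₁ : l + m = p) (h₂ : p + n = r) (h₃ : m + n = q)
    (h₄ : l + q = r) (ξ : E l) (η : E m) (v : InteriorTensor (E n) π) :
    P.creation h₄ π ξ (P.creation h₃ π η v) = P.creation h₂ π (P.mul h₁ ξ η) v := by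
  have : P.creation h₄ π ξ ∘L P.creation h₃ π η = P.creation h₂ π (P.mul h₁ ξ η) :=
    interiorTensor_ext π fun ζ x => by
      rw [ContinuousLinearMap.comp_apply, creation_tmul, creation_tmul, creation_tmul,
        P.mul_assoc h₁ h₂ h₃ h₄]
  exact congrArg (fun f => f v) this

theorem creation_ract {m n p : M} (h : m + n = p) (ξ : E m) (a : A)
    (v : InteriorTensor (E n) π) :
    P.creation h π (ract ξ a) v = P.creation h π ξ (leftRep (E n) π a v) := by
  have : P.creation h π (ract ξ a) = P.creation h π ξ ∘L leftRep (E n) π a :=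
    interiorTensor_ext π fun η x => by
      rw [ContinuousLinearMap.comp_apply, leftRep_tmul, creation_tmul, creation_tmul,
        ← P.mul_unit, P.mul_assoc (add_zero m) h (zero_add n) h, P.unit_mul]
  exact congrArg (fun f => f v) this

theorem nondegenerate_inducedσ : IsNondegenerate (inducedσ E π) := by
  unfold IsNondegenerate
  set V := Submodule.span ℂ {z : FockSpace E π | ∃ a x, inducedσ E π a x = z}
  have hV : IsClosed (V.topologicalClosure : Set (FockSpace E π)) := V.isClosed_topologicalClosure
  have h1 : ∀ (n : M) (v : InteriorTensor (E n) π), incl n v ∈ V.topologicalClosure := by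
    intro n v
    induction v using interiorTensor_induction with
    | hc => exact hV.preimage (incl (G := fun n : M => InteriorTensor (E n) π) n).continuous
    | h0 => rw [map_zero]; exact zero_mem _
    | ha x y hx hy => rw [map_add]; exact add_mem hx hy
    | ht ξ x =>
      let L : E n →L[ℂ] FockSpace E π :=
        (incl (G := fun n : M => InteriorTensor (E n) π) n).toContinuousLinearMap ∘L tmulLeft π x
      have h2 : (Submodule.span ℂ {z : E n | ∃ (a : A) (x : E n),
          CStarCorrespondence.lact a x = z}).topologicalClosure ≤
          V.topologicalClosure.comap L.toLinearMap := by
        refine Submodule.topologicalClosure_minimal _ ?_ (hV.preimage L.continuous)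
        rw [Submodule.span_le]
        rintro _ ⟨a, ξ, rfl⟩
        refine V.le_topologicalClosure (Submodule.subset_span ⟨a, incl n (tmul π ξ x), ?_⟩)
        rw [inducedσ_incl, leftRep_tmul]
        rfl
      rw [CStarCorrespondence.essential] at h2
      exact h2 (Submodule.mem_top (x := ξ))
  rw [eq_top_iff]
  rintro f -
  exact hV.mem_of_tendsto (hasSum_incl f)
    (Filter.Eventually.of_forall fun s => Submodule.sum_mem _ fun n _ => h1 n (f n))

variable [IsCancelAdd M]

/-- The operator `T_ξ ⊗ I` on `F(E) ⊗_π K`, where `T_ξ` is the creation operator `η ↦ ξη` on the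
Fock space. -/
def inducedOp {m : M} (ξ : E m) : FockSpace E π →L[ℂ] FockSpace E π :=
  shiftMap (fun n => m + n) (add_right_injective m) (fun _ => P.creation rfl π ξ) ‖ξ‖
    (fun _ v => P.norm_creation_le rfl π ξ v)

theorem inducedOp_incl {m n p : M} (h : m + n = p) (ξ : E m) (v : InteriorTensor (E n) π) :
    P.inducedOp π ξ (incl n v) = incl p (P.creation h π ξ v) :=
  (shiftMap_incl (G := fun n : M => InteriorTensor (E n) π) _ (add_right_injective m)
    (fun _ => P.creation rfl π ξ) _ _ n v).trans (P.incl_creation π rfl h ξ v)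

/-- The linear map `ξ ↦ T_ξ ⊗ I` on the fibre `E m`. -/
def inducedT (m : M) : E m →ₗ[ℂ] (FockSpace E π →L[ℂ] FockSpace E π) where
  toFun ξ := P.inducedOp π ξ
  map_add' ξ η := clm_ext_incl fun n v => by
    rw [add_apply, P.inducedOp_incl π rfl, P.inducedOp_incl π rfl,
      P.inducedOp_incl π rfl, ← map_add]
    exact congrArg (fun S => incl (G := fun n : M => InteriorTensor (E n) π) (m + n) (S v)) ((P.creationₗ (n := n) rfl π).map_add ξ η)
  map_smul' c ξ := clm_ext_incl fun n v => by
    rw [RingHom.id_apply, smul_apply, P.inducedOp_incl π rfl,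
      P.inducedOp_incl π rfl, ← map_smul]
    exact congrArg (fun S => incl (G := fun n : M => InteriorTensor (E n) π) (m + n) (S v)) ((P.creationₗ (n := n) rfl π).map_smul c ξ)

theorem inducedT_incl {m n p : M} (h : m + n = p) (ξ : E m) (v : InteriorTensor (E n) π) :
    P.inducedT π m ξ (incl n v) = incl p (P.creation h π ξ v) :=
  P.inducedOp_incl π h ξ v

theorem isIsometricRep_inducedT (m : M) : IsIsometricRep (inducedσ E π) (P.inducedT π m) where
  map_lact a ξ := clm_ext_incl fun n v => by
    rw [ContinuousLinearMap.comp_apply, P.inducedT_incl π rfl, P.inducedT_incl π rfl,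
      inducedσ_incl, P.creation_leftRep]
  map_ract ξ a := clm_ext_incl fun n v => by
    rw [ContinuousLinearMap.comp_apply, inducedσ_incl, P.inducedT_incl π rfl,
      P.inducedT_incl π rfl, P.creation_ract]
  isometric ξ η := clm_ext_incl fun n v => by
    refine ext_inner_incl fun l w => ?_
    rw [ContinuousLinearMap.comp_apply,
      ContinuousLinearMap.adjoint_inner_right, inducedσ_incl, P.inducedT_incl π rfl,
      P.inducedT_incl π rfl, inner_incl_left, inner_incl_left]
    by_cases hl : l = n
    · subst hl
      rw [incl_apply_self, incl_apply_self, P.inner_creation]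
    · rw [incl_apply_ne hl, incl_apply_ne (fun h => hl (add_right_injective m h)),
        inner_zero_right, inner_zero_right]

theorem inducedT_inducedT {m n p : M} (h : m + n = p) (ξ : E m) (η : E n) (f : FockSpace E π) :
    P.inducedT π m ξ (P.inducedT π n η f) = P.inducedT π p (P.mul h ξ η) f := by
  have : P.inducedT π m ξ ∘L P.inducedT π n η = P.inducedT π p (P.mul h ξ η) :=
    clm_ext_incl fun l v => by
      have h' : m + (n + l) = p + l := by rw [← h, add_assoc]
      rw [ContinuousLinearMap.comp_apply, P.inducedT_incl π rfl, P.inducedT_incl π h',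
        P.inducedT_incl π rfl, P.creation_creation π h rfl rfl h']
  exact congrArg (fun S => S f) this

theorem tilde_inducedT {m n p : M} (h : m + n = p)
    (v : InteriorTensor (E m) (leftRep (E n) (inducedσ E π))) :
    (P.isIsometricRep_inducedT π m).tilde (mapRight (P.isIsometricRep_inducedT π n).tilde
      (P.isIsometricRep_inducedT π n).tilde_leftRep v) =
    (P.isIsometricRep_inducedT π p).tilde (P.mulIso h (inducedσ E π) v) := by
  let S := (P.isIsometricRep_inducedT π p).tilde ∘L
    (P.mulIso h (inducedσ E π)).toContinuousLinearEquiv.toContinuousLinearMap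
  have : (P.isIsometricRep_inducedT π m).tilde ∘L mapRight (P.isIsometricRep_inducedT π n).tilde
      (P.isIsometricRep_inducedT π n).tilde_leftRep = S := by
    refine interiorTensor_ext _ fun ξ w => ?_
    have h1 : S (tmul _ ξ w) = (P.isIsometricRep_inducedT π p).tilde
        (P.creation h (inducedσ E π) ξ w) :=
      congrArg _ (P.mulIso_tmul h (inducedσ E π) ξ w)
    rw [h1, ContinuousLinearMap.comp_apply, mapRight_tmul, IsIsometricRep.tilde_tmul]
    have h2 : P.inducedT π m ξ ∘L (P.isIsometricRep_inducedT π n).tilde =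
        (P.isIsometricRep_inducedT π p).tilde ∘L P.creation h (inducedσ E π) ξ :=
      interiorTensor_ext _ fun η f => by
        rw [ContinuousLinearMap.comp_apply, ContinuousLinearMap.comp_apply, creation_tmul,
          IsIsometricRep.tilde_tmul, IsIsometricRep.tilde_tmul, P.inducedT_inducedT π h]
    exact congrArg (fun S => S w) h2
  exact congrArg (fun S => S v) this

/-- The isometric representation of a product system on `F(E) ⊗_π K` induced by a representation
`π` of `A` on `K`: `σ(a) = φ_∞(a) ⊗ I` and `T⁽ⁱ⁾(ξ) = T_ξ ⊗ I`, where `T_ξ` is the creation operator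
on the Fock space. -/
def inducedRep {ι : Type*} (e : ι → M) : IsometricRep P e (FockSpace E π) where
  σ := inducedσ E π
  nondegenerate := nondegenerate_inducedσ π
  T i := P.inducedT π (e i)
  isIsometricRep i := P.isIsometricRep_inducedT π (e i)
  comm i j := by
    ext1 v
    refine (P.tilde_inducedT π rfl v).trans (Eq.trans ?_
      (P.tilde_inducedT π (add_comm (e j) (e i)) (P.flip (inducedσ E π) (e i) (e j) v)).symm)
    exact congrArg _ ((P.mulIso (add_comm (e j) (e i)) (inducedσ E π)).apply_symm_apply _).symm

end ProductSystem

variable [IsCancelAdd M]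

/-- A representation is (isomorphic to) an induced representation if it is isomorphic to the
representation induced by some nondegenerate representation of `A` on a Hilbert space. -/
def IsometricRep.IsInduced {P : ProductSystem A E} {ι : Type*} {e : ι → M} {H : Type v}
    [NormedAddCommGroup H] [InnerProductSpace ℂ H] [CompleteSpace H]
    (R : IsometricRep P e H) : Prop :=
  ∃ (K : Type v) (_ : NormedAddCommGroup K) (_ : InnerProductSpace ℂ K) (_ : CompleteSpace K)
    (π : A →⋆ₙₐ[ℂ] (K →L[ℂ] K)), IsNondegenerate π ∧ R.Isomorphic (P.inducedRep π e)

/-- The submonoid of `ℕ₀ᵏ` of multi-indices supported in `α`, a copy of `ℕ₀^|α|`. -/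
def coordSubmonoid {k : ℕ} (α : Finset (Fin k)) : AddSubmonoid (Fin k → ℕ) where
  carrier := {n | ∀ i ∉ α, n i = 0}
  zero_mem' := fun _ _ => rfl
  add_mem' := fun hm hn i hi => by rw [Pi.add_apply, hm i hi, hn i hi]

theorem single_mem_coordSubmonoid {k : ℕ} (α : Finset (Fin k)) (i : α) :
    (Pi.single (i : Fin k) 1 : Fin k → ℕ) ∈ coordSubmonoid α := fun _ hj =>
  Pi.single_eq_of_ne (fun h => hj (by rw [h]; exact i.2)) 1

end Induced

end WoldDecomposition

end

open WoldDecomposition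

/-!
The argument rests on the closed subspaces `level n ⊆ H` spanned by `T(E n)H`, for `n ∈ ℕ₀ᵏ`. They
make sense because the commutation relations allow the maps `T⁽ⁱ⁾` to be extended multiplicatively
to all fibres `E n` (`IsometricRep.extend`); the extension is built generator by generator, and it
does not depend on the order of the generators (`IsExtension.unique`). Then `level (m + n)` is the
closed span of `T(E m) (level n)`. Double commutation says that, for `i ≠ j`, the operators `T⁽ⁱ⁾(ξ)`
leave the kernel of `T̃⁽ʲ⁾*` invariant, and it follows that `level (n e_j)` is reduced by `T⁽ⁱ⁾`
(`PreservesKernels.T_mem_orthogonal_level`). A recurring tool is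
`IsIsometricRep.mem_imageSpan_of_adjoint_mem`: a vector `y` in the range of `T̃` lies in the closed
span of `T(E)K` as soon as all `T(ξ)* y` lie in `K`. It takes the place of computations with
operators `I ⊗ S` on interior tensor products.

For every `i`, the intersection `coisometricPart i` of the subspaces `level (n e_i)` reduces the
representation, and the projections onto reducing subspaces preserve the `coisometricPart i`. So `H`
splits simultaneously along all of them, and `H_α` is the intersection of the `coisometricPart i`
for `i ∉ α` with the complements of the `coisometricPart i` for `i ∈ α` (`woldPart`).

On `H_α` the coisometric parts of index `i ∈ α` vanish, and then the representation of the subsystem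
is induced from its wandering subspace `W`, the common kernel of the `T̃⁽ⁱ⁾*` with `i ∈ α`
(`PreservesKernels.isInduced_subsystem`). Indeed `T(E n)W` lies in `level (n_i e_i)` and is orthogonal
to `level ((n_i + 1) e_i)`, so that these spaces are mutually orthogonal. They are total: if `x ≠ 0`
is orthogonal to all of them, a suitable product over `i ∈ α` of differences of consecutive
projections onto `level (m e_i)` maps `x` to a nonzero vector `y` with the same orthogonality, which
lies in `level n` and is orthogonal to the `level ((n_i + 1) e_i)`. The vectors `T(η)* y` with
`η ∈ E n` are wandering, hence `y` belongs to the closed span of `T(E n)W`, a contradiction.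

For uniqueness, let `(K_α)` be another such family. For `i ∉ α` full coisometry gives
`K_α ⊆ coisometricPart i`. For `i ∈ α`, the projection onto `K_α` followed by the isomorphism with a
Fock space intertwines `T⁽ⁱ⁾` with a creation operator, which raises the `i`-th degree by one, so it
annihilates `coisometricPart i`. Thus `K_α ⊆ H_α` for all `α`, and two orthogonal decompositions
which are comparable in this way coincide.
-/

noncomputable section

set_option linter.unusedSectionVars false

namespace WoldDecomposition

open scoped TensorProduct InnerProductSpace

/-! ### Closed spans of images -/

section ImageSpan

variable {A : Type*} [NonUnitalCStarAlgebra A] [PartialOrder A] [StarOrderedRing A]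
variable {E : Type*} [NormedAddCommGroup E] [NormedSpace ℂ E] [CStarCorrespondence A E]
variable {H : Type*} [NormedAddCommGroup H] [InnerProductSpace ℂ H] [CompleteSpace H]
variable {H' : Type*} [NormedAddCommGroup H'] [InnerProductSpace ℂ H'] [CompleteSpace H']
variable {σ : A →⋆ₙₐ[ℂ] (H →L[ℂ] H)}

/-- The closed linear span of the vectors `T(ξ)x` with `ξ ∈ E` and `x ∈ K`. -/
def imageSpan (T : E →ₗ[ℂ] (H →L[ℂ] H)) (K : Submodule ℂ H) : Submodule ℂ H :=
  (Submodule.span ℂ {z : H | ∃ ξ, ∃ x ∈ K, T ξ x = z}).topologicalClosure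

variable {T : E →ₗ[ℂ] (H →L[ℂ] H)} {T' : E →ₗ[ℂ] (H' →L[ℂ] H')}

theorem isClosed_imageSpan (K : Submodule ℂ H) : IsClosed (imageSpan T K : Set H) :=
  Submodule.isClosed_topologicalClosure _

instance (K : Submodule ℂ H) : CompleteSpace (imageSpan T K) :=
  (isClosed_imageSpan K).completeSpace_coe

theorem apply_mem_imageSpan (ξ : E) {x : H} {K : Submodule ℂ H} (hx : x ∈ K) :
    T ξ x ∈ imageSpan T K :=
  Submodule.le_topologicalClosure _ (Submodule.subset_span ⟨ξ, x, hx, rfl⟩)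

theorem imageSpan_le {K L : Submodule ℂ H} (hL : IsClosed (L : Set H))
    (h : ∀ ξ, ∀ x ∈ K, T ξ x ∈ L) : imageSpan T K ≤ L := by
  refine Submodule.topologicalClosure_minimal _ (Submodule.span_le.mpr ?_) hL
  rintro _ ⟨ξ, x, hx, rfl⟩
  exact h ξ x hx

theorem imageSpan_mono {K L : Submodule ℂ H} (h : K ≤ L) : imageSpan T K ≤ imageSpan T L :=
  imageSpan_le (isClosed_imageSpan L) fun ξ _ hx => apply_mem_imageSpan ξ (h hx)

theorem map_mem_imageSpan (f : H →L[ℂ] H') (hf : ∀ ξ x, f (T ξ x) = T' ξ (f x))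
    {K : Submodule ℂ H} {K' : Submodule ℂ H'} (hK : ∀ x ∈ K, f x ∈ K') {y : H}
    (hy : y ∈ imageSpan T K) : f y ∈ imageSpan T' K' := by
  have h : imageSpan T K ≤ (imageSpan T' K').comap f.toLinearMap :=
    imageSpan_le ((isClosed_imageSpan K').preimage f.continuous) fun ξ x hx => by
      rw [Submodule.mem_comap]
      exact (hf ξ x).symm ▸ apply_mem_imageSpan ξ (hK x hx)
  exact h hy

theorem mem_orthogonal_imageSpan_iff {K : Submodule ℂ H} {y : H} :
    y ∈ (imageSpan T K)ᗮ ↔ ∀ ξ, ∀ x ∈ K, ⟪T ξ x, y⟫_ℂ = 0 := by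
  refine ⟨fun h ξ x hx => h _ (apply_mem_imageSpan ξ hx), fun h => ?_⟩
  rw [Submodule.mem_orthogonal']
  have h1 : imageSpan T K ≤ (ℂ ∙ y)ᗮ :=
    imageSpan_le (Submodule.isClosed_orthogonal _) fun ξ x hx => by
      rw [Submodule.mem_orthogonal_singleton_iff_inner_left]
      exact h ξ x hx
  intro u hu
  exact (Submodule.mem_orthogonal_singleton_iff_inner_right).mp (h1 hu)

/-- A closed subspace whose orthogonal complement is invariant under `S` is invariant under the
adjoint of `S`. -/
theorem adjoint_mem_of_map_orthogonal {S : H →L[ℂ] H} {K : Submodule ℂ H}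
    (hK : IsClosed (K : Set H)) (h : ∀ x ∈ Kᗮ, S x ∈ Kᗮ) {x : H} (hx : x ∈ K) :
    ContinuousLinearMap.adjoint S x ∈ K := by
  have : CompleteSpace K := hK.completeSpace_coe
  rw [← K.orthogonal_orthogonal]
  intro u hu
  rw [ContinuousLinearMap.adjoint_inner_right]
  exact Submodule.inner_left_of_mem_orthogonal hx (h u hu)

theorem map_orthogonal_of_adjoint_mem {S : H →L[ℂ] H} {K : Submodule ℂ H}
    (h : ∀ x ∈ K, ContinuousLinearMap.adjoint S x ∈ K) {x : H} (hx : x ∈ Kᗮ) : S x ∈ Kᗮ := by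
  intro u hu
  rw [← ContinuousLinearMap.adjoint_inner_left]
  exact hx _ (h u hu)

theorem adjoint_map_star (σ : A →⋆ₙₐ[ℂ] (H →L[ℂ] H)) (a : A) :
    ContinuousLinearMap.adjoint (σ a) = σ (star a) := by
  rw [map_star, ContinuousLinearMap.star_eq_adjoint]

theorem map_orthogonal_of_invariant {K : Submodule ℂ H} (h : ∀ a, ∀ x ∈ K, σ a x ∈ K) (a : A)
    {x : H} (hx : x ∈ Kᗮ) : σ a x ∈ Kᗮ :=
  map_orthogonal_of_adjoint_mem (fun y hy => by rw [adjoint_map_star]; exact h _ y hy) hx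

/-- An orthogonal projection onto a subspace which is invariant under an operator `S` together
with its orthogonal complement commutes with `S`. -/
theorem starProjection_comm {S : H →L[ℂ] H} {K : Submodule ℂ H} [K.HasOrthogonalProjection]
    (h : ∀ x ∈ K, S x ∈ K) (h' : ∀ x ∈ Kᗮ, S x ∈ Kᗮ) (x : H) :
    K.starProjection (S x) = S (K.starProjection x) := by
  have h1 : S x = S (K.starProjection x) + S (x - K.starProjection x) := by
    rw [← map_add, add_sub_cancel]
  rw [h1, map_add, Submodule.starProjection_eq_self_iff.mpr (h _ (K.starProjection_apply_mem x)),
    (Submodule.starProjection_apply_eq_zero_iff K).mpr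
      (h' _ (K.sub_starProjection_mem_orthogonal x)), add_zero]

namespace IsIsometricRep

variable (hT : IsIsometricRep σ T)
include hT

theorem norm_apply_le (ξ : E) (x : H) : ‖T ξ x‖ ≤ ‖x‖ * ‖ξ‖ := by
  rw [← hT.tilde_tmul]
  refine Eq.trans_le ?_ (norm_tmul_le σ ξ x)
  exact (liftₗᵢ σ ((ContinuousLinearMap.coeLM ℂ).comp T) hT.inner_map_map).norm_map _

/-- The bounded map `ξ ↦ T(ξ)x`. -/
def evalL (x : H) : E →L[ℂ] H :=
  LinearMap.mkContinuous
    { toFun := fun ξ => T ξ x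
      map_add' := fun ξ η => by simp
      map_smul' := fun c ξ => by simp } ‖x‖ fun ξ => hT.norm_apply_le ξ x

/-- A closed linear condition on `T(ζ)x` may be checked for `ζ` in a total set. -/
theorem apply_mem_of_total {s : Set E} (hs : (Submodule.span ℂ s).topologicalClosure = ⊤)
    {K : Submodule ℂ H} (hK : IsClosed (K : Set H)) {x : H} (h : ∀ ζ ∈ s, T ζ x ∈ K) (ζ : E) :
    T ζ x ∈ K := by
  have h1 : (Submodule.span ℂ s).topologicalClosure ≤ K.comap (hT.evalL x).toLinearMap :=
    Submodule.topologicalClosure_minimal _ (Submodule.span_le.mpr h)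
      (hK.preimage (hT.evalL x).continuous)
  rw [hs] at h1
  exact h1 (Submodule.mem_top (x := ζ))

theorem rep_mem_imageSpan {K : Submodule ℂ H} (a : A)
    {y : H} (hy : y ∈ imageSpan T K) : σ a y ∈ imageSpan T K := by
  have h : imageSpan T K ≤ (imageSpan T K).comap (σ a).toLinearMap :=
    imageSpan_le ((isClosed_imageSpan K).preimage (σ a).continuous) fun ξ x hx => by
      have : σ a (T ξ x) = T (lact a ξ) x := by rw [hT.map_lact]; rfl
      exact (this.symm ▸ apply_mem_imageSpan _ hx : σ a (T ξ x) ∈ imageSpan T K)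
  exact h hy

theorem adjoint_apply_apply (ξ η : E) (x : H) :
    ContinuousLinearMap.adjoint (T ξ) (T η x) = σ (rinner A ξ η) x :=
  congrArg (fun S => S x) (hT.isometric ξ η)

theorem adjoint_mem_of_mem_imageSpan {K : Submodule ℂ H} (hKc : IsClosed (K : Set H))
    (hK : ∀ a, ∀ x ∈ K, σ a x ∈ K) {y : H} (hy : y ∈ imageSpan T K) (ξ : E) :
    ContinuousLinearMap.adjoint (T ξ) y ∈ K := by
  have h : imageSpan T K ≤ K.comap (ContinuousLinearMap.adjoint (T ξ)).toLinearMap :=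
    imageSpan_le (hKc.preimage (ContinuousLinearMap.adjoint (T ξ)).continuous) fun η x hx => by
      have := hT.adjoint_apply_apply ξ η x
      exact (this.symm ▸ hK _ x hx : ContinuousLinearMap.adjoint (T ξ) (T η x) ∈ K)
  exact h hy

theorem apply_mem_orthogonal_imageSpan {K : Submodule ℂ H} (hK : ∀ a, ∀ x ∈ K, σ a x ∈ K)
    {x : H} (hx : x ∈ Kᗮ) (ξ : E) : T ξ x ∈ (imageSpan T K)ᗮ := by
  rw [mem_orthogonal_imageSpan_iff]
  intro η y hy
  rw [hT.inner_map_map]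
  exact map_orthogonal_of_invariant hK _ hx y hy

/-- A vector in the range of `T̃` whose images under all `T(ξ)*` lie in a `σ`-invariant closed
subspace `K` belongs to the closed span of `T(E)K`. -/
theorem mem_imageSpan_of_adjoint_mem {K : Submodule ℂ H} (hKc : IsClosed (K : Set H))
    (hK : ∀ a, ∀ x ∈ K, σ a x ∈ K) {y : H} (hy : y ∈ imageSpan T ⊤)
    (h : ∀ ξ, ContinuousLinearMap.adjoint (T ξ) y ∈ K) : y ∈ imageSpan T K := by
  set L := imageSpan T K
  have h1 : L.starProjection y ∈ L := L.starProjection_apply_mem y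
  have h2 : y - L.starProjection y ∈ Lᗮ := L.sub_starProjection_mem_orthogonal y
  have h3 : y - L.starProjection y ∈ (imageSpan T ⊤)ᗮ := by
    rw [mem_orthogonal_imageSpan_iff]
    intro ξ x _
    have h4 : ContinuousLinearMap.adjoint (T ξ) (y - L.starProjection y) ∈ K := by
      rw [map_sub]
      exact sub_mem (h ξ) (hT.adjoint_mem_of_mem_imageSpan hKc hK h1 ξ)
    have h5 : ContinuousLinearMap.adjoint (T ξ) (y - L.starProjection y) ∈ Kᗮ := by
      intro x hx
      rw [ContinuousLinearMap.adjoint_inner_right]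
      exact h2 _ (apply_mem_imageSpan ξ hx)
    rw [← ContinuousLinearMap.adjoint_inner_right,
      (Submodule.disjoint_def.mp K.orthogonal_disjoint) _ h4 h5, inner_zero_right]
  have h4 : y - L.starProjection y ∈ imageSpan T ⊤ := sub_mem hy (imageSpan_mono le_top h1)
  have h5 := (Submodule.disjoint_def.mp (imageSpan T ⊤).orthogonal_disjoint) _ h4 h3
  rw [sub_eq_zero.mp h5]
  exact h1

theorem isFullyCoisometric_iff : hT.IsFullyCoisometric ↔ imageSpan T ⊤ = ⊤ := by
  set V := liftₗᵢ σ ((ContinuousLinearMap.coeLM ℂ).comp T) hT.inner_map_map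
  have hV : ∀ v, hT.tilde v = V v := fun v => rfl
  have h1 : ∀ v w, ⟪hT.tilde v, hT.tilde w⟫_ℂ = ⟪v, w⟫_ℂ := V.inner_map_map
  have h2 : ∀ v, ContinuousLinearMap.adjoint hT.tilde (hT.tilde v) = v := fun v =>
    ext_inner_left ℂ fun w => by rw [ContinuousLinearMap.adjoint_inner_right, h1]
  constructor
  · intro h
    rw [eq_top_iff]
    rintro x -
    have h3 : ∀ v, hT.tilde v ∈ imageSpan T ⊤ := by
      intro v
      induction v using interiorTensor_induction with
      | hc => exact (isClosed_imageSpan ⊤).preimage hT.tilde.continuous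
      | h0 => rw [map_zero]; exact zero_mem _
      | ha v w hv hw => rw [map_add]; exact add_mem hv hw
      | ht ξ x => rw [hT.tilde_tmul]; exact apply_mem_imageSpan ξ Submodule.mem_top
    have h4 : hT.tilde (ContinuousLinearMap.adjoint hT.tilde x) = x := congrArg (fun S => S x) h
    rw [← h4]
    exact h3 _
  · intro h
    have h3 : imageSpan T ⊤ ≤ LinearMap.eqLocus
        (hT.tilde ∘L ContinuousLinearMap.adjoint hT.tilde).toLinearMap
        (ContinuousLinearMap.id ℂ H).toLinearMap := by
      refine imageSpan_le (isClosed_eq (ContinuousLinearMap.continuous _)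
        (ContinuousLinearMap.continuous _)) fun ξ x _ => ?_
      rw [LinearMap.mem_eqLocus, ← hT.tilde_tmul]
      exact congrArg hT.tilde (h2 _)
    rw [h] at h3
    ext x
    exact h3 (Submodule.mem_top (x := x))

end IsIsometricRep

end ImageSpan

/-! ### Extension of a representation to all fibres -/

section Extension

variable {A : Type*} [NonUnitalCStarAlgebra A] [PartialOrder A] [StarOrderedRing A]
variable {M : Type*} [AddCommMonoid M] {E : M → Type*} [∀ n, NormedAddCommGroup (E n)]
  [∀ n, NormedSpace ℂ (E n)] [∀ n, CStarCorrespondence A (E n)]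
variable {H : Type*} [NormedAddCommGroup H] [InnerProductSpace ℂ H] [CompleteSpace H]
variable {σ : A →⋆ₙₐ[ℂ] (H →L[ℂ] H)} (P : ProductSystem A E)

section Single

variable {F : Type*} [NormedAddCommGroup F] [NormedSpace ℂ F] [CStarCorrespondence A F]

theorem eq_of_forall_rinner_eq {x y : F} (h : ∀ z, rinner A z x = rinner A z y) : x = y := by
  have h1 : rinner A (x - y) (x - y) = 0 := by
    have h2 : rinner A (x - y) (y + (x - y)) = rinner A (x - y) y := by
      rw [add_sub_cancel, h]
    rwa [rinner_add_right, add_eq_left] at h2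
  have h2 := norm_sq_eq_norm_rinner (A := A) (x - y)
  rw [h1, norm_zero, sq_eq_zero_iff, norm_eq_zero] at h2
  exact sub_eq_zero.mp h2

/-- An isometry `V : F ⊗_σ H → H` intertwining the representations of `A` is of the form `T̃` with
`T(ξ)h = V(ξ ⊗ h)`. -/
theorem exists_isIsometricRep_of_isometry (V : InteriorTensor F σ →ₗᵢ[ℂ] H)
    (hV : ∀ a v, V (leftRep F σ a v) = σ a (V v)) :
    ∃ T : F →ₗ[ℂ] (H →L[ℂ] H), IsIsometricRep σ T ∧ ∀ ξ h, T ξ h = V (tmul σ ξ h) := by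
  let T : F →ₗ[ℂ] (H →L[ℂ] H) :=
    { toFun := fun ξ => LinearMap.mkContinuous
        { toFun := fun h => V (tmul σ ξ h)
          map_add' := fun h k => by rw [tmul_add_right, map_add]
          map_smul' := fun c h => by rw [tmul_smul_right, map_smul]; rfl } ‖ξ‖ fun h => by
        rw [mul_comm]
        exact (V.norm_map _).trans_le (norm_tmul_le σ ξ h)
      map_add' := fun ξ η => by
        ext h
        exact (congrArg V (tmul_add_left σ ξ η h)).trans (map_add V _ _)
      map_smul' := fun c ξ => by
        ext h
        exact (congrArg V (tmul_smul_left σ c ξ h)).trans (map_smul V _ _) }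
  have hT : ∀ ξ h, T ξ h = V (tmul σ ξ h) := fun _ _ => rfl
  refine ⟨T, ⟨fun a ξ => ?_, fun ξ a => ?_, fun ξ η => ?_⟩, hT⟩
  · ext h
    rw [ContinuousLinearMap.comp_apply, hT, hT, ← hV, leftRep_tmul]
  · ext h
    rw [ContinuousLinearMap.comp_apply, hT, hT]
    congr 1
    have h1 : ∀ v : InteriorTensor F σ, ⟪v, tmul σ (ract ξ a) h⟫_ℂ = ⟪v, tmul σ ξ (σ a h)⟫_ℂ := by
      intro v
      induction v using interiorTensor_induction with
      | hc => exact isClosed_eq (by fun_prop) (by fun_prop)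
      | h0 => rw [inner_zero_left, inner_zero_left]
      | ha v w hv hw => rw [inner_add_left, inner_add_left, hv, hw]
      | ht η k => rw [inner_tmul, inner_tmul, rinner_ract_right, map_mul]; rfl
    exact ext_inner_left ℂ h1
  · ext h
    refine ext_inner_left ℂ fun k => ?_
    rw [ContinuousLinearMap.comp_apply, ContinuousLinearMap.adjoint_inner_right, hT, hT,
      V.inner_map_map, inner_tmul]

end Single

theorem unit_mul_eq (a b : A) : P.unit (a * b) = lact a (P.unit b) := by
  refine eq_of_forall_rinner_eq (A := A) fun z => ?_
  obtain ⟨c, rfl⟩ := P.unit.surjective z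
  rw [← P.unit_mul, P.mul_unit, rinner_ract_right, P.rinner_unit, P.rinner_unit, mul_assoc]

theorem unit_ract (a b : A) : P.unit (a * b) = ract (P.unit a) b := by
  rw [unit_mul_eq, ← P.unit_mul, P.mul_unit]

theorem exists_isIsometricRep_zero :
    ∃ T : E 0 →ₗ[ℂ] (H →L[ℂ] H), IsIsometricRep σ T ∧ ∀ a, T (P.unit a) = σ a := by
  let T : E 0 →ₗ[ℂ] (H →L[ℂ] H) :=
    { toFun := fun ξ => σ (P.unit.symm ξ)
      map_add' := fun ξ η => by simp
      map_smul' := fun c ξ => by simp }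
  have hT : ∀ a, T (P.unit a) = σ a := fun a => by
    change σ (P.unit.symm (P.unit a)) = σ a
    rw [LinearEquiv.symm_apply_apply]
  refine ⟨T, ⟨fun a ξ => ?_, fun ξ a => ?_, fun ξ η => ?_⟩, hT⟩
  · obtain ⟨b, rfl⟩ := P.unit.surjective ξ
    rw [← unit_mul_eq, hT, hT, map_mul]
    rfl
  · obtain ⟨b, rfl⟩ := P.unit.surjective ξ
    rw [← unit_ract, hT, hT, map_mul]
    rfl
  · obtain ⟨b, rfl⟩ := P.unit.surjective ξ
    obtain ⟨c, rfl⟩ := P.unit.surjective η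
    rw [hT, hT, P.rinner_unit, map_mul, adjoint_map_star]
    rfl

section Product

variable {m n p : M} (h : m + n = p)
variable {S : E m →ₗ[ℂ] (H →L[ℂ] H)} {T : E n →ₗ[ℂ] (H →L[ℂ] H)} {U U' : E p →ₗ[ℂ] (H →L[ℂ] H)}

/-- The product of isometric representations of `E m` and `E n` is an isometric representation of
`E m ⊗_A E n ≅ E p`. -/
theorem exists_isIsometricRep_mul (hS : IsIsometricRep σ S) (hT : IsIsometricRep σ T) :
    ∃ U : E p →ₗ[ℂ] (H →L[ℂ] H), IsIsometricRep σ U ∧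
      (∀ ξ η, U (P.mul h ξ η) = S ξ ∘L T η) ∧
      ∀ ζ x, U ζ x = hS.tilde (mapRight hT.tilde hT.tilde_leftRep
        ((P.mulIso h σ).symm (tmul σ ζ x))) := by
  let B : E m →ₗ[ℂ] InteriorTensor (E n) σ →ₗ[ℂ] H := LinearMap.mk₂ ℂ (fun ξ v => S ξ (hT.tilde v))
    (by intros; simp) (by intros; simp) (by intros; simp) (by intros; simp)
  have hB : ∀ ξ η v w, ⟪B ξ v, B η w⟫_ℂ = ⟪v, leftRep (E n) σ (rinner A ξ η) w⟫_ℂ := by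
    intro ξ η v w
    change ⟪S ξ (hT.tilde v), S η (hT.tilde w)⟫_ℂ = _
    rw [hS.inner_map_map, ← hT.tilde_leftRep]
    exact (liftₗᵢ σ ((ContinuousLinearMap.coeLM ℂ).comp T) hT.inner_map_map).inner_map_map _ _
  let W := liftₗᵢ (leftRep (E n) σ) B hB
  have hW : ∀ v, W v = hS.tilde (mapRight hT.tilde hT.tilde_leftRep v) := by
    have : W.toContinuousLinearMap = hS.tilde ∘L mapRight hT.tilde hT.tilde_leftRep :=
      interiorTensor_ext _ fun ξ v => by
        rw [ContinuousLinearMap.comp_apply, mapRight_tmul, hS.tilde_tmul]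
        exact liftₗᵢ_tmul _ B hB ξ v
    exact fun v => congrArg (fun f => f v) this
  let V : InteriorTensor (E p) σ →ₗᵢ[ℂ] H := W.comp (P.mulIso h σ).symm.toLinearIsometry
  have hV : ∀ ξ η x, V (tmul σ (P.mul h ξ η) x) = S ξ (T η x) := by
    intro ξ η x
    have h1 : (P.mulIso h σ).symm (tmul σ (P.mul h ξ η) x) = tmul _ ξ (tmul σ η x) := by
      rw [LinearIsometryEquiv.symm_apply_eq, P.mulIso_tmul, P.creation_tmul]
    change W ((P.mulIso h σ).symm (tmul σ (P.mul h ξ η) x)) = _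
    rw [h1, hW, mapRight_tmul, hS.tilde_tmul, hT.tilde_tmul]
  have hVa : ∀ a v, V (leftRep (E p) σ a v) = σ a (V v) := by
    intro a v
    obtain ⟨v, rfl⟩ := (P.mulIso h σ).surjective v
    have h1 : (P.mulIso h σ).symm (leftRep (E p) σ a (P.mulIso h σ v)) =
        leftRep (E m) (leftRep (E n) σ) a v := by
      rw [LinearIsometryEquiv.symm_apply_eq]
      have : leftRep (E p) σ a ∘L (P.mulIso h σ).toContinuousLinearEquiv.toContinuousLinearMap =
          (P.mulIso h σ).toContinuousLinearEquiv.toContinuousLinearMap ∘L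
            leftRep (E m) (leftRep (E n) σ) a :=
        interiorTensor_ext _ fun ξ w => by
          simp [P.mulIso_tmul, leftRep_tmul, P.creation_leftRep]
      exact congrArg (fun f => f v) this
    have h2 : W (leftRep (E m) (leftRep (E n) σ) a v) = σ a (W v) := by
      rw [hW, hW, mapRight_leftRep, hS.tilde_leftRep]
    change W ((P.mulIso h σ).symm _) = σ a (W ((P.mulIso h σ).symm _))
    rw [h1, h2, LinearIsometryEquiv.symm_apply_apply]
  obtain ⟨U, hU, hUV⟩ := exists_isIsometricRep_of_isometry V hVa
  refine ⟨U, hU, fun ξ η => ?_, fun ζ x => ?_⟩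
  · ext x
    rw [hUV, hV]
    rfl
  · rw [hUV]
    exact hW _

theorem IsIsometricRep.ext_mul (hU : IsIsometricRep σ U)
    (hU' : IsIsometricRep σ U') (hUU : ∀ ξ η, U (P.mul h ξ η) = U' (P.mul h ξ η)) : U = U' := by
  ext ζ x
  have h1 : hU.evalL x = hU'.evalL x := ContinuousLinearMap.ext_on
    (s := {z : E p | ∃ ξ η, P.mul h ξ η = z})
    (by rw [Submodule.dense_iff_topologicalClosure_eq_top]; exact P.mul_total h) (by
      rintro _ ⟨ξ, η, rfl⟩
      exact congrArg (fun f => f x) (hUU ξ η))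
  exact congrArg (fun f => f ζ) h1

/-- An identity `U(μ η) = S(μ) T(η)` may be checked for `μ` in a total set. -/
theorem IsIsometricRep.apply_mul_of_total (hU : IsIsometricRep σ U) (hS : IsIsometricRep σ S)
    {s : Set (E m)} (hs : (Submodule.span ℂ s).topologicalClosure = ⊤) {η : E n}
    (hs' : ∀ μ ∈ s, U (P.mul h μ η) = S μ ∘L T η) (μ : E m) : U (P.mul h μ η) = S μ ∘L T η := by
  ext x
  have h0 : ∀ μ, U (P.mul h μ η) x = hU.tilde (P.creation h σ μ (tmul σ η x)) := fun μ => by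
    rw [P.creation_tmul, hU.tilde_tmul]
  let f : E m →L[ℂ] H := LinearMap.mkContinuous
    { toFun := fun μ => U (P.mul h μ η) x
      map_add' := fun ξ η => by simp
      map_smul' := fun c ξ => by simp } ‖tmul σ η x‖ fun μ => by
    change ‖U (P.mul h μ η) x‖ ≤ _
    rw [h0, mul_comm]
    exact ((liftₗᵢ σ ((ContinuousLinearMap.coeLM ℂ).comp U) hU.inner_map_map).norm_map _).trans_le
      (P.norm_creation_le h σ μ _)
  have h1 : f = hS.evalL (T η x) := ContinuousLinearMap.ext_on (s := s)
    (by rwa [Submodule.dense_iff_topologicalClosure_eq_top]) fun μ hμ =>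
      congrArg (fun f => f x) (hs' μ hμ)
  exact congrArg (fun f => f μ) h1

end Product

end Extension

section MultiIndex

variable {k : ℕ}

theorem multiIndex_cases (n : Fin k → ℕ) : n = 0 ∨ ∃ (i : Fin k) (m : Fin k → ℕ), (Pi.single i 1 + m : Fin k → ℕ) = n := by
  by_cases h : n = 0
  · exact Or.inl h
  · obtain ⟨i, hi⟩ := Function.ne_iff.mp h
    refine Or.inr ⟨i, n - Pi.single i 1, add_tsub_cancel_of_le fun j => ?_⟩
    by_cases hj : j = i
    · subst hj
      rw [Pi.single_eq_same]
      exact Nat.one_le_iff_ne_zero.mpr hi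
    · rw [Pi.single_eq_of_ne hj]
      exact Nat.zero_le _

theorem sum_single_add (i : Fin k) (m : Fin k → ℕ) :
    ∑ j, (Pi.single i 1 + m : Fin k → ℕ) j = ∑ j, m j + 1 := by
  simp [Finset.sum_add_distrib, add_comm]

/-- Induction on multi-indices: every `n ∈ ℕ₀ᵏ` is a sum of basis elements. -/
theorem multiIndex_induction {p : (Fin k → ℕ) → Prop} (zero : p 0)
    (add : ∀ i m, p m → p (Pi.single i 1 + m)) (n : Fin k → ℕ) : p n := by
  induction hN : ∑ j, n j generalizing n with
  | zero =>
    have : n = 0 := funext fun j => by simpa using (Finset.sum_eq_zero_iff.mp hN) j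
    exact this ▸ zero
  | succ N ih =>
    obtain rfl | ⟨i, m, rfl⟩ := multiIndex_cases n
    · exact zero
    · rw [sum_single_add] at hN
      exact add i m (ih m (by omega))

theorem exists_of_single_add_eq {i j : Fin k} (hij : i ≠ j) {m m' : Fin k → ℕ}
    (h : (Pi.single i 1 + m : Fin k → ℕ) = Pi.single j 1 + m') :
    ∃ l : Fin k → ℕ, (Pi.single j 1 + l : Fin k → ℕ) = m ∧ Pi.single i 1 + l = m' := by
  have h1 : (Pi.single j 1 : Fin k → ℕ) ≤ m := fun q => by
    by_cases hq : q = j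
    · subst hq
      have := congrFun h q
      simp [Pi.single_eq_of_ne hij.symm] at this ⊢
      omega
    · rw [Pi.single_eq_of_ne hq]
      exact Nat.zero_le _
  refine ⟨m - Pi.single j 1, add_tsub_cancel_of_le h1, ?_⟩
  have h2 : (Pi.single j 1 : Fin k → ℕ) + (Pi.single i 1 + (m - Pi.single j 1)) =
      Pi.single j 1 + m' := by
    rw [← h, add_left_comm, add_tsub_cancel_of_le h1]
  exact add_left_cancel h2

end MultiIndex

section Extension

variable {A : Type*} [NonUnitalCStarAlgebra A] [PartialOrder A] [StarOrderedRing A]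
variable {k : ℕ} {E : (Fin k → ℕ) → Type*} [∀ n, NormedAddCommGroup (E n)]
  [∀ n, NormedSpace ℂ (E n)] [∀ n, CStarCorrespondence A (E n)] {P : ProductSystem A E}
variable {H : Type*} [NormedAddCommGroup H] [InnerProductSpace ℂ H] [CompleteSpace H]

namespace IsometricRep

variable (R : IsometricRep P (fun i : Fin k => Pi.single i 1) H)

/-- The commutation relation in terms of the fibre `E (e_i + e_j)`: the two products of `T⁽ⁱ⁾` and
`T⁽ʲ⁾` are given by one and the same map on this fibre. -/
theorem exists_commuting_product (i j : Fin k) {p : Fin k → ℕ}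
    (h : (Pi.single i 1 + Pi.single j 1 : Fin k → ℕ) = p)
    (h' : (Pi.single j 1 + Pi.single i 1 : Fin k → ℕ) = p) :
    ∃ U : E p →ₗ[ℂ] (H →L[ℂ] H), IsIsometricRep R.σ U ∧
      (∀ ξ η, U (P.mul h ξ η) = R.T i ξ ∘L R.T j η) ∧
      ∀ ξ η, U (P.mul h' η ξ) = R.T j η ∘L R.T i ξ := by
  subst h
  obtain ⟨U, hU, h1, h2⟩ := exists_isIsometricRep_mul P rfl (R.isIsometricRep i)
    (R.isIsometricRep j)
  obtain ⟨U', hU', h1', h2'⟩ := exists_isIsometricRep_mul P h' (R.isIsometricRep j)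
    (R.isIsometricRep i)
  refine ⟨U, hU, h1, fun ξ η => ?_⟩
  have h3 : U = U' := by
    ext ζ x
    rw [h2, h2']
    refine (congrArg (fun f => f ((P.mulIso rfl R.σ).symm (tmul R.σ ζ x))) (R.comm i j)).trans ?_
    refine congrArg (fun v => R.tilde j (mapRight (R.tilde i) (R.isIsometricRep i).tilde_leftRep v))
      ?_
    change (P.flip R.σ _ _) _ = _
    rw [ProductSystem.flip, LinearIsometryEquiv.trans_apply, LinearIsometryEquiv.apply_symm_apply]
  rw [h3, h1']

/-- `R.IsExtension n T` states that `T` is obtained on the fibre `E n` by successively multiplying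
the maps `T⁽ⁱ⁾`, along some way of writing `n` as a sum of basis elements. -/
inductive IsExtension : ∀ n : Fin k → ℕ, (E n →ₗ[ℂ] (H →L[ℂ] H)) → Prop
  | zero {n : Fin k → ℕ} (hn : 0 = n) (T : E n →ₗ[ℂ] (H →L[ℂ] H)) (hT : IsIsometricRep R.σ T)
    (h : ∀ a, T (hn ▸ P.unit a) = R.σ a) : IsExtension n T
  | mul {i : Fin k} {m n : Fin k → ℕ} (hn : Pi.single i 1 + m = n) (S : E m →ₗ[ℂ] (H →L[ℂ] H))
    (T : E n →ₗ[ℂ] (H →L[ℂ] H)) (hT : IsIsometricRep R.σ T) (hS : IsExtension m S)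
    (h : ∀ ξ η, T (P.mul hn ξ η) = R.T i ξ ∘L S η) : IsExtension n T

variable {R} in
theorem IsExtension.isIsometricRep {n : Fin k → ℕ} {T : E n →ₗ[ℂ] (H →L[ℂ] H)}
    (h : R.IsExtension n T) : IsIsometricRep R.σ T := by
  cases h <;> assumption

variable {R} in
theorem IsExtension.exists_mul {i : Fin k} {m n : Fin k → ℕ} (hn : Pi.single i 1 + m = n)
    {S : E m →ₗ[ℂ] (H →L[ℂ] H)} (hS : R.IsExtension m S) :
    ∃ T : E n →ₗ[ℂ] (H →L[ℂ] H), R.IsExtension n T ∧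
      ∀ ξ η, T (P.mul hn ξ η) = R.T i ξ ∘L S η := by
  obtain ⟨T, hT, h, -⟩ := exists_isIsometricRep_mul P hn (R.isIsometricRep i) hS.isIsometricRep
  exact ⟨T, .mul hn S T hT hS h, h⟩

theorem exists_isExtension (n : Fin k → ℕ) : ∃ T, R.IsExtension n T := by
  induction n using multiIndex_induction with
  | zero =>
    obtain ⟨T, hT, h⟩ := exists_isIsometricRep_zero (σ := R.σ) P
    exact ⟨T, .zero rfl T hT h⟩
  | add i m ih =>
    obtain ⟨S, hS⟩ := ih
    obtain ⟨T, hT, -⟩ := hS.exists_mul (i := i) rfl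
    exact ⟨T, hT⟩

variable {R} in
/-- The extension to a fibre does not depend on the decomposition of the multi-index: this is where
the commutation relations of the `T⁽ⁱ⁾` enter. -/
theorem IsExtension.unique {n : Fin k → ℕ} {T T' : E n →ₗ[ℂ] (H →L[ℂ] H)}
    (h : R.IsExtension n T) (h' : R.IsExtension n T') : T = T' := by
  induction hN : ∑ j, n j generalizing n with
  | zero =>
    cases h with
    | zero hn _ hT h =>
      cases h' with
      | zero hn' _ hT' h' =>
        subst hn
        ext1 ξ
        obtain ⟨a, rfl⟩ := P.unit.surjective ξ
        exact (h a).trans (h' a).symm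
      | mul hn' => rw [← hn', sum_single_add] at hN; omega
    | mul hn => rw [← hn, sum_single_add] at hN; omega
  | succ N ih =>
    cases h with
    | zero hn => rw [← hn] at hN; simp at hN
    | mul hn S _ hT hS hTS =>
      cases h' with
      | zero hn' => rw [← hn'] at hN; simp at hN
      | mul hn' S' _ hT' hS' hTS' =>
        rename_i i m j m'
        have hm : ∑ q, m q = N := by rw [← hn, sum_single_add] at hN; omega
        have hm' : ∑ q, m' q = N := by rw [← hn', sum_single_add] at hN; omega
        by_cases hij : i = j
        · subst hij
          obtain rfl : m = m' := add_left_cancel (hn.trans hn'.symm)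
          obtain rfl := ih hS hS' hm
          exact hT.ext_mul P hn hT' fun ξ η => (hTS ξ η).trans (hTS' ξ η).symm
        -- If the first factor of `T` is `T⁽ⁱ⁾` and that of `T'` is `T⁽ʲ⁾`, both can, by induction, be rewritten
        -- through an extension to `E l` with `n = e_i + e_j + l`, where the relations apply.
        · obtain ⟨l, hl, hl'⟩ := exists_of_single_add_eq hij (hn.trans hn'.symm)
          obtain ⟨V, hV⟩ := R.exists_isExtension l
          obtain ⟨S₁, hS₁, hS₁V⟩ := hV.exists_mul hl
          obtain ⟨S₁', hS₁', hS₁V'⟩ := hV.exists_mul hl'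
          obtain rfl := ih hS hS₁ hm
          obtain rfl := ih hS' hS₁' hm'
          obtain ⟨U, hU, hU1, hU2⟩ := R.exists_commuting_product i j rfl (add_comm _ _)
          have hp : Pi.single i 1 + Pi.single j 1 + l = n := by rw [add_assoc, hl, hn]
          refine hT.ext_mul P hp hT' fun μ ζ => ?_
          refine (hT.apply_mul_of_total P hp hU (T := V) (P.mul_total rfl) ?_ μ).trans
            (hT'.apply_mul_of_total P hp hU (T := V)
              (P.mul_total (add_comm (Pi.single j 1) (Pi.single i 1))) ?_ μ).symm
          · rintro _ ⟨ξ, η, rfl⟩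
            rw [P.mul_assoc rfl hp hl hn, hTS, hS₁V, hU1]
            rfl
          · rintro _ ⟨η, ξ, rfl⟩
            rw [P.mul_assoc _ hp hl' hn', hTS', hS₁V', hU2]
            rfl

/-- The extension of `(σ, T⁽¹⁾, …, T⁽ᵏ⁾)` to a map `E n → B(H)` on each fibre. -/
def extend (n : Fin k → ℕ) : E n →ₗ[ℂ] (H →L[ℂ] H) := (R.exists_isExtension n).choose

theorem isExtension_extend (n : Fin k → ℕ) : R.IsExtension n (R.extend n) :=
  (R.exists_isExtension n).choose_spec

theorem isIsometricRep_extend (n : Fin k → ℕ) : IsIsometricRep R.σ (R.extend n) :=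
  (R.isExtension_extend n).isIsometricRep

theorem extend_unit (a : A) : R.extend 0 (P.unit a) = R.σ a := by
  obtain ⟨T, hT, h⟩ := exists_isIsometricRep_zero (σ := R.σ) P
  rw [(R.isExtension_extend 0).unique (.zero rfl T hT h), h]

theorem extend_single_mul {i : Fin k} {m n : Fin k → ℕ} (h : Pi.single i 1 + m = n)
    (ξ : E (Pi.single i 1)) (η : E m) :
    R.extend n (P.mul h ξ η) = R.T i ξ ∘L R.extend m η := by
  obtain ⟨T, hT, h'⟩ := (R.isExtension_extend m).exists_mul h
  rw [(R.isExtension_extend n).unique hT, h']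

theorem extend_single (i : Fin k) : R.extend (Pi.single i 1) = R.T i := by
  refine (R.isIsometricRep_extend _).ext_mul P (add_zero _) (R.isIsometricRep i) fun ξ η => ?_
  obtain ⟨a, rfl⟩ := P.unit.surjective η
  rw [R.extend_single_mul, extend_unit, P.mul_unit, (R.isIsometricRep i).map_ract]

theorem extend_mul {m n p : Fin k → ℕ} (h : m + n = p) (ξ : E m) (η : E n) :
    R.extend p (P.mul h ξ η) = R.extend m ξ ∘L R.extend n η := by
  induction m using multiIndex_induction generalizing p with
  | zero =>
    obtain rfl : n = p := by rw [← h, zero_add]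
    obtain ⟨a, rfl⟩ := P.unit.surjective ξ
    rw [P.unit_mul, (R.isIsometricRep_extend n).map_lact, extend_unit]
  | add i m ih =>
    refine (R.isIsometricRep_extend p).apply_mul_of_total P h (R.isIsometricRep_extend _)
      (P.mul_total rfl) ?_ ξ
    rintro _ ⟨ξ, μ, rfl⟩
    rw [P.mul_assoc rfl h rfl (by rw [← h, add_assoc]), extend_single_mul, extend_single_mul, ih]
    rfl

end IsometricRep

end Extension

/-! ### The range subspaces of the fibres -/

section Level

variable {A : Type*} [NonUnitalCStarAlgebra A] [PartialOrder A] [StarOrderedRing A]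
variable {k : ℕ} {E : (Fin k → ℕ) → Type*} [∀ n, NormedAddCommGroup (E n)]
  [∀ n, NormedSpace ℂ (E n)] [∀ n, CStarCorrespondence A (E n)] {P : ProductSystem A E}
variable {H : Type*} [NormedAddCommGroup H] [InnerProductSpace ℂ H] [CompleteSpace H]
variable {H' : Type*} [NormedAddCommGroup H'] [InnerProductSpace ℂ H'] [CompleteSpace H']

namespace IsometricRep

variable (R : IsometricRep P (fun i : Fin k => Pi.single i 1) H)
variable (R' : IsometricRep P (fun i : Fin k => Pi.single i 1) H')

/-- The closed linear span of `T(E n)H`, where `T` is the extension of the representation to the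
fibre `E n`; it is the range of the isometry `E n ⊗_σ H → H`. -/
def level (n : Fin k → ℕ) : Submodule ℂ H := imageSpan (R.extend n) ⊤

theorem isClosed_level (n : Fin k → ℕ) : IsClosed (R.level n : Set H) := isClosed_imageSpan ⊤

instance (n : Fin k → ℕ) : CompleteSpace (R.level n) := (R.isClosed_level n).completeSpace_coe

theorem level_zero : R.level 0 = ⊤ := by
  rw [eq_top_iff, ← R.nondegenerate]
  refine Submodule.topologicalClosure_minimal _ (Submodule.span_le.mpr ?_) (R.isClosed_level 0)
  rintro _ ⟨a, x, rfl⟩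
  rw [← R.extend_unit]
  exact apply_mem_imageSpan _ Submodule.mem_top

theorem σ_mem_level (n : Fin k → ℕ) (a : A) {x : H} (hx : x ∈ R.level n) : R.σ a x ∈ R.level n :=
  (R.isIsometricRep_extend n).rep_mem_imageSpan a hx

theorem level_add {m n p : Fin k → ℕ} (h : m + n = p) :
    R.level p = imageSpan (R.extend m) (R.level n) := by
  apply le_antisymm
  · refine imageSpan_le (isClosed_imageSpan _) fun ζ x _ => ?_
    refine (R.isIsometricRep_extend p).apply_mem_of_total (P.mul_total h) (isClosed_imageSpan _) ?_ ζ
    rintro _ ⟨ξ, η, rfl⟩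
    rw [R.extend_mul h]
    exact apply_mem_imageSpan ξ (apply_mem_imageSpan η Submodule.mem_top)
  · refine imageSpan_le (R.isClosed_level p) fun ξ x hx => ?_
    have h1 : R.level n ≤ (R.level p).comap (R.extend m ξ).toLinearMap :=
      imageSpan_le ((R.isClosed_level p).preimage (R.extend m ξ).continuous) fun η x _ => by
        have h2 : R.extend m ξ (R.extend n η x) = R.extend p (P.mul h ξ η) x := by
          rw [R.extend_mul h]
          rfl
        exact (h2 ▸ apply_mem_imageSpan _ Submodule.mem_top :
          R.extend m ξ (R.extend n η x) ∈ R.level p)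
    exact h1 hx

theorem level_le_left {m n p : Fin k → ℕ} (h : m + n = p) : R.level p ≤ R.level m := by
  rw [R.level_add h]
  exact imageSpan_mono le_top

theorem level_le_right {m n p : Fin k → ℕ} (h : m + n = p) : R.level p ≤ R.level n :=
  R.level_le_left ((add_comm n m).trans h)

theorem level_single_antitone (i : Fin k) {m n : ℕ} (h : m ≤ n) :
    R.level (Pi.single i n) ≤ R.level (Pi.single i m) :=
  R.level_le_left (n := Pi.single i (n - m)) (by rw [← Pi.single_add, Nat.add_sub_cancel' h])

theorem level_single_succ (i : Fin k) (n : ℕ) :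
    R.level (Pi.single i (n + 1)) = imageSpan (R.T i) (R.level (Pi.single i n)) := by
  rw [R.level_add (m := Pi.single i 1) (n := Pi.single i n) (by rw [← Pi.single_add, add_comm]),
    R.extend_single]

theorem level_single_one (i : Fin k) : R.level (Pi.single i 1) = imageSpan (R.T i) ⊤ := by
  rw [level, R.extend_single]

theorem extend_mem_level (m : Fin k → ℕ) {n : Fin k → ℕ} (ξ : E m) {x : H} (hx : x ∈ R.level n) :
    R.extend m ξ x ∈ R.level n := by
  refine R.level_le_right (m := m) rfl ?_
  rw [R.level_add rfl]
  exact apply_mem_imageSpan ξ hx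

theorem T_mem_level (i : Fin k) {n : Fin k → ℕ} (ξ : E (Pi.single i 1)) {x : H}
    (hx : x ∈ R.level n) : R.T i ξ x ∈ R.level n := by
  have := R.extend_mem_level (Pi.single i 1) ξ hx
  rwa [R.extend_single] at this

/-- A closed subspace invariant under `σ` and the `T⁽ʲ⁾` with `j` in the support of `n` is invariant
under the extension of the representation to `E n`. -/
theorem extend_mem {K : Submodule ℂ H} (hKc : IsClosed (K : Set H))
    (hσ : ∀ a, ∀ x ∈ K, R.σ a x ∈ K) (n : Fin k → ℕ)
    (hT : ∀ j, n j ≠ 0 → ∀ ξ, ∀ x ∈ K, R.T j ξ x ∈ K) (ξ : E n) {x : H} (hx : x ∈ K) :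
    R.extend n ξ x ∈ K := by
  induction n using multiIndex_induction generalizing x with
  | zero =>
    obtain ⟨a, rfl⟩ := P.unit.surjective ξ
    rw [R.extend_unit]
    exact hσ a x hx
  | add i m ih =>
    refine (R.isIsometricRep_extend _).apply_mem_of_total (P.mul_total rfl) hKc ?_ ξ
    rintro _ ⟨ξ, η, rfl⟩
    rw [R.extend_single_mul]
    refine hT i (by simp) ξ _ (ih (fun j hj => hT j ?_) η hx)
    rw [Pi.add_apply]
    omega

variable {R R'} in
/-- A bounded operator intertwining two representations maps range subspaces to range subspaces. -/
theorem map_mem_level (f : H →L[ℂ] H') (n : Fin k → ℕ)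
    (hf : ∀ j, n j ≠ 0 → ∀ ξ x, f (R.T j ξ x) = R'.T j ξ (f x)) {x : H} (hx : x ∈ R.level n) :
    f x ∈ R'.level n := by
  induction n using multiIndex_induction generalizing x with
  | zero => rw [R'.level_zero]; exact Submodule.mem_top
  | add i m ih =>
    rw [R.level_add rfl, R.extend_single] at hx
    rw [R'.level_add rfl, R'.extend_single]
    refine map_mem_imageSpan f (hf i (by simp)) (fun y hy => ih (fun j hj => hf j ?_) hy) hx
    rw [Pi.add_apply]
    omega

theorem starProjection_mem_level {K : Submodule ℂ H} [K.HasOrthogonalProjection] (n : Fin k → ℕ)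
    (h : ∀ j, n j ≠ 0 → ∀ ξ, ∀ x ∈ K, R.T j ξ x ∈ K)
    (h' : ∀ j, n j ≠ 0 → ∀ ξ, ∀ x ∈ Kᗮ, R.T j ξ x ∈ Kᗮ) {x : H} (hx : x ∈ R.level n) :
    K.starProjection x ∈ R.level n :=
  map_mem_level _ n (fun j hj ξ => starProjection_comm (h j hj ξ) (h' j hj ξ)) hx

theorem σ_mem_orthogonal_level (n : Fin k → ℕ) (a : A) {x : H} (hx : x ∈ (R.level n)ᗮ) :
    R.σ a x ∈ (R.level n)ᗮ :=
  map_orthogonal_of_invariant (fun a _ hx => R.σ_mem_level n a hx) a hx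

theorem T_self_mem_orthogonal_level (i : Fin k) {n : ℕ} (ξ : E (Pi.single i 1)) {x : H}
    (hx : x ∈ (R.level (Pi.single i n))ᗮ) : R.T i ξ x ∈ (R.level (Pi.single i (n + 1)))ᗮ := by
  rw [R.level_single_succ]
  exact (R.isIsometricRep i).apply_mem_orthogonal_imageSpan
    (fun a _ hx => R.σ_mem_level _ a hx) hx ξ

/-! ### Double commutation -/

/-- For `i ≠ j`, the kernel of `T̃⁽ʲ⁾*` is invariant under `T⁽ⁱ⁾`. Together with the commutation
relations, this is what double commutation amounts to. -/
def PreservesKernels : Prop :=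
  ∀ i j, i ≠ j → ∀ ξ, ∀ x ∈ (R.level (Pi.single j 1))ᗮ, R.T i ξ x ∈ (R.level (Pi.single j 1))ᗮ

theorem mem_orthogonal_level_single_one_iff (i : Fin k) {x : H} :
    x ∈ (R.level (Pi.single i 1))ᗮ ↔ ContinuousLinearMap.adjoint (R.tilde i) x = 0 := by
  rw [level_single_one, mem_orthogonal_imageSpan_iff]
  constructor
  · intro h
    refine ext_inner_left ℂ fun v => ?_
    rw [ContinuousLinearMap.adjoint_inner_right, inner_zero_right]
    induction v using interiorTensor_induction with
    | hc => exact isClosed_eq (by fun_prop) (by fun_prop)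
    | h0 => rw [map_zero, inner_zero_left]
    | ha v w hv hw => rw [map_add, inner_add_left, hv, hw, add_zero]
    | ht ξ y => rw [(R.isIsometricRep i).tilde_tmul]; exact h ξ y Submodule.mem_top
  · intro h ξ y _
    rw [← (R.isIsometricRep i).tilde_tmul, ← ContinuousLinearMap.adjoint_inner_right, h,
      inner_zero_right]

variable {R}

theorem IsDoublyCommuting.preservesKernels (hR : R.IsDoublyCommuting) : R.PreservesKernels := by
  intro i j hij ξ x hx
  rw [mem_orthogonal_level_single_one_iff] at hx ⊢
  have h := congrArg (fun f => f (tmul R.σ ξ x)) (hR i j hij)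
  simp only [ContinuousLinearMap.comp_apply] at h
  rw [(R.isIsometricRep i).tilde_tmul, mapRight_tmul, hx] at h
  have h0 : tmul (leftRep (E (Pi.single j 1)) R.σ) ξ
      (0 : InteriorTensor (E (Pi.single j 1)) R.σ) = 0 := by
    simpa using tmul_smul_right (leftRep (E (Pi.single j 1)) R.σ) (0 : ℂ) ξ 0
  rw [h, h0, map_zero, map_zero]

theorem PreservesKernels.T_mem_orthogonal_level (hR : R.PreservesKernels) {i j : Fin k}
    (hij : j ≠ i) (n : ℕ) (ξ : E (Pi.single j 1)) {x : H}
    (hx : x ∈ (R.level (Pi.single i n))ᗮ) : R.T j ξ x ∈ (R.level (Pi.single i n))ᗮ := by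
  induction n generalizing ξ x with
  | zero =>
    rw [Pi.single_zero, level_zero, Submodule.top_orthogonal_eq_bot, Submodule.mem_bot] at hx
    rw [hx, map_zero]
    exact zero_mem _
  | succ n ih =>
    refine map_orthogonal_of_adjoint_mem (fun y hy => ?_) hx
    have hy1 : y ∈ R.level (Pi.single i 1) := R.level_single_antitone i (by omega) hy
    rw [R.level_single_succ]
    refine (R.isIsometricRep i).mem_imageSpan_of_adjoint_mem (R.isClosed_level _)
      (fun a _ hx => R.σ_mem_level _ a hx) ?_ fun η => ?_
    · rw [← R.level_single_one]
      exact adjoint_mem_of_map_orthogonal (R.isClosed_level _) (hR j i hij ξ) hy1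
    · rw [← (R.level (Pi.single i n)).orthogonal_orthogonal]
      intro z hz
      rw [ContinuousLinearMap.adjoint_inner_right, ContinuousLinearMap.adjoint_inner_right,
        ← Submodule.mem_orthogonal_singleton_iff_inner_left]
      -- `T⁽ʲ⁾(ξ) T⁽ⁱ⁾(η)` is approximated by linear combinations of operators
      -- `T⁽ⁱ⁾(η') T⁽ʲ⁾(ξ')`, and these map `z` into the orthogonal complement of `y`.
      have h1 : R.T j ξ (R.T i η z) = R.extend _ (P.mul rfl ξ η) z := by
        rw [R.extend_single_mul, R.extend_single]
        rfl
      rw [h1]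
      refine (R.isIsometricRep_extend _).apply_mem_of_total
        (P.mul_total (add_comm (Pi.single i 1) (Pi.single j 1))) (Submodule.isClosed_orthogonal _)
        ?_ _
      rintro _ ⟨η', ξ', rfl⟩
      rw [R.extend_single_mul, R.extend_single, ContinuousLinearMap.comp_apply,
        Submodule.mem_orthogonal_singleton_iff_inner_left]
      exact Submodule.inner_left_of_mem_orthogonal hy
        (R.T_self_mem_orthogonal_level i η' (ih ξ' hz))

theorem PreservesKernels.extend_mem_orthogonal_level (hR : R.PreservesKernels) {i : Fin k}
    {n : Fin k → ℕ} (hn : n i = 0) (m : ℕ) (ξ : E n) {x : H}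
    (hx : x ∈ (R.level (Pi.single i m))ᗮ) : R.extend n ξ x ∈ (R.level (Pi.single i m))ᗮ :=
  R.extend_mem (Submodule.isClosed_orthogonal _) (fun a _ hx => R.σ_mem_orthogonal_level _ a hx) n
    (fun j hj ξ _ hx => hR.T_mem_orthogonal_level (fun h => hj (by rw [h, hn])) m ξ hx) ξ hx

/-- The ranges of `T̃` on `E n` and on `E (m e_i)`, with `i` outside the support of `n`, intersect in
the range of `T̃` on `E (n + m e_i)`. -/
theorem PreservesKernels.mem_level_add (hR : R.PreservesKernels) {i : Fin k}
    {n : Fin k → ℕ} (hn : n i = 0) (m : ℕ) {x : H} (hx : x ∈ R.level n)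
    (hx' : x ∈ R.level (Pi.single i m)) : x ∈ R.level (n + Pi.single i m) := by
  rw [R.level_add rfl]
  exact (R.isIsometricRep_extend n).mem_imageSpan_of_adjoint_mem (R.isClosed_level _)
    (fun a _ hx => R.σ_mem_level _ a hx) hx fun ξ =>
      adjoint_mem_of_map_orthogonal (R.isClosed_level _)
        (fun _ hy => hR.extend_mem_orthogonal_level hn m ξ hy) hx'

end IsometricRep

end Level

/-! ### Reducing subspaces and the fully coisometric parts -/

section Reducing

variable {A : Type*} [NonUnitalCStarAlgebra A] [PartialOrder A] [StarOrderedRing A]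
variable {k : ℕ} {E : (Fin k → ℕ) → Type*} [∀ n, NormedAddCommGroup (E n)]
  [∀ n, NormedSpace ℂ (E n)] [∀ n, CStarCorrespondence A (E n)] {P : ProductSystem A E}
variable {H : Type*} [NormedAddCommGroup H] [InnerProductSpace ℂ H] [CompleteSpace H]

namespace IsometricRep

variable (R : IsometricRep P (fun i : Fin k => Pi.single i 1) H)

/-- Invariance of a subspace under all `σ(a)`, all `T⁽ⁱ⁾(ξ)` and their adjoints. For closed
subspaces this is `IsReducing`, but in this form it is evidently stable under intersections. -/
structure Reduces (K : Submodule ℂ H) : Prop where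
  σ_mem : ∀ a, ∀ x ∈ K, R.σ a x ∈ K
  T_mem : ∀ i ξ, ∀ x ∈ K, R.T i ξ x ∈ K
  adjoint_mem : ∀ i ξ, ∀ x ∈ K, ContinuousLinearMap.adjoint (R.T i ξ) x ∈ K

variable {R}

theorem Reduces.isReducing {K : ClosedSubmodule ℂ H} (h : R.Reduces K.toSubmodule) :
    R.IsReducing K where
  σ_mem := h.σ_mem
  σ_mem_orthogonal a _ hx := map_orthogonal_of_invariant h.σ_mem a hx
  T_mem := h.T_mem
  T_mem_orthogonal i ξ _ hx := map_orthogonal_of_adjoint_mem (h.adjoint_mem i ξ) hx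

theorem IsReducing.reduces {K : ClosedSubmodule ℂ H} (h : R.IsReducing K) :
    R.Reduces K.toSubmodule where
  σ_mem := h.σ_mem
  T_mem := h.T_mem
  adjoint_mem i ξ _ hx := adjoint_mem_of_map_orthogonal K.isClosed (h.T_mem_orthogonal i ξ) hx

theorem Reduces.orthogonal {K : Submodule ℂ H} (h : R.Reduces K) : R.Reduces Kᗮ where
  σ_mem a _ hx := map_orthogonal_of_invariant h.σ_mem a hx
  T_mem i ξ _ hx := map_orthogonal_of_adjoint_mem (h.adjoint_mem i ξ) hx
  adjoint_mem i ξ _ hx := map_orthogonal_of_adjoint_mem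
    (by rw [ContinuousLinearMap.adjoint_adjoint]; exact h.T_mem i ξ) hx

theorem Reduces.iInf {ι : Type*} {K : ι → Submodule ℂ H} (h : ∀ j, R.Reduces (K j)) :
    R.Reduces (⨅ j, K j) where
  σ_mem a x hx := by
    rw [Submodule.mem_iInf] at hx ⊢
    exact fun j => (h j).σ_mem a x (hx j)
  T_mem i ξ x hx := by
    rw [Submodule.mem_iInf] at hx ⊢
    exact fun j => (h j).T_mem i ξ x (hx j)
  adjoint_mem i ξ x hx := by
    rw [Submodule.mem_iInf] at hx ⊢
    exact fun j => (h j).adjoint_mem i ξ x (hx j)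

theorem Reduces.starProjection_T {K : Submodule ℂ H} [K.HasOrthogonalProjection] (h : R.Reduces K)
    (i : Fin k) (ξ : E (Pi.single i 1)) (x : H) :
    K.starProjection (R.T i ξ x) = R.T i ξ (K.starProjection x) :=
  starProjection_comm (h.T_mem i ξ) (h.orthogonal.T_mem i ξ) x

theorem Reduces.starProjection_mem_level {K : Submodule ℂ H} [K.HasOrthogonalProjection]
    (h : R.Reduces K) {n : Fin k → ℕ} {x : H} (hx : x ∈ R.level n) :
    K.starProjection x ∈ R.level n :=
  R.starProjection_mem_level n (fun j _ => h.T_mem j) (fun j _ => h.orthogonal.T_mem j) hx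

variable (R)

/-- The intersection of the ranges of the powers of `T̃⁽ⁱ⁾`: the largest subspace on which
`(σ, T⁽ⁱ⁾)` is fully coisometric. -/
def coisometricPart (i : Fin k) : Submodule ℂ H := ⨅ n : ℕ, R.level (Pi.single i n)

theorem mem_coisometricPart_iff (i : Fin k) {x : H} :
    x ∈ R.coisometricPart i ↔ ∀ n : ℕ, x ∈ R.level (Pi.single i n) := Submodule.mem_iInf _

theorem isClosed_coisometricPart (i : Fin k) : IsClosed (R.coisometricPart i : Set H) := by
  rw [coisometricPart, Submodule.coe_iInf]
  exact isClosed_iInter fun n => R.isClosed_level _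

instance (i : Fin k) : CompleteSpace (R.coisometricPart i) :=
  (R.isClosed_coisometricPart i).completeSpace_coe

variable {R}

theorem PreservesKernels.reduces_coisometricPart (hR : R.PreservesKernels) (i : Fin k) :
    R.Reduces (R.coisometricPart i) where
  σ_mem a x hx := by
    rw [mem_coisometricPart_iff] at hx ⊢
    exact fun n => R.σ_mem_level _ a (hx n)
  T_mem j ξ x hx := by
    rw [mem_coisometricPart_iff] at hx ⊢
    exact fun n => R.T_mem_level j ξ (hx n)
  adjoint_mem j ξ x hx := by
    rw [mem_coisometricPart_iff] at hx ⊢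
    intro n
    by_cases hij : j = i
    · subst hij
      refine (R.isIsometricRep j).adjoint_mem_of_mem_imageSpan (R.isClosed_level _)
        (fun a _ hx => R.σ_mem_level _ a hx) ?_ ξ
      rw [← R.level_single_succ]
      exact hx (n + 1)
    · exact adjoint_mem_of_map_orthogonal (R.isClosed_level _)
        (fun _ hy => hR.T_mem_orthogonal_level hij n ξ hy) (hx n)

theorem Reduces.starProjection_mem_coisometricPart {K : Submodule ℂ H}
    [K.HasOrthogonalProjection] (h : R.Reduces K) {i : Fin k} {x : H}
    (hx : x ∈ R.coisometricPart i) : K.starProjection x ∈ R.coisometricPart i := by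
  rw [mem_coisometricPart_iff] at hx ⊢
  exact fun n => h.starProjection_mem_level (hx n)

theorem Reduces.starProjection_mem_orthogonal_coisometricPart {K : Submodule ℂ H}
    [K.HasOrthogonalProjection] (h : R.Reduces K) {i : Fin k} {x : H}
    (hx : x ∈ (R.coisometricPart i)ᗮ) : K.starProjection x ∈ (R.coisometricPart i)ᗮ := by
  intro u hu
  rw [← Submodule.inner_starProjection_left_eq_right]
  exact hx _ (h.starProjection_mem_coisometricPart hu)

/-! ### The summands of the decomposition -/

variable (R)

open scoped Classical in
/-- The coisometric part of index `i` or its orthogonal complement, according to whether `i ∈ α`. -/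
def factor (α : Finset (Fin k)) (i : Fin k) : Submodule ℂ H :=
  if i ∈ α then (R.coisometricPart i)ᗮ else R.coisometricPart i

theorem factor_of_mem {α : Finset (Fin k)} {i : Fin k} (h : i ∈ α) :
    R.factor α i = (R.coisometricPart i)ᗮ := if_pos h

theorem factor_of_notMem {α : Finset (Fin k)} {i : Fin k} (h : i ∉ α) :
    R.factor α i = R.coisometricPart i := if_neg h

theorem isClosed_factor (α : Finset (Fin k)) (i : Fin k) : IsClosed (R.factor α i : Set H) := by
  by_cases h : i ∈ α
  · rw [factor_of_mem R h]
    exact Submodule.isClosed_orthogonal _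
  · rw [factor_of_notMem R h]
    exact R.isClosed_coisometricPart i

/-- The summand `H_α`: the part of `H` on which `(σ, T⁽ⁱ⁾)` is pure for `i ∈ α` and fully
coisometric for `i ∉ α`. -/
def woldPart (α : Finset (Fin k)) : ClosedSubmodule ℂ H where
  toSubmodule := ⨅ i, R.factor α i
  isClosed' := by
    simp only [Submodule.carrier_eq_coe, Submodule.coe_iInf]
    exact isClosed_iInter fun i => R.isClosed_factor α i

theorem mem_woldPart_iff {α : Finset (Fin k)} {x : H} :
    x ∈ (R.woldPart α).toSubmodule ↔ ∀ i, x ∈ R.factor α i := Submodule.mem_iInf _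

theorem inner_eq_zero_of_mem_woldPart {α β : Finset (Fin k)} (h : α ≠ β) {x y : H}
    (hx : x ∈ (R.woldPart α).toSubmodule) (hy : y ∈ (R.woldPart β).toSubmodule) :
    ⟪x, y⟫_ℂ = 0 := by
  rw [mem_woldPart_iff] at hx hy
  obtain ⟨i, hi⟩ : ∃ i, ¬ (i ∈ α ↔ i ∈ β) := by
    by_contra! h1
    exact h (Finset.ext h1)
  have hxi := hx i
  have hyi := hy i
  by_cases hα : i ∈ α
  · have hβ : i ∉ β := fun hβ => hi (iff_of_true hα hβ)
    rw [factor_of_mem R hα] at hxi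
    rw [factor_of_notMem R hβ] at hyi
    exact Submodule.inner_left_of_mem_orthogonal hyi hxi
  · have hβ : i ∈ β := by_contra fun hβ => hi (iff_of_false hα hβ)
    rw [factor_of_notMem R hα] at hxi
    rw [factor_of_mem R hβ] at hyi
    exact Submodule.inner_right_of_mem_orthogonal hxi hyi

variable {R}

theorem PreservesKernels.reduces_woldPart (hR : R.PreservesKernels) (α : Finset (Fin k)) :
    R.Reduces (R.woldPart α).toSubmodule := by
  refine Reduces.iInf fun i => ?_
  by_cases h : i ∈ α
  · rw [factor_of_mem R h]
    exact (hR.reduces_coisometricPart i).orthogonal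
  · rw [factor_of_notMem R h]
    exact hR.reduces_coisometricPart i

theorem PreservesKernels.starProjection_mem_factor (hR : R.PreservesKernels)
    {α : Finset (Fin k)} (i : Fin k) {j : Fin k} {x : H} (hx : x ∈ R.factor α j) :
    (R.coisometricPart i).starProjection x ∈ R.factor α j := by
  by_cases h : j ∈ α
  · rw [factor_of_mem R h] at hx ⊢
    exact (hR.reduces_coisometricPart i).starProjection_mem_orthogonal_coisometricPart hx
  · rw [factor_of_notMem R h] at hx ⊢
    exact (hR.reduces_coisometricPart i).starProjection_mem_coisometricPart hx

/-- Splitting along `coisometricPart i` and its complement, successively for all `i`. -/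
theorem PreservesKernels.iSup_woldPart (hR : R.PreservesKernels) :
    ⨆ α, (R.woldPart α).toSubmodule = ⊤ := by
  classical
  have key : ∀ s : Finset (Fin k), ⨆ α, ⨅ i ∈ s, R.factor α i = ⊤ := by
    intro s
    induction s using Finset.induction_on with
    | empty => simp
    | insert i s hi ih =>
      rw [eq_top_iff, ← ih]
      refine iSup_le fun α x hx => ?_
      simp only [Submodule.mem_iInf] at hx
      set Q := R.coisometricPart i
      have h1 : Q.starProjection x ∈ ⨅ j ∈ insert i s, R.factor (α.erase i) j := by
        simp only [Submodule.mem_iInf, Finset.mem_insert, forall_eq_or_imp]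
        refine ⟨?_, fun j hj => ?_⟩
        · rw [factor_of_notMem R (by simp)]
          exact Q.starProjection_apply_mem x
        · have h2 : R.factor (α.erase i) j = R.factor α j := by
            have : j ≠ i := fun h => hi (h ▸ hj)
            simp [factor, this]
          rw [h2]
          exact hR.starProjection_mem_factor i (hx j hj)
      have h1' : x - Q.starProjection x ∈ ⨅ j ∈ insert i s, R.factor (insert i α) j := by
        simp only [Submodule.mem_iInf, Finset.mem_insert, forall_eq_or_imp]
        refine ⟨?_, fun j hj => ?_⟩
        · rw [factor_of_mem R (by simp)]
          exact Q.sub_starProjection_mem_orthogonal x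
        · have h2 : R.factor (insert i α) j = R.factor α j := by
            have : j ≠ i := fun h => hi (h ▸ hj)
            simp [factor, this]
          rw [h2]
          exact sub_mem (hx j hj) (hR.starProjection_mem_factor i (hx j hj))
      rw [← add_sub_cancel (Q.starProjection x) x]
      exact add_mem (Submodule.mem_iSup_of_mem (p := fun α => ⨅ j ∈ insert i s, R.factor α j) _ h1)
        (Submodule.mem_iSup_of_mem (p := fun α => ⨅ j ∈ insert i s, R.factor α j) _ h1')
  have := key Finset.univ
  simpa [woldPart] using this

theorem PreservesKernels.isHilbertSum_woldPart (hR : R.PreservesKernels) :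
    IsHilbertSum ℂ (fun α => (R.woldPart α).toSubmodule)
      (fun α => (R.woldPart α).toSubmodule.subtypeₗᵢ) := by
  refine IsHilbertSum.mkInternal _ (fun α β h x y => ?_) ?_
  · exact R.inner_eq_zero_of_mem_woldPart h x.2 y.2
  · rw [hR.iSup_woldPart]
    exact Submodule.le_topologicalClosure _

/-! ### Restrictions to reducing subspaces -/

section Restrict

variable {K : ClosedSubmodule ℂ H} (hK : R.IsReducing K)
include hK

theorem IsReducing.orthogonalProjectionOnto_T (i : Fin k) (ξ : E (Pi.single i 1)) (x : H) :
    K.toSubmodule.orthogonalProjectionOnto (R.T i ξ x) =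
      (R.restrict hK).T i ξ (K.toSubmodule.orthogonalProjectionOnto x) :=
  Subtype.ext (hK.reduces.starProjection_T i ξ x)

theorem IsReducing.mem_level_restrict_iff (n : Fin k → ℕ) (x : K.toSubmodule) :
    x ∈ (R.restrict hK).level n ↔ (x : H) ∈ R.level n := by
  constructor
  · exact fun h => map_mem_level (R := R.restrict hK) (R' := R) K.toSubmodule.subtypeL n
      (fun j _ ξ x => rfl) h
  · intro h
    have := map_mem_level (R := R) (R' := R.restrict hK) K.toSubmodule.orthogonalProjectionOnto n
      (fun j _ ξ x => hK.orthogonalProjectionOnto_T j ξ x) h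
    rwa [Submodule.orthogonalProjectionOnto_mem_subspace_eq_self] at this

theorem IsReducing.mem_orthogonal_level_restrict_iff (n : Fin k → ℕ) (x : K.toSubmodule) :
    x ∈ ((R.restrict hK).level n)ᗮ ↔ (x : H) ∈ (R.level n)ᗮ := by
  constructor
  · intro h u hu
    have h1 := map_mem_level (R := R) (R' := R.restrict hK) K.toSubmodule.orthogonalProjectionOnto n
      (fun j _ ξ x => hK.orthogonalProjectionOnto_T j ξ x) hu
    have h2 := h _ h1
    rwa [Submodule.inner_orthogonalProjectionOnto_eq_of_mem_right] at h2
  · intro h u hu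
    exact h _ ((hK.mem_level_restrict_iff n u).mp hu)

theorem PreservesKernels.restrict (hR : R.PreservesKernels) :
    (R.restrict hK).PreservesKernels := by
  intro i j hij ξ x hx
  rw [hK.mem_orthogonal_level_restrict_iff] at hx ⊢
  exact hR i j hij ξ _ hx

theorem IsReducing.isFullyCoisometric_restrict_iff (i : Fin k) :
    ((R.restrict hK).isIsometricRep i).IsFullyCoisometric ↔
      K.toSubmodule ≤ R.level (Pi.single i 1) := by
  rw [IsIsometricRep.isFullyCoisometric_iff, ← level_single_one, eq_top_iff]
  constructor
  · intro h x hx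
    exact (hK.mem_level_restrict_iff _ ⟨x, hx⟩).mp (h Submodule.mem_top)
  · rintro h x -
    exact (hK.mem_level_restrict_iff _ x).mpr (h x.2)

theorem IsReducing.le_coisometricPart {i : Fin k}
    (h : ((R.restrict hK).isIsometricRep i).IsFullyCoisometric) :
    K.toSubmodule ≤ R.coisometricPart i := by
  intro x hx
  rw [mem_coisometricPart_iff]
  intro n
  induction n generalizing x with
  | zero => rw [Pi.single_zero, level_zero]; exact Submodule.mem_top
  | succ n ih =>
    rw [R.level_single_succ]
    refine (R.isIsometricRep i).mem_imageSpan_of_adjoint_mem (R.isClosed_level _)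
      (fun a _ hx => R.σ_mem_level _ a hx) ?_ fun ξ => ih (hK.reduces.adjoint_mem i ξ x hx)
    rw [← R.level_single_one]
    exact (hK.isFullyCoisometric_restrict_iff i).mp h hx

end Restrict

end IsometricRep

end Reducing

/-! ### Pure representations are induced -/

section HilbertSum

variable {I : Type*} {G : I → Type*} [∀ n, NormedAddCommGroup (G n)]
  [∀ n, InnerProductSpace ℂ (G n)]
variable {H : Type*} [NormedAddCommGroup H] [InnerProductSpace ℂ H] [CompleteSpace H]
variable {V : ∀ n, G n →ₗᵢ[ℂ] H}

theorem linearIsometryEquiv_symm_incl (hV : IsHilbertSum ℂ G V) (n : I) (v : G n) :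
    hV.linearIsometryEquiv.symm (incl n v) = V n v := by
  classical
  rw [← hV.linearIsometryEquiv_symm_apply_single (i := n) v]
  refine congrArg hV.linearIsometryEquiv.symm ?_
  change lp.single 2 n v = lp.single 2 n v
  congr!

/-- The unitary identifying `H` with a Hilbert sum intertwines two operators if these agree on the
summands. -/
theorem linearIsometryEquiv_intertwines (hV : IsHilbertSum ℂ G V) (S : H →L[ℂ] H)
    (S' : lp G 2 →L[ℂ] lp G 2)
    (h : ∀ n v, ∃ m, ∃ w : G m, S' (incl n v) = incl m w ∧ S (V n v) = V m w) (x : H) :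
    hV.linearIsometryEquiv (S x) = S' (hV.linearIsometryEquiv x) := by
  set U := hV.linearIsometryEquiv with hU
  have h1 : U.symm.toContinuousLinearEquiv.toContinuousLinearMap ∘L S' =
      S ∘L U.symm.toContinuousLinearEquiv.toContinuousLinearMap := by
    refine clm_ext_incl fun n v => ?_
    obtain ⟨m, w, h1, h2⟩ := h n v
    change U.symm (S' (incl n v)) = S (U.symm (incl n v))
    rw [h1, linearIsometryEquiv_symm_incl, linearIsometryEquiv_symm_incl, h2]
  have h2 : U.symm (S' (U x)) = S (U.symm (U x)) := congrArg (fun f => f (U x)) h1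
  rw [LinearIsometryEquiv.symm_apply_apply] at h2
  rw [← h2, LinearIsometryEquiv.apply_symm_apply]

end HilbertSum

section Pure

variable {A : Type*} [NonUnitalCStarAlgebra A] [PartialOrder A] [StarOrderedRing A]
variable {k : ℕ} {E : (Fin k → ℕ) → Type*} [∀ n, NormedAddCommGroup (E n)]
  [∀ n, NormedSpace ℂ (E n)] [∀ n, CStarCorrespondence A (E n)] {P : ProductSystem A E}
variable {H : Type*} [NormedAddCommGroup H] [InnerProductSpace ℂ H] [CompleteSpace H]

namespace IsometricRep

variable (R : IsometricRep P (fun i : Fin k => Pi.single i 1) H)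

theorem nondegenerate_restrictStarHom_of_invariant (K : ClosedSubmodule ℂ H)
    (hK : ∀ a, ∀ x ∈ K.toSubmodule, R.σ a x ∈ K.toSubmodule) :
    IsNondegenerate (restrictStarHom R.σ K hK) := by
  -- Reducing `σ` is the same as reducing the representation of the subsystem without generators.
  let S := R.subsystem ⊤ (Empty.elim : Empty → Fin k) (fun j => j.elim)
  have hS : S.IsReducing K := ⟨hK, fun a _ hx => map_orthogonal_of_invariant hK a hx,
    fun j => j.elim, fun j => j.elim⟩
  exact S.nondegenerate_restrictStarHom hS

/-- The wandering subspace for the generators in `α`: the common kernel of the operators `T⁽ⁱ⁾(ξ)*`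
with `i ∈ α`. -/
def wandering (α : Finset (Fin k)) : ClosedSubmodule ℂ H where
  toSubmodule := ⨅ i ∈ α, (R.level (Pi.single i 1))ᗮ
  isClosed' := by
    simp only [Submodule.carrier_eq_coe, Submodule.coe_iInf]
    exact isClosed_biInter fun i _ => Submodule.isClosed_orthogonal _

theorem mem_wandering_iff {α : Finset (Fin k)} {x : H} :
    x ∈ (R.wandering α).toSubmodule ↔ ∀ i ∈ α, x ∈ (R.level (Pi.single i 1))ᗮ := by
  change x ∈ ⨅ i ∈ α, (R.level (Pi.single i 1))ᗮ ↔ _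
  simp only [Submodule.mem_iInf]

theorem σ_mem_wandering (α : Finset (Fin k)) (a : A) :
    ∀ x ∈ (R.wandering α).toSubmodule, R.σ a x ∈ (R.wandering α).toSubmodule := by
  intro x hx
  rw [mem_wandering_iff] at hx ⊢
  exact fun i hi => R.σ_mem_orthogonal_level _ a (hx i hi)

theorem level_le_level_single (n : Fin k → ℕ) (i : Fin k) :
    R.level n ≤ R.level (Pi.single i (n i)) := by
  refine R.level_le_left (n := n - Pi.single i (n i)) (add_tsub_cancel_of_le fun j => ?_)
  by_cases h : j = i
  · subst h
    rw [Pi.single_eq_same]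
  · rw [Pi.single_eq_of_ne h]
    exact Nat.zero_le _

variable {R}

theorem PreservesKernels.extend_wandering_mem (hR : R.PreservesKernels) {α : Finset (Fin k)}
    {i : Fin k} (hi : i ∈ α) (n : Fin k → ℕ) (ξ : E n) {x : H}
    (hx : x ∈ (R.wandering α).toSubmodule) :
    R.extend n ξ x ∈ (R.level (Pi.single i (n i + 1)))ᗮ := by
  induction n using multiIndex_induction with
  | zero =>
    obtain ⟨a, rfl⟩ := P.unit.surjective ξ
    rw [R.extend_unit]
    exact R.σ_mem_orthogonal_level _ a (R.mem_wandering_iff.mp hx i hi)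
  | add j m ih =>
    refine (R.isIsometricRep_extend _).apply_mem_of_total (P.mul_total rfl)
      (Submodule.isClosed_orthogonal _) ?_ ξ
    rintro _ ⟨ξ, η, rfl⟩
    rw [R.extend_single_mul, ContinuousLinearMap.comp_apply]
    by_cases hij : j = i
    · subst hij
      rw [Pi.add_apply, Pi.single_eq_same, add_comm 1]
      exact R.T_self_mem_orthogonal_level j ξ (ih η)
    · rw [Pi.add_apply, Pi.single_eq_of_ne (Ne.symm hij), zero_add]
      exact hR.T_mem_orthogonal_level hij _ ξ (ih η)

theorem PreservesKernels.imageSpan_wandering_le (hR : R.PreservesKernels) {α : Finset (Fin k)}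
    {i : Fin k} (hi : i ∈ α) (n : Fin k → ℕ) {m : ℕ} (hm : n i < m) :
    imageSpan (R.extend n) (R.wandering α).toSubmodule ≤ (R.level (Pi.single i m))ᗮ :=
  imageSpan_le (Submodule.isClosed_orthogonal _) fun ξ _ hx =>
    Submodule.orthogonal_le (R.level_single_antitone i hm) (hR.extend_wandering_mem hi n ξ hx)

theorem imageSpan_wandering_le_level {α : Finset (Fin k)} (i : Fin k) (n : Fin k → ℕ) {m : ℕ}
    (hm : m ≤ n i) :
    imageSpan (R.extend n) (R.wandering α).toSubmodule ≤ R.level (Pi.single i m) :=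
  (imageSpan_mono le_top).trans
    ((R.level_le_level_single n i).trans (R.level_single_antitone i hm))

/-- The translates `T(E n)W` of the wandering subspace, with `n` supported in `α`, are mutually
orthogonal. -/
theorem PreservesKernels.inner_wandering_eq_zero (hR : R.PreservesKernels) {α : Finset (Fin k)}
    {m n : Fin k → ℕ} (hm : m ∈ coordSubmonoid α) (hn : n ∈ coordSubmonoid α) (hmn : m ≠ n)
    {x y : H} (hx : x ∈ imageSpan (R.extend m) (R.wandering α).toSubmodule)
    (hy : y ∈ imageSpan (R.extend n) (R.wandering α).toSubmodule) : ⟪x, y⟫_ℂ = 0 := by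
  obtain ⟨i, hi⟩ := Function.ne_iff.mp hmn
  have hα : i ∈ α := by_contra fun h => hi ((hm i h).trans (hn i h).symm)
  rcases lt_or_gt_of_ne hi with h | h
  · exact Submodule.inner_left_of_mem_orthogonal (imageSpan_wandering_le_level i n le_rfl hy)
      (hR.imageSpan_wandering_le hα m h hx)
  · exact Submodule.inner_right_of_mem_orthogonal (imageSpan_wandering_le_level i m le_rfl hx)
      (hR.imageSpan_wandering_le hα n h hy)

variable (R) in
/-- The vectors orthogonal to all `T(E n)W`, where `W` is the wandering subspace for `α` and `n` is
supported in `α`. -/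
def wanderingCompl (α : Finset (Fin k)) : Submodule ℂ H :=
  ⨅ n ∈ coordSubmonoid α, (imageSpan (R.extend n) (R.wandering α).toSubmodule)ᗮ

theorem mem_wanderingCompl_iff {α : Finset (Fin k)} {x : H} :
    x ∈ R.wanderingCompl α ↔ ∀ n ∈ coordSubmonoid α,
      x ∈ (imageSpan (R.extend n) (R.wandering α).toSubmodule)ᗮ := by
  simp only [wanderingCompl, Submodule.mem_iInf]

/-- The projections onto the subspaces `level (m e_i)`, `i ∈ α`, are diagonal with respect to the
subspaces `T(E n)W`, hence preserve their joint orthogonal complement. -/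
theorem PreservesKernels.starProjection_mem_wanderingCompl (hR : R.PreservesKernels)
    {α : Finset (Fin k)} {i : Fin k} (hi : i ∈ α) (m : ℕ) {x : H} (hx : x ∈ R.wanderingCompl α) :
    (R.level (Pi.single i m)).starProjection x ∈ R.wanderingCompl α := by
  rw [mem_wanderingCompl_iff] at hx ⊢
  intro n hn z hz
  rw [← Submodule.inner_starProjection_left_eq_right]
  rcases le_or_gt m (n i) with h | h
  · rw [Submodule.starProjection_eq_self_iff.mpr (imageSpan_wandering_le_level i n h hz)]
    exact hx n hn z hz
  · rw [(Submodule.starProjection_apply_eq_zero_iff _).mpr (hR.imageSpan_wandering_le hi n h hz),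
      inner_zero_left]

/-- A nonzero vector of `wanderingCompl α` can be cut down, by differences of projections onto the
subspaces `level (m e_i)` with `i` in a subset `s` of `α`, to a nonzero vector of `wanderingCompl α`
which is homogeneous of some degree `n` with respect to `s`. -/
theorem PreservesKernels.exists_mem_wanderingCompl (hR : R.PreservesKernels)
    {α : Finset (Fin k)} (hα : ∀ i ∈ α, R.coisometricPart i = ⊥) {x : H} (hx0 : x ≠ 0)
    (hx : x ∈ R.wanderingCompl α) (s : Finset (Fin k)) (hs : s ⊆ α) :
    ∃ n : Fin k → ℕ, ∃ y ∈ R.wanderingCompl α, y ≠ 0 ∧ (∀ j ∉ s, n j = 0) ∧ y ∈ R.level n ∧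
      ∀ j ∈ s, y ∈ (R.level (Pi.single j (n j + 1)))ᗮ := by
  classical
  induction s using Finset.induction_on with
  | empty =>
    exact ⟨0, x, hx, hx0, fun _ _ => rfl, by rw [level_zero]; exact Submodule.mem_top, by simp⟩
  | insert i s his ih =>
    obtain ⟨n, y, hy, hy0, hn, hyn, hys⟩ := ih fun j hj => hs (Finset.mem_insert_of_mem hj)
    have hi : i ∈ α := hs (Finset.mem_insert_self i s)
    have hni : n i = 0 := hn i his
    have h1 : ∃ m : ℕ, y ∉ R.level (Pi.single i m) := by
      by_contra! h
      rw [← mem_coisometricPart_iff, hα i hi] at h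
      exact hy0 h
    -- The multiplicity of `i` is the last `m` with `y ∈ level (m e_i)`; it exists because
    -- `coisometricPart i` vanishes.
    obtain ⟨m, hm, hm'⟩ : ∃ m : ℕ, y ∈ R.level (Pi.single i m) ∧
        y ∉ R.level (Pi.single i (m + 1)) := by
      by_contra! h
      obtain ⟨m, hm⟩ := h1
      refine hm ?_
      induction m with
      | zero => rw [Pi.single_zero, level_zero]; exact Submodule.mem_top
      | succ m ih => exact h m (by_contra fun h' => h' (ih h'))
    set Q := R.level (Pi.single i (m + 1)) with hQ
    have hQT : ∀ j, j ≠ i → ∀ ξ, ∀ x ∈ Qᗮ, R.T j ξ x ∈ Qᗮ := fun j hj ξ x hx =>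
      hR.T_mem_orthogonal_level hj _ ξ hx
    have hQn : ∀ (l : Fin k → ℕ), l i = 0 → ∀ z ∈ R.level l, Q.starProjection z ∈ R.level l :=
      fun l hl z hz => R.starProjection_mem_level l (fun j _ ξ x hx => R.T_mem_level j ξ hx)
        (fun j hj => hQT j fun h => hj (by rw [h, hl])) hz
    refine ⟨n + Pi.single i m, y - Q.starProjection y,
      sub_mem hy (hR.starProjection_mem_wanderingCompl hi _ hy), fun h => hm' ?_, fun j hj => ?_,
      ?_, fun j hj => ?_⟩
    · rw [sub_eq_zero.mp h]
      exact Q.starProjection_apply_mem y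
    · rw [Finset.mem_insert, not_or] at hj
      rw [Pi.add_apply, hn j hj.2, Pi.single_eq_of_ne hj.1, add_zero]
    · exact hR.mem_level_add hni m (sub_mem hyn (hQn n hni y hyn))
        (sub_mem hm (R.level_single_antitone i (Nat.le_succ m) (Q.starProjection_apply_mem y)))
    · by_cases hji : j = i
      · subst hji
        rw [Pi.add_apply, hni, Pi.single_eq_same, zero_add]
        exact Q.sub_starProjection_mem_orthogonal y
      · have hjs := (Finset.mem_insert.mp hj).resolve_left hji
        rw [Pi.add_apply, Pi.single_eq_of_ne hji, add_zero]
        refine sub_mem (hys j hjs) fun u hu => ?_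
        rw [← Submodule.inner_starProjection_left_eq_right]
        exact hys j hjs _ (hQn _ (Pi.single_eq_of_ne (Ne.symm hji) _) u hu)

/-- If the coisometric parts of index `i ∈ α` vanish, then the translates of the wandering subspace
span the whole space. -/
theorem PreservesKernels.wanderingCompl_eq_bot (hR : R.PreservesKernels)
    {α : Finset (Fin k)} (hα : ∀ i ∈ α, R.coisometricPart i = ⊥) : R.wanderingCompl α = ⊥ := by
  rw [eq_bot_iff]
  intro x hx
  by_contra hx0
  obtain ⟨n, y, hy, hy0, hn, hyn, hyα⟩ := hR.exists_mem_wanderingCompl hα hx0 hx α subset_rfl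
  refine hy0 (Submodule.disjoint_def.mp (Submodule.orthogonal_disjoint _) y ?_
    (mem_wanderingCompl_iff.mp hy n hn))
  refine (R.isIsometricRep_extend n).mem_imageSpan_of_adjoint_mem (R.wandering α).isClosed
    (R.σ_mem_wandering α) hyn fun ξ => R.mem_wandering_iff.mpr fun i hi => ?_
  rw [level_single_one, mem_orthogonal_imageSpan_iff]
  intro η z _
  rw [ContinuousLinearMap.adjoint_inner_right]
  refine hyα i hi _ ?_
  have h1 : R.extend n ξ (R.T i η z) = R.extend _ (P.mul rfl ξ η) z := by
    rw [R.extend_mul rfl, R.extend_single]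
    rfl
  have h2 := R.level_le_level_single (n + Pi.single i 1) i
  rw [Pi.add_apply, Pi.single_eq_same] at h2
  rw [h1]
  exact h2 (apply_mem_imageSpan _ Submodule.mem_top)

/-- If the coisometric parts of index `i ∈ α` vanish, then the representation of the subsystem for
`α` is induced by the restriction of `σ` to the wandering subspace. -/
theorem PreservesKernels.isInduced_subsystem (hR : R.PreservesKernels) {α : Finset (Fin k)}
    (hα : ∀ i ∈ α, R.coisometricPart i = ⊥) :
    (R.subsystem (coordSubmonoid α) (fun i : α => (i : Fin k))
      (single_mem_coordSubmonoid α)).IsInduced := by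
  classical
  let W := R.wandering α
  let π := restrictStarHom R.σ W (R.σ_mem_wandering α)
  let b (n : coordSubmonoid α) : E n →ₗ[ℂ] W.toSubmodule →ₗ[ℂ] H :=
    LinearMap.mk₂ ℂ (fun ξ w => R.extend n ξ w) (by intros; simp) (by intros; simp)
      (by intros; simp) (by intros; simp)
  have hb (n : coordSubmonoid α) (ξ η : E n) (v w : W.toSubmodule) :
      ⟪b n ξ v, b n η w⟫_ℂ = ⟪v, π (rinner A ξ η) w⟫_ℂ :=
    (R.isIsometricRep_extend n).inner_map_map ξ η (v : H) (w : H)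
  let V (n : coordSubmonoid α) : InteriorTensor (E n) π →ₗᵢ[ℂ] H := liftₗᵢ π (b n) (hb n)
  have hV (n : coordSubmonoid α) (ξ : E n) (w : W.toSubmodule) :
      V n (tmul π ξ w) = R.extend n ξ w := liftₗᵢ_tmul π (b n) (hb n) ξ w
  have hVmem (n : coordSubmonoid α) (v : InteriorTensor (E n) π) :
      V n v ∈ imageSpan (R.extend n) W.toSubmodule := by
    induction v using interiorTensor_induction with
    | hc => exact (isClosed_imageSpan _).preimage (V n).continuous
    | h0 => rw [map_zero]; exact zero_mem _
    | ha v w hv hw => rw [map_add]; exact add_mem hv hw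
    | ht ξ w => rw [hV]; exact apply_mem_imageSpan ξ w.2
  have hsum : IsHilbertSum ℂ (fun n : coordSubmonoid α => InteriorTensor (E n) π) V := by
    refine IsHilbertSum.mk (fun m n hmn v w => hR.inner_wandering_eq_zero m.2 n.2
      (fun h => hmn (Subtype.ext h)) (hVmem m v) (hVmem n w)) ?_
    rw [top_le_iff, Submodule.topologicalClosure_eq_top_iff, eq_bot_iff,
      ← hR.wanderingCompl_eq_bot hα]
    intro x hx
    rw [mem_wanderingCompl_iff]
    intro n hn
    rw [mem_orthogonal_imageSpan_iff]
    intro ξ w hw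
    rw [← hV ⟨n, hn⟩ ξ ⟨w, hw⟩]
    exact hx _ (Submodule.mem_iSup_of_mem (p := fun n => LinearMap.range (V n).toLinearMap) ⟨n, hn⟩
      ⟨_, rfl⟩)
  refine ⟨W.toSubmodule, inferInstance, inferInstance, inferInstance, π,
    R.nondegenerate_restrictStarHom_of_invariant _ _, hsum.linearIsometryEquiv, fun a => ?_,
    fun i ξ => ?_⟩
  · refine linearIsometryEquiv_intertwines hsum (R.σ a)
      (inducedσ (fun n : coordSubmonoid α => E n) π a) fun n v =>
      ⟨n, leftRep (E n) π a v,
        inducedσ_incl (E := fun n : coordSubmonoid α => E n) π a n v, ?_⟩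
    have h : R.σ a ∘L (V n).toContinuousLinearMap =
        (V n).toContinuousLinearMap ∘L leftRep (E n) π a := interiorTensor_ext π fun ξ w => by
      change R.σ a (V n (tmul π ξ w)) = V n (leftRep (E n) π a (tmul π ξ w))
      rw [leftRep_tmul, hV, hV, (R.isIsometricRep_extend n).map_lact]
      rfl
    exact congrArg (fun f => f v) h
  · let Q := P.subsystem (coordSubmonoid α)
    let m : coordSubmonoid α := ⟨Pi.single (i : Fin k) 1, single_mem_coordSubmonoid α i⟩
    refine linearIsometryEquiv_intertwines hsum (R.T i ξ) (Q.inducedT π m ξ) fun n v =>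
      ⟨m + n, Q.creation rfl π ξ v, Q.inducedT_incl π rfl ξ v, ?_⟩
    have h : R.T i ξ ∘L (V n).toContinuousLinearMap =
        (V (m + n)).toContinuousLinearMap ∘L Q.creation (n := n) rfl π ξ :=
      interiorTensor_ext π fun η w => by
        change R.T i ξ (V n (tmul π η w)) = V (m + n) (Q.creation rfl π ξ (tmul π η w))
        rw [ProductSystem.creation_tmul, hV, hV]
        exact (congrArg (fun S => S (w : H)) (R.extend_single_mul rfl ξ η)).symm
    exact congrArg (fun f => f v) h

end IsometricRep

end Pure

/-! ### Induced representations are pure -/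

section Shift

variable {I : Type*} {G : I → Type*} [∀ n, NormedAddCommGroup (G n)]
  [∀ n, InnerProductSpace ℂ (G n)]

/-- If `S` maps the `l`-th summand of a Hilbert sum into the `s l`-th one for all `l`, then the
`m`-th component of `S g` only depends on the components of `g` with index in `s ⁻¹ {m}`. -/
theorem apply_eq_zero_of_shift (S : lp G 2 →L[ℂ] lp G 2) (s : I → I)
    (hS : ∀ l v, ∃ w, S (incl l v) = incl (s l) w) {g : lp G 2} {m : I}
    (hg : ∀ l, s l = m → g l = 0) : S g m = 0 := by
  refine ext_inner_left ℂ fun v => ?_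
  rw [inner_zero_right, ← inner_incl_left]
  have h := ((hasSum_incl g).mapL S).mapL (innerSL ℂ (incl m v : lp G 2))
  refine h.unique ?_
  convert hasSum_zero with l
  rw [innerSL_apply_apply]
  by_cases hl : s l = m
  · rw [hg l hl, map_zero, map_zero, inner_zero_right]
  · obtain ⟨w, hw⟩ := hS l (g l)
    rw [hw, inner_incl_left, incl_apply_ne (Ne.symm hl), inner_zero_right]

end Shift

section FockTail

variable {A : Type*} [NonUnitalCStarAlgebra A] [PartialOrder A] [StarOrderedRing A]
variable {M : Type*} [AddCommMonoid M] {E : M → Type*} [∀ n, NormedAddCommGroup (E n)]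
  [∀ n, NormedSpace ℂ (E n)] [∀ n, CStarCorrespondence A (E n)]
variable {K : Type*} [NormedAddCommGroup K] [InnerProductSpace ℂ K] [CompleteSpace K]
variable (π : A →⋆ₙₐ[ℂ] (K →L[ℂ] K)) (d : M → ℕ)

variable (E) in
/-- The vectors of the Fock space all of whose components of degree less than `n` vanish, where `d`
is the degree function. -/
def fockTail (n : ℕ) : Submodule ℂ (FockSpace E π) where
  carrier := {g | ∀ m, d m < n → g m = 0}
  zero_mem' := fun _ _ => rfl
  add_mem' := fun hf hg m hm => by rw [lp.coeFn_add, Pi.add_apply, hf m hm, hg m hm, add_zero]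
  smul_mem' := fun c f hf m hm => by rw [lp.coeFn_smul, Pi.smul_apply, hf m hm, smul_zero]

theorem mem_fockTail_iff_inner {n : ℕ} {g : FockSpace E π} :
    g ∈ fockTail E π d n ↔ ∀ m, d m < n →
      ∀ v : InteriorTensor (E m) π, ⟪(incl m v : FockSpace E π), g⟫_ℂ = 0 := by
  refine forall₂_congr fun m _ => ⟨fun h v => ?_, fun h => ?_⟩
  · rw [inner_incl_left, h, inner_zero_right]
  · refine ext_inner_left ℂ fun v => ?_
    rw [inner_zero_right, ← h v]
    exact (inner_incl_left m v g).symm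

theorem isClosed_fockTail (n : ℕ) : IsClosed (fockTail E π d n : Set (FockSpace E π)) := by
  have : (fockTail E π d n : Set (FockSpace E π)) =
      ⋂ (m) (_ : d m < n) (v : InteriorTensor (E m) π),
        {g | ⟪(incl m v : FockSpace E π), g⟫_ℂ = 0} := by
    ext g
    simp only [Set.mem_iInter, Set.mem_ofPred_eq, SetLike.mem_coe]
    exact mem_fockTail_iff_inner π d
  rw [this]
  refine isClosed_iInter fun m => isClosed_iInter fun _ => isClosed_iInter fun v => ?_
  exact isClosed_eq (by fun_prop) continuous_const

theorem ProductSystem.inducedT_mem_fockTail [IsCancelAdd M] (P : ProductSystem A E) {n : ℕ}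
    {g : FockSpace E π} (hg : g ∈ fockTail E π d n) {e : M} (he : ∀ l, d (e + l) = d l + 1)
    (ξ : E e) : P.inducedT π e ξ g ∈ fockTail E π d (n + 1) := by
  intro m hm
  refine apply_eq_zero_of_shift (G := fun m => InteriorTensor (E m) π) (P.inducedT π e ξ)
    (fun l => e + l) (fun l v => ⟨P.creation rfl π ξ v, P.inducedT_incl π rfl ξ v⟩)
    fun l hl => hg l ?_
  subst hl
  rw [he] at hm
  exact Nat.lt_of_succ_lt_succ hm

end FockTail

section Uniqueness

variable {A : Type*} [NonUnitalCStarAlgebra A] [PartialOrder A] [StarOrderedRing A]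
variable {k : ℕ} {E : (Fin k → ℕ) → Type*} [∀ n, NormedAddCommGroup (E n)]
  [∀ n, NormedSpace ℂ (E n)] [∀ n, CStarCorrespondence A (E n)] {P : ProductSystem A E}
variable {H : Type*} [NormedAddCommGroup H] [InnerProductSpace ℂ H] [CompleteSpace H]

namespace IsometricRep

variable {R : IsometricRep P (fun i : Fin k => Pi.single i 1) H}

/-- A reducing subspace on which the generators in `α` act by an induced representation is
orthogonal to the coisometric parts of index `i ∈ α`. -/
theorem IsReducing.le_orthogonal_coisometricPart {K : ClosedSubmodule ℂ H} (hK : R.IsReducing K)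
    {α : Finset (Fin k)}
    (h : ((R.restrict hK).subsystem (coordSubmonoid α) (fun i : α => (i : Fin k))
      (single_mem_coordSubmonoid α)).IsInduced) {i : Fin k} (hi : i ∈ α) :
    K.toSubmodule ≤ (R.coisometricPart i)ᗮ := by
  obtain ⟨L, _, _, _, π, -, U, -, hU⟩ := h
  let f : H →L[ℂ] FockSpace (fun m : coordSubmonoid α => E m) π :=
    U.toContinuousLinearEquiv.toContinuousLinearMap ∘L K.toSubmodule.orthogonalProjectionOnto
  have hf : ∀ ξ x, f (R.T i ξ x) = (P.subsystem (coordSubmonoid α)).inducedT π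
      ⟨_, single_mem_coordSubmonoid α ⟨i, hi⟩⟩ ξ (f x) := fun ξ x =>
    (congrArg U (hK.orthogonalProjectionOnto_T i ξ x)).trans (hU ⟨i, hi⟩ ξ _)
  let d : coordSubmonoid α → ℕ := fun m => (m : Fin k → ℕ) i
  have hd : ∀ l, d (⟨_, single_mem_coordSubmonoid α ⟨i, hi⟩⟩ + l) = d l + 1 := fun l => by
    change (Pi.single i 1 : Fin k → ℕ) i + d l = d l + 1
    rw [Pi.single_eq_same, add_comm]
  -- Applying the generator `i` raises the `i`-th degree, so that `f` maps the intersection of the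
  -- ranges to vectors all of whose components vanish.
  have hlevel : ∀ n : ℕ, ∀ x ∈ R.level (Pi.single i n),
      f x ∈ fockTail (fun m : coordSubmonoid α => E m) π d n := by
    intro n
    induction n with
    | zero => exact fun x _ m hm => absurd hm (Nat.not_lt_zero _)
    | succ n ih =>
      have h1 : imageSpan (R.T i) (R.level (Pi.single i n)) ≤
          (fockTail (fun m : coordSubmonoid α => E m) π d (n + 1)).comap f.toLinearMap :=
        imageSpan_le ((isClosed_fockTail π d (n + 1)).preimage f.continuous)
          fun ξ x hx => by
            rw [Submodule.mem_comap]
            exact (hf ξ x).symm ▸ (P.subsystem _).inducedT_mem_fockTail π d (ih x hx) hd ξ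
      rw [R.level_single_succ]
      exact fun x hx => h1 hx
  intro y hy x hx
  rw [mem_coisometricPart_iff] at hx
  have h1 : f x = 0 := by
    ext m : 2
    exact hlevel _ x (hx _) m (Nat.lt_succ_self _)
  have h2 : K.toSubmodule.orthogonalProjectionOnto x = 0 := U.injective (h1.trans (map_zero U).symm)
  rw [Submodule.orthogonalProjectionOnto_eq_zero_iff] at h2
  exact Submodule.inner_left_of_mem_orthogonal hy h2

/-- A family of subspaces with the properties of the decomposition is contained in, hence equal to,
the family of the `woldPart α`. -/
theorem eq_woldPart_of_le {K : Finset (Fin k) → ClosedSubmodule ℂ H}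
    (hK : IsHilbertSum ℂ (fun α => (K α).toSubmodule) (fun α => (K α).toSubmodule.subtypeₗᵢ))
    (hle : ∀ α, (K α).toSubmodule ≤ (R.woldPart α).toSubmodule) : K = R.woldPart := by
  funext α
  refine ClosedSubmodule.toSubmodule_injective (le_antisymm (hle α) fun x hx => ?_)
  set y := x - (K α).toSubmodule.starProjection x with hy
  have hyα : y ∈ (R.woldPart α).toSubmodule :=
    sub_mem hx (hle α ((K α).toSubmodule.starProjection_apply_mem x))
  have horth : ∀ β, ∀ z ∈ (K β).toSubmodule, ⟪y, z⟫_ℂ = 0 := by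
    intro β z hz
    by_cases hβ : α = β
    · subst hβ
      exact Submodule.inner_left_of_mem_orthogonal hz
        ((K α).toSubmodule.sub_starProjection_mem_orthogonal x)
    · exact R.inner_eq_zero_of_mem_woldPart hβ hyα (hle β hz)
  have h1 := hK.hasSum_linearIsometryEquiv_symm (hK.linearIsometryEquiv y)
  rw [LinearIsometryEquiv.symm_apply_apply] at h1
  have h2 := h1.mapL (innerSL ℂ y)
  have h3 : ⟪y, y⟫_ℂ = 0 := by
    refine h2.unique ?_
    convert hasSum_zero with β
    exact horth β _ (hK.linearIsometryEquiv y β).2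
  rw [inner_self_eq_zero, hy, sub_eq_zero] at h3
  rw [h3]
  exact (K α).toSubmodule.starProjection_apply_mem x

theorem PreservesKernels.isInduced_restrict_woldPart (hR : R.PreservesKernels)
    (α : Finset (Fin k)) (hα : R.IsReducing (R.woldPart α)) :
    ((R.restrict hα).subsystem (coordSubmonoid α) (fun i : α => (i : Fin k))
      (single_mem_coordSubmonoid α)).IsInduced := by
  refine PreservesKernels.isInduced_subsystem (hR.restrict hα) fun i hi => ?_
  rw [eq_bot_iff]
  intro x hx
  have h1 : (x : H) ∈ R.coisometricPart i := by
    rw [mem_coisometricPart_iff] at hx ⊢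
    exact fun n => (hα.mem_level_restrict_iff _ x).mp (hx n)
  have h2 := (R.mem_woldPart_iff).mp x.2 i
  rw [factor_of_mem R hi] at h2
  exact Subtype.ext (Submodule.disjoint_def.mp (Submodule.orthogonal_disjoint _) _ h1 h2)

end IsometricRep

end Uniqueness

end WoldDecomposition

end

theorem theorem2p3 {A : Type*} [NonUnitalCStarAlgebra A] [PartialOrder A] [StarOrderedRing A]
    {k : ℕ} {E : (Fin k → ℕ) → Type*} [∀ n, NormedAddCommGroup (E n)]
    [∀ n, NormedSpace ℂ (E n)] [∀ n, CStarCorrespondence A (E n)] (P : ProductSystem A E)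
    {H : Type*} [NormedAddCommGroup H] [InnerProductSpace ℂ H] [CompleteSpace H]
    (R : IsometricRep P (fun i : Fin k => Pi.single i 1) H) (hR : R.IsDoublyCommuting) :
    ∃! K : Finset (Fin k) → ClosedSubmodule ℂ H,
      IsHilbertSum ℂ (fun α => (K α).toSubmodule) (fun α => (K α).toSubmodule.subtypeₗᵢ) ∧
      ∀ α, ∃ hα : R.IsReducing (K α),
        ((R.restrict hα).subsystem (coordSubmonoid α) (fun i : α => (i : Fin k))
          (single_mem_coordSubmonoid α)).IsInduced ∧
        ∀ i ∉ α, ((R.restrict hα).isIsometricRep i).IsFullyCoisometric := by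
  have hP := hR.preservesKernels
  refine ⟨R.woldPart, ⟨hP.isHilbertSum_woldPart, fun α => ?_⟩, fun K hK => ?_⟩
  · have hα := (hP.reduces_woldPart α).isReducing
    refine ⟨hα, hP.isInduced_restrict_woldPart α hα, fun i hi => ?_⟩
    rw [hα.isFullyCoisometric_restrict_iff]
    intro x hx
    have h := R.mem_woldPart_iff.mp hx i
    rw [R.factor_of_notMem hi, R.mem_coisometricPart_iff] at h
    exact h 1
  · refine R.eq_woldPart_of_le hK.1 fun α x hx => R.mem_woldPart_iff.mpr fun i => ?_
    obtain ⟨hα, hind, hco⟩ := hK.2 α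
    by_cases hi : i ∈ α
    · rw [R.factor_of_mem hi]
      exact hα.le_orthogonal_coisometricPart hind hi hx
    · rw [R.factor_of_notMem hi]
      exact hα.le_coisometricPart (hco i hi) hx
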